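/- Let $F$ be a nonarchimedean local field, let $G,H,\mathcal E,Z$ be affine algebraic groups over $F$ such that $Z$ is a closed central subgroup of $G$ and of $H$, and let $i:G\times H\to\mathcal E$ be a homomorphism of algebraic groups with kernel $$\mathrm{Ker}(i)=Z^\nabla=\{(z,z^{-1}): z\in Z\}$$ (for example, a reductive dual pair $(G,H)$ in $\mathcal E$ with this property). Fix the following initial data: étale $F$-algebras $K,E$ of finite rank, a closed embedding $j:Z\hookrightarrow T:=\mathrm{Res}_{K/F}\mathbb G_m$, and an embedding $T/j(Z)\hookrightarrow \mathrm{Res}_{E/F}\mathbb G_m$. Put $\tilde G=(G\times T)/\{(z,j(z)^{-1}):z\in Z\}$, and let $\mathrm{sim}_G:\tilde G\to T/j(Z)\hookrightarrow\mathrm{Res}_{E/F}\mathbb G_m$ be induced by the second projection; define $\tilde H$ and $\mathrm{sim}_H$ in the same way. Let $$\tilde J^{\mathrm{sim}}(F)=\{(g,h)\in\tilde G(F)\times\tilde H(F):\ \mathrm{sim}_G(g)\,\mathrm{sim}_H(h)=1\},$$ let $\tilde G(F)^+$ and $\tilde H(F)^+$ be its images under the two projections, and let $\iota:\tilde J^{\mathrm{sim}}(F)\to\mathcal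 E(F)$ be the homomorphism induced by $((g,t),(h,t^{-1}))\mapsto i(g,h)$. If $F$ has positive characteristic, assume moreover that $T(F)G(F)$ has finite index in $\tilde G(F)^+$ and that $T(F)H(F)$ has finite index in $\tilde H(F)^+$ (in characteristic zero this is automatic). Let $\Omega$ be a smooth complex representation of $\mathcal E(F)$ (for example, a minimal representation), regarded as a representation of $G(F)\times H(F)$ via $i$ and of $\tilde J^{\mathrm{sim}}(F)$ via $\iota$. For a topological group $A$, $\mathrm{Irr}(A)$ denotes the irreducible admissible smooth complex representations of $A$, and $\pi^\vee$ the smooth dual of $\pi$. For $\pi\in\mathrm{Irr}(G(F))$ put $\Theta(\pi)=(\Omega\otimes\pi^\vee)_{G(F)}$, a representation of $H(F)$, and for $\tilde\pi\in\mathrm{Irr}(\tilde G(F)^+)$ put $\Theta(\tilde\pi)=(\Omega\otimes\tilde\pi^\vee)_{G(F)}$, a representation of $\tilde H(F)^+=\tilde J^{\mathrm{sim}}(F)/G(F)$, where $\tilde J^{\mathrm{sim}}(F)$ acts on $\tilde\pi^\vee$ through its projection to $\tilde G(F)^+$. Define $\Theta(\sigma)$ for $\sigma\in\mathrm{Irr}(H(F))$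 and $\Theta(\tilde\sigma)$ for $\tilde\sigma\in\mathrm{Irr}(\tilde H(F)^+)$ symmetrically. The pair $(G(F),H(F))$ has the Howe duality property if $\Theta(\pi)$, for every $\pi\in\mathrm{Irr}(G(F))$, and $\Theta(\sigma)$, for every $\sigma\in\mathrm{Irr}(H(F))$, has finite length and, if nonzero, a unique irreducible quotient (i.e. exactly one quotient lying in $\mathrm{Irr}$). The Howe duality property for $(\tilde G(F)^+,\tilde H(F)^+)$ is defined in the same way, with $\Theta(\tilde\pi)$ and $\Theta(\tilde\sigma)$. Then the Howe duality property holds for $(G(F),H(F))$ if and only if it holds for $(\tilde G(F)^+,\tilde H(F)^+)$. -/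

import Mathlib

open scoped TensorProduct MonoidAlgebra

universe u

noncomputable section

/-! ### Smooth representations of topological groups -/

section SmoothReps

variable {A : Type*} [Group A] [TopologicalSpace A]
variable {V : Type*} [AddCommGroup V] [Module ℂ V]

/-- A vector is smooth if it is fixed by an open subgroup. -/
def IsSmoothVector (π : Representation ℂ A V) (v : V) : Prop :=
  ∃ U : OpenSubgroup A, ∀ a ∈ U, π a v = v

/-- A smooth representation: every vector is smooth. -/
def IsSmoothRep (π : Representation ℂ A V) : Prop :=
  ∀ v : V, IsSmoothVector π v

/-- The subspace of vectors fixed by a subgroup. -/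
def fixedVectors (π : Representation ℂ A V) (U : Subgroup A) : Submodule ℂ V where
  carrier := {v | ∀ a ∈ U, π a v = v}
  zero_mem' := fun a _ => map_zero _
  add_mem' := fun {v w} hv hw a ha => by rw [map_add, hv a ha, hw a ha]
  smul_mem' := fun c v hv a ha => by rw [map_smul, hv a ha]

/-- An admissible representation: it is smooth and each open subgroup has only a
finite-dimensional space of fixed vectors. -/
def IsAdmissibleRep (π : Representation ℂ A V) : Prop :=
  IsSmoothRep π ∧ ∀ U : OpenSubgroup A, Module.Finite ℂ (fixedVectors π U.toSubgroup)

/-- Membership in `Irr A`: irreducible, smooth and admissible. (For the rational points of a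
reductive group over a nonarchimedean local field, and for the subgroups of such groups considered
below, every irreducible smooth representation is admissible.) -/
def IsIrrRep (π : Representation ℂ A V) : Prop :=
  π.IsIrreducible ∧ IsAdmissibleRep π

variable [SeparatelyContinuousMul A]

/-- The smooth vectors in the full linear dual of a representation. -/
def smoothDual (π : Representation ℂ A V) : Submodule ℂ (Module.Dual ℂ V) where
  carrier := {f | IsSmoothVector π.dual f}
  zero_mem' := ⟨⊤, fun a _ => map_zero _⟩
  add_mem' := by
    rintro v w ⟨U₁, h₁⟩ ⟨U₂, h₂⟩
    refine ⟨U₁ ⊓ U₂, fun a ha => ?_⟩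
    rw [map_add, h₁ a ha.1, h₂ a ha.2]
  smul_mem' := by
    rintro c v ⟨U, h⟩
    exact ⟨U, fun a ha => by rw [map_smul, h a ha]⟩

theorem smoothDual_le_comap (π : Representation ℂ A V) (a : A) :
    smoothDual π ≤ (smoothDual π).comap (π.dual a) := by
  rintro f ⟨U, hU⟩
  have hc : Continuous (MulAut.conj a⁻¹).toMonoidHom := by
    have h1 : Continuous fun x : A => a⁻¹ * x := SeparatelyContinuousMul.continuous_const_mul
    have h2 : Continuous fun x : A => x * a := SeparatelyContinuousMul.continuous_mul_const
    have h3 := h2.comp h1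
    refine h3.congr fun x => ?_
    simp
  refine ⟨U.comap (MulAut.conj a⁻¹).toMonoidHom hc, fun b hb => ?_⟩
  have hb' : a⁻¹ * b * a ∈ U := by
    simpa [OpenSubgroup.mem_comap] using hb
  have h4 := hU _ hb'
  calc π.dual b (π.dual a f) = π.dual a (π.dual (a⁻¹ * b * a) f) := by
        rw [← Module.End.mul_apply, ← Module.End.mul_apply, ← map_mul, ← map_mul]
        congr 2
        group
    _ = π.dual a f := by rw [h4]

/-- The contragredient representation `π^∨`, on the smooth vectors of the linear dual. -/
def contragredient (π : Representation ℂ A V) : Representation ℂ A (smoothDual π) :=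
  π.dual.subrepresentation (smoothDual π) (smoothDual_le_comap π)

end SmoothReps

/-! ### Big theta lifts

A group `J` with two surjective homomorphisms `p : J → A`, `q : J → B` and a representation `ω` of
`J`. The two cases of interest are `J = G(F) × H(F)` with its two projections, and the group of
pairs in `G̃(F) × H̃(F)` with opposite similitudes, with its projections to `G̃(F)⁺` and `H̃(F)⁺`.
In both cases the kernel of `q` is the subgroup `G(F)` of `J`. -/

section BigTheta

variable {J A B : Type*} [Group J] [Group A] [Group B]
variable [TopologicalSpace A] [SeparatelyContinuousMul A]
variable {Ω V : Type*} [AddCommGroup Ω] [Module ℂ Ω] [AddCommGroup V] [Module ℂ V]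

/-- The representation `Ω ⊗ π^∨` of `J`, where `π` is a representation of `A`. -/
def thetaTensor (p : J →* A) (ω : Representation ℂ J Ω) (π : Representation ℂ A V) :
    Representation ℂ J (Ω ⊗[ℂ] smoothDual π) :=
  ω.tprod ((contragredient π).comp p)

/-- The space of the big theta lift: the coinvariants `(Ω ⊗ π^∨)_{ker q}`. -/
abbrev BigThetaSpace (p : J →* A) (q : J →* B) (ω : Representation ℂ J Ω)
    (π : Representation ℂ A V) : Type _ :=
  Representation.Coinvariants ((thetaTensor p ω π).comp q.ker.subtype)

/-- The big theta lift `Θ(π) = (Ω ⊗ π^∨)_{ker q}` as a representation of `B = J / ker q`. -/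
def bigTheta (p : J →* A) (q : J →* B) (hq : Function.Surjective q)
    (ω : Representation ℂ J Ω) (π : Representation ℂ A V) :
    Representation ℂ B (BigThetaSpace p q ω π) :=
  ((thetaTensor p ω π).quotientToCoinvariants q.ker).comp
    (QuotientGroup.quotientKerEquivOfSurjective q hq).symm.toMonoidHom

end BigTheta

/-- A representation of finite length which, if nonzero, has a unique irreducible quotient: there
is exactly one subrepresentation for which the quotient lies in `Irr B`. -/
def FiniteLengthUniqueQuotient {B W : Type*} [Group B] [TopologicalSpace B]
    [AddCommGroup W] [Module ℂ W] (τ : Representation ℂ B W) : Prop :=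
  IsFiniteLength ℂ[B] τ.asModule ∧
    (Nontrivial W → ∃! N : Subrepresentation τ,
      IsIrrRep (τ.quotient N.toSubmodule fun b _ hv => N.apply_mem_toSubmodule b hv))

/-- The Howe duality property for `A` and `B` with respect to the representation `ω` of `J`: every
`Θ(π)` with `π ∈ Irr A`, and every `Θ(σ)` with `σ ∈ Irr B`, has finite length and, if nonzero,
a unique irreducible quotient. -/
def HoweDualityProperty {J A B Ω : Type u} [Group J] [Group A] [Group B]
    [TopologicalSpace A] [SeparatelyContinuousMul A]
    [TopologicalSpace B] [SeparatelyContinuousMul B] [AddCommGroup Ω] [Module ℂ Ω]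
    (p : J →* A) (hp : Function.Surjective p) (q : J →* B) (hq : Function.Surjective q)
    (ω : Representation ℂ J Ω) : Prop :=
  (∀ (V : Type u) [AddCommGroup V] [Module ℂ V] (π : Representation ℂ A V),
      IsIrrRep π → FiniteLengthUniqueQuotient (bigTheta p q hq ω π)) ∧
  (∀ (V : Type u) [AddCommGroup V] [Module ℂ V] (σ : Representation ℂ B V),
      IsIrrRep σ → FiniteLengthUniqueQuotient (bigTheta q p hp ω σ))

/-! ### Affine algebraic groups -/

/-- An affine algebraic group (affine group scheme of finite type) over `F`, given by its
coordinate ring. -/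
structure AffineAlgebraicGroup (F : Type u) [Field F] where
  /-- the coordinate ring -/
  coord : Type u
  [commRing : CommRing coord]
  [hopfAlgebra : HopfAlgebra F coord]
  [finiteType : Algebra.FiniteType F coord]

attribute [instance] AffineAlgebraicGroup.commRing AffineAlgebraicGroup.hopfAlgebra
  AffineAlgebraicGroup.finiteType

namespace AffineAlgebraicGroup

variable {F : Type u} [Field F]

/-- The group `G(R)` of `R`-points. -/
def Pts (G : AffineAlgebraicGroup F) (R : Type u) [CommRing R] [Algebra F R] : Type u :=
  WithConv (G.coord →ₐ[F] R)

/-- The point of `G(R)` given by a homomorphism from the coordinate ring to `R`. -/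
def pt (G : AffineAlgebraicGroup F) {R : Type u} [CommRing R] [Algebra F R]
    (f : G.coord →ₐ[F] R) : G.Pts R :=
  WithConv.toConv f

/-- Evaluation of regular functions at a point of `G(R)`. -/
def ev (G : AffineAlgebraicGroup F) {R : Type u} [CommRing R] [Algebra F R]
    (g : G.Pts R) : G.coord →ₐ[F] R :=
  WithConv.ofConv g

theorem ext_ev (G : AffineAlgebraicGroup F) {R : Type u} [CommRing R] [Algebra F R]
    {g h : G.Pts R} (H : G.ev g = G.ev h) : g = h :=
  WithConv.ext H

/-- The product of `G(R)` is convolution. -/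
instance ptsMonoid (G : AffineAlgebraicGroup F) (R : Type u) [CommRing R] [Algebra F R] :
    Monoid (G.Pts R) :=
  inferInstanceAs (Monoid (WithConv (G.coord →ₐ[F] R)))

/-- The functoriality of `R ↦ G(R)`. -/
def map (G : AffineAlgebraicGroup F) {R S : Type u} [CommRing R] [Algebra F R] [CommRing S]
    [Algebra F S] (φ : R →ₐ[F] S) : G.Pts R →* G.Pts S where
  toFun g := G.pt (φ.comp (G.ev g))
  map_one' := G.ext_ev (AlgHom.ext fun _ => φ.commutes _)
  map_mul' g h := G.ext_ev (AlgHom.comp_convMul_distrib φ g h)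

/-- The group structure of `G(R)`; inversion is composition with the antipode. -/
instance ptsGroup (G : AffineAlgebraicGroup F) (R : Type u) [CommRing R] [Algebra F R] :
    Group (G.Pts R) where
  inv g := G.pt ((G.ev g).comp (HopfAlgebra.antipodeAlgHom F G.coord))
  inv_mul_cancel g := by
    have h := congrArg (G.map (G.ev g))
      (show G.pt (HopfAlgebra.antipodeAlgHom F G.coord) * G.pt (AlgHom.id F G.coord) = 1 from
        AlgHom.antipode_id_cancel)
    exact ((MonoidHom.map_mul _ _ _).symm.trans h).trans (MonoidHom.map_one _)

section Topology

variable [TopologicalSpace F]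

/-- The topology of `G(F)` for a topological field `F`: the coarsest one for which every regular
function is continuous. -/
instance ptsTopology (G : AffineAlgebraicGroup F) : TopologicalSpace (G.Pts F) :=
  TopologicalSpace.induced (fun g a => G.ev g a) (inferInstance : TopologicalSpace (G.coord → F))

theorem continuous_eval (G : AffineAlgebraicGroup F) (a : G.coord) :
    Continuous fun g : G.Pts F => G.ev g a :=
  (continuous_apply a).comp continuous_induced_dom

instance ptsContinuousMul [IsTopologicalRing F] (G : AffineAlgebraicGroup F) :
    ContinuousMul (G.Pts F) where
  continuous_mul := by
    refine continuous_induced_rng.2 (continuous_pi fun a => ?_)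
    have key : ∀ x : G.coord ⊗[F] G.coord, Continuous fun gh : G.Pts F × G.Pts F =>
        Algebra.TensorProduct.lift (G.ev gh.1) (G.ev gh.2) (fun _ _ => .all ..) x := by
      intro x
      induction x using TensorProduct.induction_on with
      | zero => simpa using continuous_const
      | tmul b c =>
        simp only [Algebra.TensorProduct.lift_tmul]
        exact ((G.continuous_eval b).comp continuous_fst).mul
          ((G.continuous_eval c).comp continuous_snd)
      | add x y hx hy =>
        refine (hx.add hy).congr fun gh => ?_
        exact (map_add _ x y).symm
    refine (key (Coalgebra.comul (R := F) a)).congr fun gh => ?_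
    exact (AlgHom.convMul_apply gh.1 gh.2 a).symm

end Topology

/-- A closed central subgroup `Z ↪ G`: a homomorphism which is surjective on coordinate rings and
whose image is central on points in all `F`-algebras. -/
structure CentralSubgroup (Z G : AffineAlgebraicGroup F) where
  /-- the map of coordinate rings -/
  comap : G.coord →ₐc[F] Z.coord
  surjective : Function.Surjective comap
  central : ∀ (R : Type u) [CommRing R] [Algebra F R] (z : Z.Pts R) (g : G.Pts R),
    Commute (G.pt ((Z.ev z).comp (comap : G.coord →ₐ[F] Z.coord))) g

namespace CentralSubgroup

variable {Z G : AffineAlgebraicGroup F}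

/-- The embedding `Z(R) → G(R)`. -/
def pts (ζ : CentralSubgroup Z G) (R : Type u) [CommRing R] [Algebra F R] :
    Z.Pts R →* G.Pts R where
  toFun z := G.pt ((Z.ev z).comp (ζ.comap : G.coord →ₐ[F] Z.coord))
  map_one' := by
    refine G.ext_ev (AlgHom.ext fun a => ?_)
    change algebraMap F R (Coalgebra.counit (R := F) (ζ.comap a)) =
      algebraMap F R (Coalgebra.counit (R := F) a)
    rw [CoalgHomClass.counit_comp_apply]
  map_mul' z w := G.ext_ev (AlgHom.convMul_comp_bialgHom_distrib z w ζ.comap)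

theorem map_pts (ζ : CentralSubgroup Z G) {R S : Type u} [CommRing R] [Algebra F R] [CommRing S]
    [Algebra F S] (φ : R →ₐ[F] S) (z : Z.Pts R) :
    G.map φ (ζ.pts R z) = ζ.pts S (Z.map φ z) := rfl

end CentralSubgroup

end AffineAlgebraicGroup

open AffineAlgebraicGroup

/-! ### Induced tori -/

section Tori

variable {F : Type u} [Field F]

/-- The points `T(R) = (K ⊗ R)ˣ` of the Weil restriction `T = Res_{K/F} 𝔾_m`. -/
abbrev ResPts (F : Type u) [Field F] (K : Type u) [CommRing K] [Algebra F K] (R : Type u)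
    [CommRing R] [Algebra F R] : Type u :=
  (K ⊗[F] R)ˣ

variable (K : Type u) [CommRing K] [Algebra F K]

/-- The functoriality of `R ↦ (K ⊗ R)ˣ`. -/
def resMap {R S : Type u} [CommRing R] [Algebra F R] [CommRing S] [Algebra F S] (φ : R →ₐ[F] S) :
    ResPts F K R →* ResPts F K S :=
  Units.map (Algebra.TensorProduct.map (AlgHom.id F K) φ : K ⊗[F] R →* K ⊗[F] S)

/-- The coordinate of an element of `K ⊗ R` along a linear form on `K`. -/
def resCoord (R : Type u) [CommRing R] [Algebra F R] (l : K →ₗ[F] F) : K ⊗[F] R →ₗ[F] R :=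
  (TensorProduct.lid F R).toLinearMap ∘ₗ l.rTensor R

/-- The topology of `T(F) = (K ⊗ F)ˣ = Kˣ`, as the unit group of a finite-dimensional algebra over
the topological field `F`. -/
@[reducible] def resTopology [TopologicalSpace F] : TopologicalSpace (ResPts F K F) :=
  letI : TopologicalSpace (K ⊗[F] F) := moduleTopology F (K ⊗[F] F)
  inferInstance

end Tori

/-- Initial data for the construction of similitude groups:
a closed embedding `j : Z ↪ T = Res_{K/F} 𝔾_m` into an induced torus, and an embedding of the
quotient `S = T / j(Z)` into `Res_{E/F} 𝔾_m`, the latter given as a homomorphism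
`s : T → Res_{E/F} 𝔾_m` with kernel `j(Z)`. Homomorphisms of algebraic groups are given as natural
transformations of their functors of points. -/
structure InitialData {F : Type u} [Field F] (Z : AffineAlgebraicGroup F)
    (K E : Type u) [CommRing K] [Algebra F K] [CommRing E] [Algebra F E] where
  /-- the embedding `j` on points -/
  j : ∀ (R : Type u) [CommRing R] [Algebra F R], Z.Pts R →* ResPts F K R
  j_natural : ∀ {R S : Type u} [CommRing R] [Algebra F R] [CommRing S] [Algebra F S]
    (φ : R →ₐ[F] S) (z : Z.Pts R), j S (Z.map φ z) = resMap K φ (j R z)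
  /-- `j` is a closed embedding: the coordinate ring of `Z` is generated by the pullbacks under
  `j` of the coordinates on `T` (those of the universal unit and of its inverse). -/
  j_closed : Algebra.adjoin F {a : Z.coord | ∃ l : K →ₗ[F] F,
    a = resCoord K Z.coord l ↑(j Z.coord (Z.pt (AlgHom.id F Z.coord))) ∨
    a = resCoord K Z.coord l ↑(j Z.coord (Z.pt (AlgHom.id F Z.coord)))⁻¹} = ⊤
  /-- the homomorphism `s` on points -/
  s : ∀ (R : Type u) [CommRing R] [Algebra F R], ResPts F K R →* ResPts F E R
  s_natural : ∀ {R S : Type u} [CommRing R] [Algebra F R] [CommRing S] [Algebra F S]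
    (φ : R →ₐ[F] S) (t : ResPts F K R), s S (resMap K φ t) = resMap E φ (s R t)
  ker_s : ∀ (R : Type u) [CommRing R] [Algebra F R] (t : ResPts F K R),
    s R t = 1 ↔ ∃ z : Z.Pts R, t = j R z

section Similitude

variable {F : Type u} [Field F] {Z G : AffineAlgebraicGroup F}
variable {K E : Type u} [CommRing K] [Algebra F K] [CommRing E] [Algebra F E]

theorem InitialData.j_injective (I : InitialData Z K E) (R : Type u) [CommRing R] [Algebra F R] :
    Function.Injective (I.j R) := by
  have hcoord : ∀ (z : Z.Pts R) (l : K →ₗ[F] F) (x : K ⊗[F] Z.coord),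
      (Z.ev z) (resCoord K Z.coord l x) =
        resCoord K R l (Algebra.TensorProduct.map (AlgHom.id F K) (Z.ev z) x) := by
    intro z l x
    induction x using TensorProduct.induction_on with
    | zero => simp
    | tmul b c => simp [resCoord]
    | add x y hx hy => simp only [map_add, hx, hy]
  have hj : ∀ z : Z.Pts R,
      I.j R z = resMap K (Z.ev z) (I.j Z.coord (Z.pt (AlgHom.id F Z.coord))) := by
    intro z
    exact I.j_natural (Z.ev z) (Z.pt (AlgHom.id F Z.coord))
  intro z w h
  apply Z.ext_ev
  apply AlgHom.ext_of_adjoin_eq_top I.j_closed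
  rw [hj z, hj w] at h
  rintro a ⟨l, rfl | rfl⟩
  · have h' := congrArg (fun t : ResPts F K R => resCoord K R l (t : K ⊗[F] R)) h
    rw [hcoord, hcoord]
    exact h'
  · have h' := congrArg (fun t : ResPts F K R => resCoord K R l ((t⁻¹ : ResPts F K R) : K ⊗[F] R)) h
    rw [hcoord, hcoord]
    exact h'

/-! ### Similitude groups

`G̃ = (G × T) / Z^∇` with `Z^∇ = {(z, j(z)⁻¹)}`. -/

/-- The subgroup `Z^∇(R)` of `G(R) × T(R)`. -/
def nabla (ζ : CentralSubgroup Z G) (I : InitialData Z K E) (R : Type u) [CommRing R]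
    [Algebra F R] : Subgroup (G.Pts R × ResPts F K R) :=
  ((ζ.pts R).prod (I.j R)⁻¹).range

theorem mem_nabla {ζ : CentralSubgroup Z G} {I : InitialData Z K E} {R : Type u} [CommRing R]
    [Algebra F R] {x : G.Pts R × ResPts F K R} :
    x ∈ nabla ζ I R ↔ ∃ z : Z.Pts R, x = (ζ.pts R z, (I.j R z)⁻¹) := by
  constructor
  · rintro ⟨z, rfl⟩
    exact ⟨z, rfl⟩
  · rintro ⟨z, rfl⟩
    exact ⟨z, rfl⟩

instance nabla_normal (ζ : CentralSubgroup Z G) (I : InitialData Z K E) (R : Type u) [CommRing R]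
    [Algebra F R] : (nabla ζ I R).Normal where
  conj_mem := by
    intro x hx y
    obtain ⟨z, rfl⟩ := mem_nabla.1 hx
    refine mem_nabla.2 ⟨z, Prod.ext ?_ ?_⟩
    · have hc : Commute (ζ.pts R z) y.1 := ζ.central R z y.1
      change y.1 * ζ.pts R z * y.1⁻¹ = ζ.pts R z
      rw [← hc.eq, mul_inv_cancel_right]
    · change y.2 * (I.j R z)⁻¹ * y.2⁻¹ = (I.j R z)⁻¹
      rw [mul_comm y.2, mul_inv_cancel_right]

/-- The presheaf quotient `(G(R) × T(R)) / Z^∇(R)`. -/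
abbrev PreSim (ζ : CentralSubgroup Z G) (I : InitialData Z K E) (R : Type u) [CommRing R]
    [Algebra F R] : Type u :=
  (G.Pts R × ResPts F K R) ⧸ nabla ζ I R

/-- The functoriality of the presheaf quotient. -/
def preSimMap (ζ : CentralSubgroup Z G) (I : InitialData Z K E) {R S : Type u} [CommRing R]
    [Algebra F R] [CommRing S] [Algebra F S] (φ : R →ₐ[F] S) : PreSim ζ I R →* PreSim ζ I S :=
  QuotientGroup.map _ _ ((G.map φ).prodMap (resMap K φ)) (by
    intro x hx
    obtain ⟨z, rfl⟩ := mem_nabla.1 hx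
    refine mem_nabla.2 ⟨Z.map φ z, ?_⟩
    exact Prod.ext rfl ((map_inv (resMap K φ) _).trans (by rw [I.j_natural])))

/-- The second projection followed by `s`, on the presheaf quotient. -/
def preSimChar (ζ : CentralSubgroup Z G) (I : InitialData Z K E) (R : Type u) [CommRing R]
    [Algebra F R] : PreSim ζ I R →* ResPts F E R :=
  QuotientGroup.lift _ ((I.s R).comp (MonoidHom.snd _ _)) (by
    intro x hx
    obtain ⟨z, rfl⟩ := mem_nabla.1 hx
    change I.s R (I.j R z)⁻¹ = 1
    rw [map_inv, (I.ker_s R _).2 ⟨z, rfl⟩, inv_one])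

/-- The subgroup of rational elements of `(G(F̄) × T(F̄)) / Z^∇(F̄)`: those whose two pullbacks to
`F̄ ⊗ F̄` agree. -/
def simSubgroup (ζ : CentralSubgroup Z G) (I : InitialData Z K E) :
    Subgroup (PreSim ζ I (AlgebraicClosure F)) :=
  MonoidHom.eqLocus
    (preSimMap ζ I (Algebra.TensorProduct.includeLeft :
      AlgebraicClosure F →ₐ[F] AlgebraicClosure F ⊗[F] AlgebraicClosure F))
    (preSimMap ζ I (Algebra.TensorProduct.includeRight :
      AlgebraicClosure F →ₐ[F] AlgebraicClosure F ⊗[F] AlgebraicClosure F))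

/-- The group `G̃(F)` of rational points of the algebraic group `G̃ = (G × T) / Z^∇`.

`G̃` is the quotient sheaf. Its points over the algebraically closed field `F̄` are
`(G(F̄) × T(F̄)) / Z^∇(F̄)`, and the presheaf quotient injects into `G̃` over every `F`-algebra.
By the sheaf property for the cover `F → F̄`, the group `G̃(F)` consists of the elements of `G̃(F̄)`
whose two pullbacks to `F̄ ⊗ F̄` agree. -/
def SimGroup (ζ : CentralSubgroup Z G) (I : InitialData Z K E) : Type u :=
  ↥(simSubgroup ζ I)

namespace SimGroup

variable (ζ : CentralSubgroup Z G) (I : InitialData Z K E)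

instance : Group (SimGroup ζ I) := inferInstanceAs (Group ↥(simSubgroup ζ I))

/-- The inclusion `G̃(F) → G̃(F̄) = (G(F̄) × T(F̄)) / Z^∇(F̄)`. -/
def incl : SimGroup ζ I →* PreSim ζ I (AlgebraicClosure F) := (simSubgroup ζ I).subtype

/-- The similitude character `sim_G`. Its values are written in `(E ⊗ F̄)ˣ`, which contains the
group `Eˣ` of rational points of `Res_{E/F} 𝔾_m`. -/
def sim : SimGroup ζ I →* ResPts F E (AlgebraicClosure F) :=
  (preSimChar ζ I (AlgebraicClosure F)).comp (incl ζ I)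

/-- The natural map `G(F) × T(F) → G̃(F)`. -/
def proj : G.Pts F × ResPts F K F →* SimGroup ζ I :=
  MonoidHom.codRestrict
    ((QuotientGroup.mk' (nabla ζ I (AlgebraicClosure F))).comp
      ((G.map (Algebra.ofId F (AlgebraicClosure F))).prodMap
        (resMap K (Algebra.ofId F (AlgebraicClosure F)))))
    (simSubgroup ζ I) (by
      intro x
      have h : (Algebra.TensorProduct.includeLeft :
          AlgebraicClosure F →ₐ[F] AlgebraicClosure F ⊗[F] AlgebraicClosure F).comp
            (Algebra.ofId F (AlgebraicClosure F)) =
          (Algebra.TensorProduct.includeRight :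
          AlgebraicClosure F →ₐ[F] AlgebraicClosure F ⊗[F] AlgebraicClosure F).comp
            (Algebra.ofId F (AlgebraicClosure F)) := Subsingleton.elim _ _
      have hG : ∀ (φ : AlgebraicClosure F →ₐ[F] AlgebraicClosure F ⊗[F] AlgebraicClosure F),
          G.map φ (G.map (Algebra.ofId F (AlgebraicClosure F)) x.1) =
            G.map (φ.comp (Algebra.ofId F (AlgebraicClosure F))) x.1 := fun φ => rfl
      have hT : ∀ (φ : AlgebraicClosure F →ₐ[F] AlgebraicClosure F ⊗[F] AlgebraicClosure F),
          resMap K φ (resMap K (Algebra.ofId F (AlgebraicClosure F)) x.2) =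
            resMap K (φ.comp (Algebra.ofId F (AlgebraicClosure F))) x.2 := by
        intro φ
        apply Units.ext
        have := congrArg (fun f : K ⊗[F] F →ₐ[F] K ⊗[F] (AlgebraicClosure F ⊗[F]
          AlgebraicClosure F) => f (x.2 : K ⊗[F] F))
          (Algebra.TensorProduct.map_comp (AlgHom.id F K) (AlgHom.id F K) φ
            (Algebra.ofId F (AlgebraicClosure F)))
        exact this.symm
      refine congrArg (QuotientGroup.mk' (nabla ζ I _)) (Prod.ext ?_ ?_)
      · refine (hG _).trans (Eq.trans ?_ (hG _).symm)
        rw [h]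
      · refine (hT _).trans (Eq.trans ?_ (hT _).symm)
        rw [h])

section Topology

variable [TopologicalSpace F]

/-- The topology of `G̃(F)`, for which the natural map `G(F) × T(F) → G̃(F)` is continuous and open:
the finest topology for which all translates of this map are continuous. (In characteristic zero
`G × T → G̃` is a smooth morphism, hence open on rational points over a nonarchimedean local field, so
that this is the usual topology of the rational points of an algebraic group.) -/
instance : TopologicalSpace (SimGroup ζ I) :=
  letI : TopologicalSpace (ResPts F K F) := resTopology K
  ⨆ gh : SimGroup ζ I × SimGroup ζ I,
    TopologicalSpace.coinduced (fun x : G.Pts F × ResPts F K F => gh.1 * proj ζ I x * gh.2)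
      inferInstance

instance : SeparatelyContinuousMul (SimGroup ζ I) where
  continuous_const_mul := by
    let _ : TopologicalSpace (ResPts F K F) := resTopology K
    intro a
    refine continuous_iSup_dom.2 fun gh => continuous_coinduced_dom.2 ?_
    have h : Continuous fun x : G.Pts F × ResPts F K F => (a * gh.1) * proj ζ I x * gh.2 :=
      continuous_iSup_rng (i := (a * gh.1, gh.2)) continuous_coinduced_rng
    refine h.congr fun x => ?_
    simp only [Function.comp_apply, mul_assoc]
  continuous_mul_const := by
    let _ : TopologicalSpace (ResPts F K F) := resTopology K
    intro a
    refine continuous_iSup_dom.2 fun gh => continuous_coinduced_dom.2 ?_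
    have h : Continuous fun x : G.Pts F × ResPts F K F => gh.1 * proj ζ I x * (gh.2 * a) :=
      continuous_iSup_rng (i := (gh.1, gh.2 * a)) continuous_coinduced_rng
    refine h.congr fun x => ?_
    simp only [Function.comp_apply, mul_assoc]

end Topology

end SimGroup

instance subgroupSeparatelyContinuousMul {A : Type*} [Group A] [TopologicalSpace A]
    [SeparatelyContinuousMul A] (S : Subgroup A) : SeparatelyContinuousMul S where
  continuous_const_mul {a} := by
    have h : Continuous fun x : A => (a : A) * x := SeparatelyContinuousMul.continuous_const_mul
    exact (h.comp continuous_subtype_val).subtype_mk _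
  continuous_mul_const {a} := by
    have h : Continuous fun x : A => x * (a : A) := SeparatelyContinuousMul.continuous_mul_const
    exact (h.comp continuous_subtype_val).subtype_mk _

end Similitude

/-! ### Dual pairs -/

/-- An element of a field extension `L / F` whose two images in `L ⊗ L` agree lies in `F`. -/
theorem exists_algebraMap_eq {F : Type u} [Field F] {L : Type u} [Field L] [Algebra F L] {a : L}
    (h : a ⊗ₜ[F] (1 : L) = (1 : L) ⊗ₜ[F] a) : ∃ c : F, algebraMap F L c = a := by
  obtain ⟨l, hl⟩ : ∃ l : L →ₗ[F] F, l 1 = 1 := by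
    obtain ⟨l, hl⟩ := LinearMap.exists_leftInverse_of_injective (Algebra.linearMap F L)
      (LinearMap.ker_eq_bot.2 (algebraMap F L).injective)
    refine ⟨l, ?_⟩
    have := congrArg (fun f : F →ₗ[F] F => f 1) hl
    simpa using this
  refine ⟨l a, ?_⟩
  have h2 := congrArg (fun x => TensorProduct.lid F L (l.rTensor L x)) h
  simpa [hl, Algebra.smul_def] using h2

/-- A pair of algebraic groups `G`, `H` with a homomorphism `i : G × H → 𝓔` of algebraic groups
whose kernel is `Z^∇ = {(z, z⁻¹)}` for a group `Z` embedded as a closed central subgroup of `G` and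
of `H`. (Reductive dual pairs are the case of interest. That `G` and `H` are reductive and mutual
centralizers in a simple group `𝓔` is not required here.) -/
structure DualPair (F : Type u) [Field F] where
  G : AffineAlgebraicGroup F
  H : AffineAlgebraicGroup F
  /-- the ambient group -/
  𝓔 : AffineAlgebraicGroup F
  Z : AffineAlgebraicGroup F
  ζG : CentralSubgroup Z G
  ζH : CentralSubgroup Z H
  /-- the homomorphism `i` on points -/
  i : ∀ (R : Type u) [CommRing R] [Algebra F R], G.Pts R × H.Pts R →* 𝓔.Pts R
  i_natural : ∀ {R S : Type u} [CommRing R] [Algebra F R] [CommRing S] [Algebra F S]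
    (φ : R →ₐ[F] S) (g : G.Pts R) (h : H.Pts R),
    i S (G.map φ g, H.map φ h) = 𝓔.map φ (i R (g, h))
  ker_i : ∀ (R : Type u) [CommRing R] [Algebra F R] (g : G.Pts R) (h : H.Pts R),
    i R (g, h) = 1 ↔ ∃ z : Z.Pts R, g = ζG.pts R z ∧ h = (ζH.pts R z)⁻¹

namespace DualPair

variable {F : Type u} [Field F] (P : DualPair F)
variable {K E : Type u} [CommRing K] [Algebra F K] [CommRing E] [Algebra F E]
variable (I : InitialData P.Z K E)

/-- `G̃(F)` -/
abbrev Gsim : Type u := SimGroup P.ζG I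

/-- `H̃(F)` -/
abbrev Hsim : Type u := SimGroup P.ζH I

/-- The group `J̃^sim(F)` of pairs `(g, h)` in `G̃(F) × H̃(F)` with `sim_G(g) sim_H(h) = 1`. -/
def Jsim : Subgroup (P.Gsim I × P.Hsim I) :=
  ((SimGroup.sim P.ζG I).comp (MonoidHom.fst _ _) *
    (SimGroup.sim P.ζH I).comp (MonoidHom.snd _ _)).ker

/-- `G̃(F)⁺`, the image of `J̃^sim(F)` in `G̃(F)`. -/
def Gplus : Subgroup (P.Gsim I) := (P.Jsim I).map (MonoidHom.fst _ _)

/-- `H̃(F)⁺`, the image of `J̃^sim(F)` in `H̃(F)`. -/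
def Hplus : Subgroup (P.Hsim I) := (P.Jsim I).map (MonoidHom.snd _ _)

/-- The surjection `J̃^sim(F) → G̃(F)⁺`. -/
def toGplus : P.Jsim I →* P.Gplus I := (MonoidHom.fst _ _).subgroupMap (P.Jsim I)

/-- The surjection `J̃^sim(F) → H̃(F)⁺`. -/
def toHplus : P.Jsim I →* P.Hplus I := (MonoidHom.snd _ _).subgroupMap (P.Jsim I)

theorem toGplus_surjective : Function.Surjective (P.toGplus I) :=
  MonoidHom.subgroupMap_surjective _ _

theorem toHplus_surjective : Function.Surjective (P.toHplus I) :=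
  MonoidHom.subgroupMap_surjective _ _

/-- The subgroups `T(F) G(F)` of `G̃(F)⁺` and `T(F) H(F)` of `H̃(F)⁺` have finite index. -/
def FiniteIndex : Prop :=
  (SimGroup.proj P.ζG I).range.relIndex (P.Gplus I) ≠ 0 ∧
    (SimGroup.proj P.ζH I).range.relIndex (P.Hplus I) ≠ 0

variable {I} in
theorem i_eq_of_eq {R : Type u} [CommRing R] [Algebra F R] {g g' : P.G.Pts R} {h h' : P.H.Pts R}
    {t t' : ResPts F K R}
    (hg : (QuotientGroup.mk (g, t) : PreSim P.ζG I R) = QuotientGroup.mk (g', t'))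
    (hh : (QuotientGroup.mk (h, t⁻¹) : PreSim P.ζH I R) = QuotientGroup.mk (h', t'⁻¹)) :
    P.i R (g, h) = P.i R (g', h') := by
  obtain ⟨z, hz⟩ := mem_nabla.1 (QuotientGroup.eq.1 hg)
  obtain ⟨w, hw⟩ := mem_nabla.1 (QuotientGroup.eq.1 hh)
  have hz1 : g⁻¹ * g' = P.ζG.pts R z := congrArg Prod.fst hz
  have hz2 : t⁻¹ * t' = (I.j R z)⁻¹ := congrArg Prod.snd hz
  have hw1 : h⁻¹ * h' = P.ζH.pts R w := congrArg Prod.fst hw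
  have hw2 : (t⁻¹)⁻¹ * t'⁻¹ = (I.j R w)⁻¹ := congrArg Prod.snd hw
  have hzw : w = z⁻¹ := by
    apply I.j_injective R
    rw [map_inv, ← hz2, ← inv_inj, ← hw2, mul_inv]
  have hker : P.i R (g⁻¹ * g', h⁻¹ * h') = 1 :=
    (P.ker_i R _ _).2 ⟨z, hz1, by rw [hw1, hzw, map_inv]⟩
  have hmul : P.i R (g', h') = P.i R (g, h) * P.i R (g⁻¹ * g', h⁻¹ * h') := by
    rw [← map_mul, Prod.mk_mul_mk, mul_inv_cancel_left, mul_inv_cancel_left]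
  rw [hmul, hker, mul_one]

/-- The relation `ι(x) = e` between `x ∈ J̃^sim(F)` and `e ∈ 𝓔(F)`: over the algebraic closure,
`x` is the class of `((g, t), (h, t⁻¹))` and `i(g, h) = e`. -/
def IotaRel (x : P.Jsim I) (e : P.𝓔.Pts F) : Prop :=
  ∃ (g : P.G.Pts (AlgebraicClosure F)) (h : P.H.Pts (AlgebraicClosure F))
    (t : ResPts F K (AlgebraicClosure F)),
    SimGroup.incl P.ζG I x.1.1 = QuotientGroup.mk (g, t) ∧
    SimGroup.incl P.ζH I x.1.2 = QuotientGroup.mk (h, t⁻¹) ∧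
    P.i (AlgebraicClosure F) (g, h) = P.𝓔.map (Algebra.ofId F (AlgebraicClosure F)) e

theorem exists_iotaRel (x : P.Jsim I) : ∃ e, P.IotaRel I x e := by
  obtain ⟨⟨x₁, x₂⟩, hx⟩ := x
  obtain ⟨⟨g, t⟩, hgt⟩ := QuotientGroup.mk_surjective (SimGroup.incl P.ζG I x₁)
  obtain ⟨⟨h₀, t'⟩, hht⟩ := QuotientGroup.mk_surjective (SimGroup.incl P.ζH I x₂)
  have hs : I.s (AlgebraicClosure F) (t * t') = 1 := by
    have h1 : SimGroup.sim P.ζG I x₁ * SimGroup.sim P.ζH I x₂ = 1 := hx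
    have h2 : SimGroup.sim P.ζG I x₁ = I.s (AlgebraicClosure F) t := by
      change preSimChar P.ζG I _ (SimGroup.incl P.ζG I x₁) = _
      rw [← hgt]
      rfl
    have h3 : SimGroup.sim P.ζH I x₂ = I.s (AlgebraicClosure F) t' := by
      change preSimChar P.ζH I _ (SimGroup.incl P.ζH I x₂) = _
      rw [← hht]
      rfl
    rw [map_mul, ← h2, ← h3, h1]
  obtain ⟨z, hz⟩ := (I.ker_s _ _).1 hs
  have hh : SimGroup.incl P.ζH I x₂ =
      QuotientGroup.mk (h₀ * P.ζH.pts (AlgebraicClosure F) z, t⁻¹) := by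
    rw [← hht]
    refine QuotientGroup.eq.2 (mem_nabla.2 ⟨z, Prod.ext ?_ ?_⟩)
    · exact inv_mul_cancel_left _ _
    · change t'⁻¹ * t⁻¹ = (I.j _ z)⁻¹
      rw [← hz, mul_inv, mul_comm]
  set h := h₀ * P.ζH.pts (AlgebraicClosure F) z
  have hdesc : P.𝓔.map (Algebra.TensorProduct.includeLeft :
        AlgebraicClosure F →ₐ[F] AlgebraicClosure F ⊗[F] AlgebraicClosure F) (P.i _ (g, h)) =
      P.𝓔.map (Algebra.TensorProduct.includeRight :
        AlgebraicClosure F →ₐ[F] AlgebraicClosure F ⊗[F] AlgebraicClosure F) (P.i _ (g, h)) := by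
    rw [← P.i_natural, ← P.i_natural]
    have e1 := x₁.2
    have e2 := x₂.2
    change preSimMap P.ζG I _ (SimGroup.incl P.ζG I x₁) =
      preSimMap P.ζG I _ (SimGroup.incl P.ζG I x₁) at e1
    change preSimMap P.ζH I _ (SimGroup.incl P.ζH I x₂) =
      preSimMap P.ζH I _ (SimGroup.incl P.ζH I x₂) at e2
    rw [← hgt] at e1
    rw [hh] at e2
    refine P.i_eq_of_eq (I := I) (t := resMap K _ t) (t' := resMap K _ t) e1 ?_
    rw [← map_inv, ← map_inv]
    exact e2
  have hrange : ∀ a : P.𝓔.coord, (P.𝓔.ev (P.i (AlgebraicClosure F) (g, h))) a ∈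
      (Algebra.ofId F (AlgebraicClosure F)).range := by
    intro a
    have h1 := congrArg (fun y : P.𝓔.Pts (AlgebraicClosure F ⊗[F] AlgebraicClosure F) =>
      P.𝓔.ev y a) hdesc
    obtain ⟨c, hc⟩ := exists_algebraMap_eq (F := F) (L := AlgebraicClosure F) h1
    exact ⟨c, hc⟩
  have hinj : Function.Injective (Algebra.ofId F (AlgebraicClosure F)) :=
    (algebraMap F (AlgebraicClosure F)).injective
  let e₀ : P.𝓔.coord →ₐ[F] F :=
    ((AlgEquiv.ofInjective _ hinj).symm : _ →ₐ[F] F).comp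
      ((P.𝓔.ev (P.i (AlgebraicClosure F) (g, h))).codRestrict _ hrange)
  refine ⟨P.𝓔.pt e₀, g, h, t, hgt.symm, hh, ?_⟩
  refine P.𝓔.ext_ev (AlgHom.ext fun a => ?_)
  have := congrArg Subtype.val ((AlgEquiv.ofInjective _ hinj).apply_symm_apply
      ((P.𝓔.ev (P.i (AlgebraicClosure F) (g, h))).codRestrict _ hrange a))
  exact this.symm

theorem iotaRel_unique {x : P.Jsim I} {e e' : P.𝓔.Pts F} (he : P.IotaRel I x e)
    (he' : P.IotaRel I x e') : e = e' := by
  obtain ⟨g, h, t, h1, h2, h3⟩ := he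
  obtain ⟨g', h', t', h1', h2', h3'⟩ := he'
  have h4 := P.i_eq_of_eq (I := I) (h1.symm.trans h1') (h2.symm.trans h2')
  rw [h3, h3'] at h4
  refine P.𝓔.ext_ev (AlgHom.ext fun a => ?_)
  apply (algebraMap F (AlgebraicClosure F)).injective
  exact congrArg (fun y : P.𝓔.Pts (AlgebraicClosure F) => P.𝓔.ev y a) h4

/-- The homomorphism `ι : J̃^sim(F) → 𝓔(F)`, `((g, t), (h, t⁻¹)) ↦ i(g, h)`. -/
def iota : P.Jsim I →* P.𝓔.Pts F :=
  MonoidHom.mk' (fun x => (P.exists_iotaRel I x).choose) (by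
    intro x y
    refine P.iotaRel_unique I (P.exists_iotaRel I (x * y)).choose_spec ?_
    obtain ⟨g, h, t, h1, h2, h3⟩ := (P.exists_iotaRel I x).choose_spec
    obtain ⟨g', h', t', h1', h2', h3'⟩ := (P.exists_iotaRel I y).choose_spec
    refine ⟨g * g', h * h', t * t', ?_, ?_, ?_⟩
    · change SimGroup.incl P.ζG I (x.1.1 * y.1.1) = _
      rw [map_mul, h1, h1']
      rfl
    · change SimGroup.incl P.ζH I (x.1.2 * y.1.2) = _
      rw [map_mul, h2, h2', mul_inv]
      rfl
    · rw [map_mul, ← h3, ← h3', ← map_mul]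
      rfl)

variable [TopologicalSpace F]
variable {Ω : Type u} [AddCommGroup Ω] [Module ℂ Ω]

/-- The Howe duality property for `(G(F), H(F))`: here `Θ(π) = (Ω ⊗ π^∨)_{G(F)}`, where
`G(F) × H(F)` acts on `Ω` through `i`. -/
def HoweDuality [IsTopologicalRing F] (ω : Representation ℂ (P.𝓔.Pts F) Ω) : Prop :=
  HoweDualityProperty (MonoidHom.fst (P.G.Pts F) (P.H.Pts F)) Prod.fst_surjective
    (MonoidHom.snd (P.G.Pts F) (P.H.Pts F)) Prod.snd_surjective (ω.comp (P.i F))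

/-- The Howe duality property for `(G̃(F)⁺, H̃(F)⁺)`: here `Θ(π̃) = (Ω ⊗ π̃^∨)_{G(F)}`, where
`J̃^sim(F)` acts on `Ω` through `ι` and `G(F)` is the kernel of `J̃^sim(F) → H̃(F)⁺`. -/
def SimilitudeHoweDuality (ω : Representation ℂ (P.𝓔.Pts F) Ω) : Prop :=
  HoweDualityProperty (P.toGplus I) (P.toGplus_surjective I)
    (P.toHplus I) (P.toHplus_surjective I) (ω.comp (P.iota I))

end DualPair

end

/-!
Write `A = G̃(F)⁺` and `B = H̃(F)⁺`. By double duality every irreducible admissible representation is a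
contragredient, so Howe duality may be stated for the lifts `(Ω ⊗ ρ)_{G(F)}`; a quotient of such a lift
is the same as an equivariant bilinear map `Ω × ρ → τ` whose values span `τ` (`Pairing`). The relation
between the two dual pairs that matters is isolated in `ThetaExt`: the kernels of the projections of
`J̃^sim(F)` are those of `G(F) × H(F)`, and the central torus `{(t, t⁻¹)}` acts trivially on `Ω`. In
`CentralExt`, `A` is generated up to finite index by `G(F)` and the central torus `T(F)`. The equivalence
is `ThetaExt.howeDualityProperty_iff`.

Since `G(F) T(F)` has finite index in `A` and `T(F)` acts on irreducible representations by scalars, an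
irreducible representation of `A` is semisimple of finite length over `G(F)`, and conversely
semisimplicity over `G(F)` implies semisimplicity over `A`. Central characters of `Z(F)` extend to
smooth characters of `T(F)`, as `ℂˣ` is divisible, so induction shows that every irreducible
representation of `G(F)` is a summand of one of `A` (`CentralExt.exists_isIrrRep_retract`). Both
directions are then comparisons of lengths.

* From `(G(F), H(F))` to `(A, B)`. Howe duality over `G(F) × H(F)` bounds the length over `H(F)` of a
  semisimple `τ` spanned by the values of a pairing `Ω × ρ → τ` by the length of `ρ` over `G(F)`
  (`Pairing.length_le_of_spanning`). The transposed pairing with contragredients gives the opposite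
  inequality when the pairing has no kernel in `ρ` (`Pairing.length_le_of_separating`). If `σ₁` and `σ₂`
  are irreducible quotients of the lift of `ρ`, then the image of the lift in `σ₁ ⊕ σ₂` has length at
  most that of `ρ`, which is at most that of `σ₁` and of `σ₂`; so the two quotients coincide.

* From `(A, B)` to `(G(F), H(F))`. Let `σ` be the unique irreducible quotient of the lift of `ρ`. A pairing
  of `ρ` over `G(F) × H(F)` with a semisimple `υ` factors through `σ`: the intersection of the
  `B`-translates of its kernel in the lift has a semisimple quotient over `B`, which is `σ` or zero
  (`ThetaExt.exists_factor`). Hence endomorphisms of `ρ` over `G(F)` are realized on `σ`, distinct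
  subrepresentations of `ρ` span distinct subrepresentations of `σ`, and, by symmetry, `ρ` and `σ` have
  equal lengths over `G(F)` and `H(F)`. For a summand `π` of `ρ`, comparing the kernel of `ρ → π` with
  that of `σ → υ` shows that a semisimple quotient `υ` of the lift of `π` has length at most one.

The topological requirements follow from van Dantzig's theorem, together with the fact that the map
`G(F) × T(F) → G̃(F)` is open onto its image.

In characteristic zero the finiteness of the index is proved for `G̃(F)` itself. The similitude character
embeds `G̃(F) / G(F) T(F)` into `Y / s(T(F))`, where `s` is the map `T → Res_{E/F} 𝔾_m` and `Y` is the
group of rational points of its image. Over a finite Galois extension splitting `K` and `E`, the map `s`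
is given by an integer matrix. A generalized inverse of that matrix, made rational by the norm, gives an
endomorphism of `(E ⊗ F)ˣ` with values in `s(T(F))` which is `y ↦ y ^ N` on `Y`. As `N`-th powers have
finite index in `(E ⊗ F)ˣ` and its `N`-torsion is finite, `s(T(F))` has finite index in `Y`.
-/

noncomputable section

open AffineAlgebraicGroup

/-! ### Length and semisimplicity of representations -/

section Length

open Representation

variable {G : Type*} [Group G]
variable {V W X : Type*} [AddCommGroup V] [Module ℂ V] [AddCommGroup W] [Module ℂ W]
  [AddCommGroup X] [Module ℂ X]
variable {σ : Representation ℂ G V} {τ : Representation ℂ G W} {υ : Representation ℂ G X}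

/-- The quotient of a representation by a subrepresentation. -/
abbrev Subrepresentation.quot (N : Subrepresentation τ) :
    Representation ℂ G (W ⧸ N.toSubmodule) :=
  τ.quotient N.toSubmodule fun b _ hv => N.apply_mem_toSubmodule b hv

/-- The projection onto the quotient by a subrepresentation. -/
def Subrepresentation.mkQ (N : Subrepresentation τ) : IntertwiningMap τ N.quot where
  toLinearMap := N.toSubmodule.mkQ
  isIntertwining' _ := rfl

theorem Subrepresentation.mkQ_surjective (N : Subrepresentation τ) :
    Function.Surjective N.mkQ :=
  N.toSubmodule.mkQ_surjective

theorem Subrepresentation.mkQ_eq_zero {N : Subrepresentation τ} {w : W} :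
    N.mkQ w = 0 ↔ w ∈ N :=
  Submodule.Quotient.mk_eq_zero _

/-- The inclusion of a subrepresentation. -/
def Subrepresentation.incl (N : Subrepresentation τ) :
    IntertwiningMap N.toRepresentation τ where
  toLinearMap := N.toSubmodule.subtype
  isIntertwining' _ := rfl

theorem Subrepresentation.incl_injective (N : Subrepresentation τ) :
    Function.Injective N.incl :=
  Subtype.val_injective

/-- An intertwining map which kills a subrepresentation factors through the quotient. -/
def Subrepresentation.liftQ (N : Subrepresentation σ) (φ : IntertwiningMap σ τ)
    (h : ∀ v ∈ N, φ v = 0) : IntertwiningMap N.quot τ where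
  toLinearMap := N.toSubmodule.liftQ φ.toLinearMap h
  isIntertwining' g := by
    refine Submodule.linearMap_qext _ (LinearMap.ext fun v => ?_)
    exact φ.isIntertwining _ _ g v

/-- An intertwining map with values in a subrepresentation. -/
def Representation.IntertwiningMap.codRestrict (φ : IntertwiningMap σ τ) (N : Subrepresentation τ)
    (h : ∀ v, φ v ∈ N) : IntertwiningMap σ N.toRepresentation where
  toLinearMap := φ.toLinearMap.codRestrict N.toSubmodule h
  isIntertwining' g := by
    refine LinearMap.ext fun v => Subtype.ext ?_
    exact φ.isIntertwining _ _ g v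

/-- An intertwining map for `G`, regarded as one for a group mapping to `G`. -/
def Representation.IntertwiningMap.res {H : Type*} [Group H] (φ : IntertwiningMap σ τ)
    (f : H →* G) : IntertwiningMap (σ.comp f) (τ.comp f) where
  toLinearMap := φ.toLinearMap
  isIntertwining' h := φ.isIntertwining' (f h)

/-- A subrepresentation is stable under every group mapping to the given one. -/
def Subrepresentation.res {H : Type*} [Group H] (N : Subrepresentation τ) (f : H →* G) :
    Subrepresentation (τ.comp f) where
  toSubmodule := N.toSubmodule
  apply_mem_toSubmodule h _ hv := N.apply_mem_toSubmodule (f h) hv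

namespace Representation

/-- The length of a representation. -/
def length (σ : Representation ℂ G V) : ℕ∞ :=
  Module.length ℂ[G] σ.asModule

theorem length_ne_top_iff : σ.length ≠ ⊤ ↔ IsFiniteLength ℂ[G] σ.asModule :=
  Module.length_ne_top_iff

theorem length_le_of_injective (φ : IntertwiningMap σ τ) (h : Function.Injective φ) :
    σ.length ≤ τ.length :=
  Module.length_le_of_injective (IntertwiningMap.equivLinearMapAsModule σ τ φ) h

theorem length_le_of_surjective (φ : IntertwiningMap σ τ) (h : Function.Surjective φ) :
    τ.length ≤ σ.length :=
  Module.length_le_of_surjective (IntertwiningMap.equivLinearMapAsModule σ τ φ) h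

theorem length_eq_add (φ : IntertwiningMap σ τ) (ψ : IntertwiningMap τ υ)
    (h₁ : Function.Injective φ) (h₂ : Function.Surjective ψ) (h : Function.Exact φ ψ) :
    τ.length = σ.length + υ.length :=
  Module.length_eq_add_of_exact (IntertwiningMap.equivLinearMapAsModule σ τ φ)
    (IntertwiningMap.equivLinearMapAsModule τ υ ψ) h₁ h₂ h

theorem length_eq_sub_add_quot (N : Subrepresentation τ) :
    τ.length = N.toRepresentation.length + N.quot.length :=
  length_eq_add N.incl N.mkQ N.incl_injective N.mkQ_surjective fun w =>
    Subrepresentation.mkQ_eq_zero.trans ⟨fun h => ⟨⟨w, h⟩, rfl⟩, fun ⟨x, hx⟩ => hx ▸ x.2⟩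

theorem length_eq_zero_iff : σ.length = 0 ↔ Subsingleton V :=
  Module.length_eq_zero_iff

theorem length_eq_one_iff : σ.length = 1 ↔ σ.IsIrreducible :=
  Module.length_eq_one_iff.trans (irreducible_iff_isSimpleModule_asModule σ).symm

theorem length_eq_height : σ.length = Order.height (⊤ : Subrepresentation σ) := by
  rw [length, Module.length_eq_height,
    ← Order.height_orderIso Subrepresentation.subrepresentationSubmoduleOrderIso, OrderIso.map_top]

theorem length_eq_coheight : σ.length = Order.coheight (⊥ : Subrepresentation σ) := by
  rw [length, Module.length_eq_coheight,
    ← Order.coheight_orderIso Subrepresentation.subrepresentationSubmoduleOrderIso,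
    OrderIso.map_bot]

theorem IsSemisimpleRepresentation.of_injective (hτ : τ.IsSemisimpleRepresentation)
    (φ : IntertwiningMap σ τ) (h : Function.Injective φ) : σ.IsSemisimpleRepresentation := by
  rw [isSemisimpleRepresentation_iff_isSemisimpleModule_asModule] at hτ ⊢
  exact IsSemisimpleModule.of_injective (IntertwiningMap.equivLinearMapAsModule σ τ φ) h

theorem IsIrreducible.isSemisimpleRepresentation (h : σ.IsIrreducible) :
    σ.IsSemisimpleRepresentation := by
  have := (irreducible_iff_isSimpleModule_asModule σ).1 h
  rw [isSemisimpleRepresentation_iff_isSemisimpleModule_asModule]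
  infer_instance

theorem IsIrreducible.nontrivial (h : σ.IsIrreducible) : Nontrivial V := by
  by_contra hV
  rw [not_nontrivial_iff_subsingleton] at hV
  have := length_eq_one_iff.2 h
  rw [length_eq_zero_iff.2 hV] at this
  exact zero_ne_one this

theorem IsIrreducible.eq_bot_or_eq_top (h : σ.IsIrreducible) (N : Subrepresentation σ) :
    N = ⊥ ∨ N = ⊤ :=
  IsSimpleOrder.eq_bot_or_eq_top N

theorem isIrreducible_quot_iff {N : Subrepresentation τ} :
    N.quot.IsIrreducible ↔ IsCoatom N := by
  let φ := IntertwiningMap.equivLinearMapAsModule τ N.quot N.mkQ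
  have hφ : Function.Surjective φ := N.mkQ_surjective
  have hk : LinearMap.ker φ = Subrepresentation.subrepresentationSubmoduleOrderIso N := by
    refine Submodule.ext fun w => ?_
    exact Subrepresentation.mkQ_eq_zero (W := W) (N := N) (w := w)
  have h1 := (φ.quotKerEquivOfSurjective hφ).isSimpleModule_iff
  rw [irreducible_iff_isSimpleModule_asModule]
  rw [hk] at h1
  exact h1.symm.trans (isSimpleModule_iff_isCoatom.trans (OrderIso.isCoatom_iff _ _))

theorem exists_isIrreducible_quot [Nontrivial V] (h : σ.length ≠ ⊤) :
    ∃ N : Subrepresentation σ, N.quot.IsIrreducible := by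
  have h' := isFiniteLength_iff_isNoetherian_isArtinian.1 (length_ne_top_iff.1 h)
  have := h'.1
  have : Nontrivial σ.asModule := inferInstanceAs (Nontrivial V)
  obtain ⟨m, hm, -⟩ := IsCoatomic.eq_top_or_exists_le_coatom
    (⊥ : Submodule ℂ[G] σ.asModule) |>.resolve_left bot_ne_top
  refine ⟨Subrepresentation.subrepresentationSubmoduleOrderIso.symm m, ?_⟩
  rw [isIrreducible_quot_iff, OrderIso.isCoatom_iff]
  exact hm

theorem isIrreducible_sub_iff {N : Subrepresentation τ} :
    N.toRepresentation.IsIrreducible ↔ IsAtom N := by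
  let φ := IntertwiningMap.equivLinearMapAsModule N.toRepresentation τ N.incl
  have hφ : Function.Injective φ := N.incl_injective
  have hk : LinearMap.range φ = Subrepresentation.subrepresentationSubmoduleOrderIso N := by
    ext w
    exact ⟨fun ⟨x, hx⟩ => hx ▸ x.2, fun h => ⟨⟨w, h⟩, rfl⟩⟩
  have h1 := (LinearEquiv.ofInjective φ hφ).isSimpleModule_iff
  rw [irreducible_iff_isSimpleModule_asModule]
  refine h1.trans (isSimpleModule_iff_isAtom.trans ?_)
  rw [hk, OrderIso.isAtom_iff]

theorem exists_isIrreducible_sub [Nontrivial V] (h : σ.length ≠ ⊤) :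
    ∃ N : Subrepresentation σ, N.toRepresentation.IsIrreducible := by
  have h' := isFiniteLength_iff_isNoetherian_isArtinian.1 (length_ne_top_iff.1 h)
  have := h'.2
  have : Nontrivial σ.asModule := inferInstanceAs (Nontrivial V)
  obtain ⟨m, hm, -⟩ := IsAtomic.eq_bot_or_exists_atom_le
    (⊤ : Submodule ℂ[G] σ.asModule) |>.resolve_left top_ne_bot
  refine ⟨Subrepresentation.subrepresentationSubmoduleOrderIso.symm m, ?_⟩
  rw [isIrreducible_sub_iff, OrderIso.isAtom_iff]
  exact hm

/-- A nontrivial semisimple representation has an irreducible quotient whose kernel contains a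
given proper subrepresentation. -/
theorem IsSemisimpleRepresentation.exists_isIrreducible_quot_le (h : σ.IsSemisimpleRepresentation)
    {M : Subrepresentation σ} (hM : M ≠ ⊤) :
    ∃ N : Subrepresentation σ, M ≤ N ∧ N.quot.IsIrreducible := by
  rw [isSemisimpleRepresentation_iff_isSemisimpleModule_asModule] at h
  have hM' : Subrepresentation.subrepresentationSubmoduleOrderIso M ≠ ⊤ := fun h' =>
    hM (Subrepresentation.subrepresentationSubmoduleOrderIso.injective
      (h'.trans (OrderIso.map_top _).symm))
  obtain ⟨m, hm, hMm⟩ := (IsCoatomic.eq_top_or_exists_le_coatom _).resolve_left hM'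
  refine ⟨Subrepresentation.subrepresentationSubmoduleOrderIso.symm m, hMm, ?_⟩
  rw [isIrreducible_quot_iff, OrderIso.isCoatom_iff]
  exact hm

/-- A semisimple representation is the sum of its irreducible subrepresentations. -/
theorem IsSemisimpleRepresentation.exists_isIrreducible_sub_not_le
    (h : σ.IsSemisimpleRepresentation) {M : Subrepresentation σ} (hM : M ≠ ⊤) :
    ∃ N : Subrepresentation σ, N.toRepresentation.IsIrreducible ∧ ¬ N ≤ M := by
  rw [isSemisimpleRepresentation_iff_isSemisimpleModule_asModule] at h
  by_contra! hcon
  refine hM (top_le_iff.1 ?_)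
  have h1 := IsSemisimpleModule.sSup_simples_eq_top ℂ[G] σ.asModule
  have h2 : (⊤ : Submodule ℂ[G] σ.asModule) ≤
      Subrepresentation.subrepresentationSubmoduleOrderIso M := by
    rw [← h1]
    refine sSup_le fun m hm => ?_
    have h3 := hcon (Subrepresentation.subrepresentationSubmoduleOrderIso.symm m) (by
      rw [isIrreducible_sub_iff, OrderIso.isAtom_iff]
      exact isSimpleModule_iff_isAtom.1 hm)
    exact h3
  exact h2

/-- Every subrepresentation of a semisimple representation is the image of an idempotent. -/
theorem IsSemisimpleRepresentation.exists_proj (h : σ.IsSemisimpleRepresentation)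
    (N : Subrepresentation σ) :
    ∃ e : IntertwiningMap σ N.toRepresentation, ∀ x : N.toSubmodule, e x = x := by
  rw [isSemisimpleRepresentation_iff_isSemisimpleModule_asModule] at h
  let φ := IntertwiningMap.equivLinearMapAsModule N.toRepresentation σ N.incl
  obtain ⟨ψ, hψ⟩ := IsSemisimpleModule.extension_property φ N.incl_injective LinearMap.id
  refine ⟨(IntertwiningMap.equivLinearMapAsModule σ N.toRepresentation).symm ψ, fun x => ?_⟩
  exact LinearMap.congr_fun hψ x

theorem IsSemisimpleRepresentation.exists_section (h : σ.IsSemisimpleRepresentation)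
    (φ : IntertwiningMap σ τ) (hφ : Function.Surjective φ) :
    ∃ s : IntertwiningMap τ σ, ∀ w, φ (s w) = w := by
  rw [isSemisimpleRepresentation_iff_isSemisimpleModule_asModule] at h
  have := h
  let φ' := IntertwiningMap.equivLinearMapAsModule σ τ φ
  have : IsSemisimpleModule ℂ[G] τ.asModule := IsSemisimpleModule.of_surjective φ' hφ
  obtain ⟨ψ, hψ⟩ := IsSemisimpleModule.lifting_property φ' hφ LinearMap.id
  refine ⟨(IntertwiningMap.equivLinearMapAsModule τ σ).symm ψ, fun x => ?_⟩
  exact LinearMap.congr_fun hψ x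

/-- A semisimple representation in which the kernels of any two maps onto irreducible quotients
agree has length at most one. -/
theorem IsSemisimpleRepresentation.length_le_one (h : σ.IsSemisimpleRepresentation)
    (h' : ∀ M N : Subrepresentation σ, M.quot.IsIrreducible → N.quot.IsIrreducible → M = N) :
    σ.length ≤ 1 := by
  by_cases hV : Subsingleton V
  · rw [length_eq_zero_iff.2 hV]
    exact zero_le_one
  rw [not_subsingleton_iff_nontrivial] at hV
  have hbt : (⊥ : Subrepresentation σ) ≠ ⊤ := by
    intro hbt
    obtain ⟨v, hv⟩ := exists_ne (0 : V)
    have : v ∈ (⊥ : Subrepresentation σ) := hbt ▸ (Submodule.mem_top : v ∈ (⊤ : Submodule ℂ V))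
    exact hv this
  obtain ⟨N, -, hN⟩ := h.exists_isIrreducible_quot_le hbt
  obtain ⟨C, hC⟩ := exists_isCompl N
  have hCtop : C = ⊤ := by
    by_contra hCt
    obtain ⟨M, hCM, hM⟩ := h.exists_isIrreducible_quot_le hCt
    have := h' M N hM hN
    subst this
    exact (isIrreducible_quot_iff.1 hM).1 (top_le_iff.1 (hC.sup_eq_top ▸ sup_le le_rfl hCM))
  have hNbot : N = ⊥ := by
    have := hC.inf_eq_bot
    rwa [hCtop, inf_top_eq] at this
  subst hNbot
  have h1 := length_eq_sub_add_quot (⊥ : Subrepresentation σ)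
  have h2 : (⊥ : Subrepresentation σ).toRepresentation.length = 0 :=
    length_eq_zero_iff.2 (inferInstanceAs (Subsingleton (⊥ : Submodule ℂ V)))
  rw [length_eq_one_iff.2 hN, h2, zero_add] at h1
  exact h1.le

end Representation
end Length

/-! ### Finite products and twists -/

section Products

open Representation

variable {G H : Type*} [Group G] [Group H]
variable {V W : Type*} [AddCommGroup V] [Module ℂ V] [AddCommGroup W] [Module ℂ W]
variable {ι : Type*} {X : ι → Type*} [∀ i, AddCommGroup (X i)] [∀ i, Module ℂ (X i)]

namespace Representation

/-- The product of a family of representations. -/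
def piRep (τ : ∀ i, Representation ℂ G (X i)) : Representation ℂ G (∀ i, X i) where
  toFun g := LinearMap.pi fun i => τ i g ∘ₗ LinearMap.proj i
  map_one' := by ext; simp
  map_mul' g h := by ext; simp

/-- The projections of a product of representations. -/
def piProj (τ : ∀ i, Representation ℂ G (X i)) (i : ι) : IntertwiningMap (piRep τ) (τ i) where
  toLinearMap := LinearMap.proj i
  isIntertwining' _ := rfl

/-- The product of representations, as a linear map to the product of modules over the group
algebra. -/
def piToModule (τ : ∀ i, Representation ℂ G (X i)) :
    (piRep τ).asModule →ₗ[ℂ[G]] ∀ i, (τ i).asModule :=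
  LinearMap.pi fun i => IntertwiningMap.equivLinearMapAsModule _ _ (piProj τ i)

theorem piToModule_injective (τ : ∀ i, Representation ℂ G (X i)) :
    Function.Injective (piToModule τ) := fun _ _ h => h

theorem IsSemisimpleRepresentation.pi [Finite ι] {τ : ∀ i, Representation ℂ G (X i)}
    (h : ∀ i, (τ i).IsSemisimpleRepresentation) : (piRep τ).IsSemisimpleRepresentation := by
  simp only [isSemisimpleRepresentation_iff_isSemisimpleModule_asModule] at h ⊢
  exact IsSemisimpleModule.of_injective (piToModule τ) (piToModule_injective τ)

theorem length_pi_ne_top [Finite ι] {τ : ∀ i, Representation ℂ G (X i)}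
    (h : ∀ i, (τ i).length ≠ ⊤) : (piRep τ).length ≠ ⊤ := by
  cases nonempty_fintype ι
  refine ne_top_of_le_ne_top ?_
    (Module.length_le_of_injective (piToModule τ) (piToModule_injective τ))
  rw [Module.length_pi_of_fintype]
  exact WithTop.sum_ne_top.2 fun i _ => h i

/-- Restriction along a surjective homomorphism does not change the subrepresentations. -/
def subrepresentationCompIso (τ : Representation ℂ G W) {c : H →* G}
    (hc : Function.Surjective c) : Subrepresentation (τ.comp c) ≃o Subrepresentation τ where
  toFun N := ⟨N.toSubmodule, fun g v hv => by
    obtain ⟨h, rfl⟩ := hc g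
    exact N.apply_mem_toSubmodule h hv⟩
  invFun N := N.res c
  left_inv _ := rfl
  right_inv _ := rfl
  map_rel_iff' := Iff.rfl

theorem length_comp_of_surjective (τ : Representation ℂ G W) {c : H →* G}
    (hc : Function.Surjective c) : length (τ.comp c) = τ.length := by
  rw [length_eq_height, length_eq_height,
    ← Order.height_orderIso (subrepresentationCompIso τ hc), OrderIso.map_top]

theorem IsSemisimpleRepresentation.comp_of_surjective {τ : Representation ℂ G W}
    (h : τ.IsSemisimpleRepresentation) {c : H →* G} (hc : Function.Surjective c) :
    IsSemisimpleRepresentation (τ.comp c) :=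
  (OrderIso.complementedLattice_iff (subrepresentationCompIso τ hc)).2 h

end Representation

end Products

/-! ### Admissible representations -/

section Admissible

open Representation

variable {G H : Type*} [Group G] [Group H] [TopologicalSpace G] [TopologicalSpace H]
variable {V W : Type*} [AddCommGroup V] [Module ℂ V] [AddCommGroup W] [Module ℂ W]
variable {ι : Type*} {X : ι → Type*} [∀ i, AddCommGroup (X i)] [∀ i, Module ℂ (X i)]
variable {σ : Representation ℂ G V} {τ : Representation ℂ G W}

theorem IsSmoothVector.map {v : V} (hv : IsSmoothVector σ v) (φ : IntertwiningMap σ τ) :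
    IsSmoothVector τ (φ v) := by
  obtain ⟨U, hU⟩ := hv
  exact ⟨U, fun a ha => by rw [← φ.isIntertwining, hU a ha]⟩

theorem IsSmoothRep.of_surjective (h : IsSmoothRep σ) (φ : IntertwiningMap σ τ)
    (hφ : Function.Surjective φ) : IsSmoothRep τ := by
  intro w
  obtain ⟨v, rfl⟩ := hφ w
  exact (h v).map φ

theorem IsSmoothRep.of_injective (h : IsSmoothRep τ) (φ : IntertwiningMap σ τ)
    (hφ : Function.Injective φ) : IsSmoothRep σ := by
  intro v
  obtain ⟨U, hU⟩ := h (φ v)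
  exact ⟨U, fun a ha => hφ (by rw [φ.isIntertwining, hU a ha])⟩

theorem IsSmoothRep.comp (h : IsSmoothRep τ) (c : H →* G) (hc : Continuous c) :
    IsSmoothRep (τ.comp c) := by
  intro v
  obtain ⟨U, hU⟩ := h v
  exact ⟨U.comap c hc, fun a ha => hU _ ha⟩

theorem IsAdmissibleRep.of_injective (h : IsAdmissibleRep τ) (φ : IntertwiningMap σ τ)
    (hφ : Function.Injective φ) : IsAdmissibleRep σ := by
  refine ⟨h.1.of_injective φ hφ, fun U => ?_⟩
  have := h.2 U
  refine Module.Finite.of_injective (φ.toLinearMap.restrict (p := fixedVectors σ U.toSubgroup)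
    (q := fixedVectors τ U.toSubgroup) fun v hv a ha => ?_) fun v w hvw => ?_
  · exact (φ.isIntertwining _ _ a v).symm.trans (congrArg φ (hv a ha))
  · exact Subtype.ext (hφ (congrArg Subtype.val hvw))

theorem IsAdmissibleRep.pi [Finite ι] {τ : ∀ i, Representation ℂ G (X i)}
    (h : ∀ i, IsAdmissibleRep (τ i)) : IsAdmissibleRep (piRep τ) := by
  cases nonempty_fintype ι
  constructor
  · intro v
    choose U hU using fun i => (h i).1 (v i)
    have hopen : IsOpen ((⨅ i, (U i).toSubgroup : Subgroup G) : Set G) := by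
      rw [Subgroup.coe_iInf]
      exact isOpen_iInter_of_finite fun i => (U i).isOpen
    refine ⟨⟨⨅ i, (U i).toSubgroup, hopen⟩, fun a ha => funext fun i => hU i a ?_⟩
    exact (Subgroup.mem_iInf.1 ha) i
  · intro U
    have := fun i => (h i).2 U
    refine Module.Finite.of_injective (LinearMap.pi fun i =>
      ((LinearMap.proj i).restrict (p := fixedVectors (piRep τ) U.toSubgroup)
        (q := fixedVectors (τ i) U.toSubgroup) fun v hv a ha => ?_)) fun v w hvw => ?_
    · exact congrFun (hv a ha) i
    · refine Subtype.ext (funext fun i => ?_)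
      exact congrArg Subtype.val (congrFun hvw i)

theorem IsAdmissibleRep.comp_mulEquiv (h : IsAdmissibleRep τ) (c : H ≃* G) (hc : Continuous c)
    (hc' : Continuous c.symm) : IsAdmissibleRep (τ.comp c.toMonoidHom) := by
  refine ⟨h.1.comp _ hc, fun U => ?_⟩
  have := h.2 (U.comap c.symm.toMonoidHom hc')
  refine Module.Finite.of_injective (Submodule.inclusion (p := fixedVectors _ U.toSubgroup)
    (p' := fixedVectors τ (U.comap c.symm.toMonoidHom hc').toSubgroup) fun v hv a ha => ?_)
    (Submodule.inclusion_injective _)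
  have := hv (c.symm a) ha
  simpa using this

/-- Semisimple admissible representations of finite length. -/
structure IsGoodRep (σ : Representation ℂ G V) : Prop where
  semisimple : σ.IsSemisimpleRepresentation
  length_ne_top : σ.length ≠ ⊤
  admissible : IsAdmissibleRep σ

namespace IsGoodRep

theorem of_injective (h : IsGoodRep τ) (φ : IntertwiningMap σ τ) (hφ : Function.Injective φ) :
    IsGoodRep σ :=
  ⟨h.1.of_injective φ hφ, ne_top_of_le_ne_top h.2 (length_le_of_injective φ hφ),
    h.3.of_injective φ hφ⟩

theorem of_surjective (h : IsGoodRep σ) (φ : IntertwiningMap σ τ) (hφ : Function.Surjective φ) :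
    IsGoodRep τ := by
  obtain ⟨s, hs⟩ := h.1.exists_section φ hφ
  exact h.of_injective s (Function.LeftInverse.injective hs)

theorem pi [Finite ι] {τ : ∀ i, Representation ℂ G (X i)} (h : ∀ i, IsGoodRep (τ i)) :
    IsGoodRep (piRep τ) :=
  ⟨.pi fun i => (h i).1, length_pi_ne_top fun i => (h i).2, .pi fun i => (h i).3⟩

theorem comp_mulEquiv (h : IsGoodRep τ) (c : H ≃* G) (hc : Continuous c)
    (hc' : Continuous c.symm) : IsGoodRep (τ.comp c.toMonoidHom) :=
  ⟨h.1.comp_of_surjective c.surjective, by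
    rw [length_comp_of_surjective _ c.surjective]; exact h.2, h.3.comp_mulEquiv c hc hc'⟩

end IsGoodRep

theorem IsIrrRep.isGoodRep (h : IsIrrRep σ) : IsGoodRep σ :=
  ⟨h.1.isSemisimpleRepresentation, by rw [length_eq_one_iff.2 h.1]; exact ENat.one_ne_top, h.2⟩

end Admissible

/-! ### Clifford theory

A representation `σ` of `B` is compared with its restriction along `f : H → B`, when `f` has normal
image and the elements of `B` acting as scalar multiples of elements of `H` form a subgroup of
finite index. -/

section Clifford

open Representation

variable {H B : Type*} [Group H] [Group B]
variable {V W : Type*} [AddCommGroup V] [Module ℂ V] [AddCommGroup W] [Module ℂ W]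

/-- The elements of `B` which act on a representation as scalar multiples of elements of `H`. -/
def scalarSubgroup (f : H →* B) (σ : Representation ℂ B V) : Subgroup B where
  carrier := {b | ∃ (h : H) (c : ℂˣ), σ b = (c : ℂ) • σ (f h)}
  one_mem' := ⟨1, 1, by simp⟩
  mul_mem' := by
    rintro a b ⟨h, c, hc⟩ ⟨h', c', hc'⟩
    refine ⟨h * h', c * c', ?_⟩
    rw [map_mul, hc, hc', map_mul, map_mul, smul_mul_smul_comm, Units.val_mul]
  inv_mem' := by
    rintro a ⟨h, c, hc⟩
    refine ⟨h⁻¹, c⁻¹, ?_⟩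
    have h1 : σ a⁻¹ * σ a = 1 := by rw [← map_mul, inv_mul_cancel, map_one]
    have h2 : σ a * (((c⁻¹ : ℂˣ) : ℂ) • σ (f h⁻¹)) = 1 := by
      rw [hc, smul_mul_smul_comm, ← map_mul, ← map_mul, mul_inv_cancel, map_one, map_one,
        Units.mul_inv, one_smul]
    exact left_inv_eq_right_inv h1 h2

theorem scalarSubgroup_le_of_surjective {f : H →* B} {σ : Representation ℂ B V}
    {τ : Representation ℂ B W} (φ : IntertwiningMap σ τ) (hφ : Function.Surjective φ) :
    scalarSubgroup f σ ≤ scalarSubgroup f τ := by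
  rintro b ⟨h, c, hc⟩
  refine ⟨h, c, LinearMap.ext fun w => ?_⟩
  obtain ⟨v, rfl⟩ := hφ w
  rw [← φ.isIntertwining, hc, LinearMap.smul_apply, LinearMap.smul_apply, ← φ.isIntertwining,
    map_smul]

theorem scalarSubgroup_le_of_injective {f : H →* B} {σ : Representation ℂ B V}
    {τ : Representation ℂ B W} (φ : IntertwiningMap σ τ) (hφ : Function.Injective φ) :
    scalarSubgroup f τ ≤ scalarSubgroup f σ := by
  rintro b ⟨h, c, hc⟩
  refine ⟨h, c, LinearMap.ext fun v => hφ ?_⟩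
  rw [φ.isIntertwining, hc, LinearMap.smul_apply, LinearMap.smul_apply, map_smul,
    φ.isIntertwining]

theorem exists_right_transversal (S : Subgroup B) [S.FiniteIndex] :
    ∃ r : B ⧸ S → B, ∀ b : B, ∃ i, ∃ s ∈ S, b = s * r i := by
  refine ⟨fun x => x.out⁻¹, fun b => ⟨QuotientGroup.mk b⁻¹, ?_⟩⟩
  obtain ⟨s, hs⟩ := QuotientGroup.mk_out_eq_mul S b⁻¹
  refine ⟨s, s.2, ?_⟩
  simp only [hs]
  group

theorem mem_of_mem_scalarSubgroup {f : H →* B} {σ : Representation ℂ B V}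
    (Y : Subrepresentation (σ.comp f)) {b : B} (hb : b ∈ scalarSubgroup f σ) {v : V}
    (hv : v ∈ Y) : σ b v ∈ Y := by
  obtain ⟨h, c, hc⟩ := hb
  rw [hc]
  exact Y.toSubmodule.smul_mem _ (Y.apply_mem_toSubmodule h hv)

/-- The largest `B`-stable subspace of an `H`-stable subspace. -/
def Subrepresentation.core {f : H →* B} {σ : Representation ℂ B V}
    (Y : Subrepresentation (σ.comp f)) : Subrepresentation σ where
  toSubmodule := ⨅ b, Y.toSubmodule.comap (σ b)
  apply_mem_toSubmodule g v hv := by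
    rw [Submodule.mem_iInf] at hv ⊢
    intro b
    have := hv (b * g)
    rwa [map_mul] at this

theorem Subrepresentation.mem_core {f : H →* B} {σ : Representation ℂ B V}
    {Y : Subrepresentation (σ.comp f)} {v : V} : v ∈ Y.core ↔ ∀ b, σ b v ∈ Y :=
  Submodule.mem_iInf _

theorem Subrepresentation.mem_of_mem_core {f : H →* B} {σ : Representation ℂ B V}
    {Y : Subrepresentation (σ.comp f)} {v : V} (hv : v ∈ Y.core) : v ∈ Y := by
  simpa using Subrepresentation.mem_core.1 hv 1

/-- The quotient by the core embeds into a finite product of twists of the quotient by the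
`H`-stable subspace. -/
theorem Subrepresentation.exists_core_embedding {f : H →* B} {σ : Representation ℂ B V}
    (hfi : (scalarSubgroup f σ).FiniteIndex) {c : B → H ≃* H}
    (hc : ∀ b h, f (c b h) = b * f h * b⁻¹) (Y : Subrepresentation (σ.comp f)) :
    ∃ (r : B ⧸ scalarSubgroup f σ → B)
      (φ : IntertwiningMap (MonoidHom.comp Y.core.quot f)
        (piRep fun i => MonoidHom.comp Y.quot (c (r i)).toMonoidHom)), Function.Injective φ := by
  obtain ⟨r, hr⟩ := exists_right_transversal (scalarSubgroup f σ)
  let φ₀ : V →ₗ[ℂ] (B ⧸ scalarSubgroup f σ → V ⧸ Y.toSubmodule) :=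
    LinearMap.pi fun i => Y.toSubmodule.mkQ ∘ₗ σ (r i)
  have hker : LinearMap.ker φ₀ = Y.core.toSubmodule := by
    ext v
    rw [LinearMap.mem_ker]
    constructor
    · intro h
      refine Subrepresentation.mem_core.2 fun b => ?_
      obtain ⟨i, s, hs, rfl⟩ := hr b
      rw [map_mul]
      refine mem_of_mem_scalarSubgroup Y hs ?_
      exact (Submodule.Quotient.mk_eq_zero _).1 (congrFun h i)
    · intro h
      funext i
      exact (Submodule.Quotient.mk_eq_zero _).2 (Subrepresentation.mem_core.1 h (r i))
  refine ⟨r, ⟨Y.core.toSubmodule.liftQ φ₀ hker.ge, fun h => ?_⟩, ?_⟩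
  · refine Submodule.linearMap_qext _ (LinearMap.ext fun v => funext fun i => ?_)
    change Y.toSubmodule.mkQ (σ (r i) (σ (f h) v)) =
      Y.toSubmodule.mkQ (σ (f (c (r i) h)) (σ (r i) v))
    rw [hc, ← Module.End.mul_apply, ← Module.End.mul_apply, ← map_mul, ← map_mul,
      inv_mul_cancel_right]
  · exact LinearMap.ker_eq_bot.1 (Submodule.ker_liftQ_eq_bot _ _ _ hker.le)

theorem IsGoodRep.core [TopologicalSpace H] {f : H →* B} {σ : Representation ℂ B V}
    (hfi : (scalarSubgroup f σ).FiniteIndex) {c : B → H ≃* H}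
    (hc : ∀ b h, f (c b h) = b * f h * b⁻¹) (hcont : ∀ b, Continuous (c b))
    (hcont' : ∀ b, Continuous (c b).symm) {Y : Subrepresentation (σ.comp f)}
    (hY : IsGoodRep Y.quot) : IsGoodRep (MonoidHom.comp Y.core.quot f) := by
  obtain ⟨r, φ, hφ⟩ := Y.exists_core_embedding hfi hc
  exact (IsGoodRep.pi fun i => hY.comp_mulEquiv (c (r i)) (hcont _) (hcont' _)).of_injective φ hφ

/-- The restriction of an irreducible representation to a normal subgroup, of finite index up to
scalars, is semisimple of finite length. -/
theorem Representation.IsIrreducible.semisimple_comp {f : H →* B} {σ : Representation ℂ B V}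
    (hfi : (scalarSubgroup f σ).FiniteIndex) {c : B → H ≃* H}
    (hc : ∀ b h, f (c b h) = b * f h * b⁻¹) (hσ : σ.IsIrreducible) :
    IsSemisimpleRepresentation (σ.comp f) ∧ length (σ.comp f) ≠ ⊤ := by
  have := hσ.nontrivial
  obtain ⟨v₀, hv₀⟩ := exists_ne (0 : V)
  have hspan : ∀ N : Submodule ℂ V, (∀ b, σ b v₀ ∈ N) → N = ⊤ := by
    intro N hN
    let M : Subrepresentation σ :=
      ⟨Submodule.span ℂ (Set.range fun b => σ b v₀), fun g v hv => by
        refine Submodule.span_induction (fun x hx => ?_) ?_ (fun x y _ _ hx hy => ?_)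
          (fun a x _ hx => ?_) hv
        · obtain ⟨b, rfl⟩ := hx
          exact Submodule.subset_span ⟨g * b, by simp⟩
        · rw [map_zero]; exact Submodule.zero_mem _
        · rw [map_add]; exact Submodule.add_mem _ hx hy
        · rw [map_smul]; exact Submodule.smul_mem _ _ hx⟩
    have hM : v₀ ∈ M := Submodule.subset_span ⟨1, by simp⟩
    have hMtop : M = ⊤ := by
      refine (hσ.eq_bot_or_eq_top M).resolve_left fun h => hv₀ ?_
      rw [h] at hM
      exact hM
    have h1 : Submodule.span ℂ (Set.range fun b => σ b v₀) ≤ N :=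
      Submodule.span_le.2 (by rintro _ ⟨b, rfl⟩; exact hN b)
    exact top_le_iff.1 ((congrArg Subrepresentation.toSubmodule hMtop).ge.trans h1)
  obtain ⟨Y, hY⟩ : ∃ Y : Subrepresentation (σ.comp f), IsCoatom Y := by
    obtain ⟨r, hr⟩ := exists_right_transversal (scalarSubgroup f σ)
    have hfin : Module.Finite ℂ[H] (Representation.asModule (σ.comp f)) := by
      let P : Submodule ℂ[H] (Representation.asModule (σ.comp f)) :=
        Submodule.span ℂ[H] (Set.range fun i => (σ (r i) v₀ : V))
      have hP : P = ⊤ := by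
        let N := Subrepresentation.subrepresentationSubmoduleOrderIso.symm P
        have hN : N.toSubmodule = ⊤ := by
          refine hspan _ fun b => ?_
          obtain ⟨i, s, hs, rfl⟩ := hr b
          rw [map_mul]
          refine mem_of_mem_scalarSubgroup N hs ?_
          exact (Submodule.subset_span ⟨i, rfl⟩ : (σ (r i) v₀ : V) ∈ P)
        refine Submodule.ext fun x => ⟨fun _ => Submodule.mem_top, fun _ => ?_⟩
        have hx : ∀ y : V, y ∈ N.toSubmodule := fun y => by rw [hN]; exact Submodule.mem_top
        exact hx x
      refine Module.Finite.of_fg_top ?_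
      rw [← hP]
      exact Submodule.fg_span (Set.finite_range _)
    have : Nontrivial (Representation.asModule (σ.comp f)) := inferInstanceAs (Nontrivial V)
    obtain ⟨m, hm, -⟩ := IsCoatomic.eq_top_or_exists_le_coatom
      (⊥ : Submodule ℂ[H] (Representation.asModule (σ.comp f))) |>.resolve_left bot_ne_top
    exact ⟨_, (OrderIso.isCoatom_iff
      Subrepresentation.subrepresentationSubmoduleOrderIso.symm m).2 hm⟩
  have hYq := isIrreducible_quot_iff.2 hY
  obtain ⟨r, φ, hφ⟩ := Y.exists_core_embedding hfi hc
  have hcore : Y.core = ⊥ := by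
    refine (hσ.eq_bot_or_eq_top _).resolve_right fun h => hY.1 ?_
    refine top_le_iff.1 fun v _ => Subrepresentation.mem_of_mem_core (?_ : v ∈ Y.core)
    rw [h]
    exact Submodule.mem_top
  let ψ : IntertwiningMap (σ.comp f) (MonoidHom.comp Y.core.quot f) := Y.core.mkQ.res f
  have hψ : Function.Injective ψ := by
    refine (injective_iff_map_eq_zero ψ).2 fun v hv => ?_
    have : v ∈ Y.core := Subrepresentation.mkQ_eq_zero.1 hv
    rw [hcore] at this
    exact this
  have hinj : Function.Injective (φ.comp ψ) := hφ.comp hψ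
  constructor
  · exact (IsSemisimpleRepresentation.pi fun i =>
      hYq.isSemisimpleRepresentation.comp_of_surjective (c (r i)).surjective).of_injective _ hinj
  · refine ne_top_of_le_ne_top (length_pi_ne_top fun i => ?_) (length_le_of_injective _ hinj)
    have h1 := length_comp_of_surjective Y.quot (c := (c (r i)).toMonoidHom) (c (r i)).surjective
    rw [h1, length_eq_one_iff.2 hYq]
    exact ENat.one_ne_top

end Clifford

section RelativeMaschke

open Representation

variable {H B : Type*} [Group H] [Group B]
variable {V W : Type*} [AddCommGroup V] [Module ℂ V] [AddCommGroup W] [Module ℂ W]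

/-- The relative form of Maschke's theorem: a projection commuting with `H` is averaged over the
cosets of the subgroup of elements acting through `H` up to scalars. -/
theorem isSemisimpleRepresentation_of_comp {f : H →* B} {σ : Representation ℂ B V}
    (hfi : (scalarSubgroup f σ).FiniteIndex) (h : IsSemisimpleRepresentation (σ.comp f)) :
    σ.IsSemisimpleRepresentation := by
  refine ⟨fun N => ?_⟩
  obtain ⟨e, he⟩ := h.exists_proj (N.res f)
  let S := scalarSubgroup f σ
  have : Fintype (B ⧸ S) := Fintype.ofFinite _
  let e₀ : Module.End ℂ V := N.toSubmodule.subtype ∘ₗ e.toLinearMap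
  have he₀ : ∀ v, e₀ v ∈ N.toSubmodule := fun v => (e v).2
  have he₁ : ∀ v ∈ N.toSubmodule, e₀ v = v := fun v hv => congrArg Subtype.val (he ⟨v, hv⟩)
  have hcomm : ∀ s ∈ S, ∀ v, e₀ (σ s v) = σ s (e₀ v) := by
    rintro s ⟨h, c, hc⟩ v
    rw [hc]
    simp only [LinearMap.smul_apply, map_smul]
    congr 1
    exact congrArg Subtype.val (e.isIntertwining _ _ h v)
  -- the conjugate of the projection by `b` depends only on the coset of `b` modulo `S`
  let t : B → Module.End ℂ V := fun b => σ b * e₀ * σ b⁻¹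
  have ht : ∀ b, ∀ s ∈ S, t (b * s) = t b := by
    intro b s hs
    refine LinearMap.ext fun v => ?_
    simp only [t, Module.End.mul_apply, mul_inv_rev, map_mul]
    rw [← hcomm s hs, ← Module.End.mul_apply (σ s), ← map_mul, mul_inv_cancel, map_one,
      Module.End.one_apply]
  let T : B ⧸ S → Module.End ℂ V := fun x => t x.out
  have hT : ∀ b : B, T b = t b := by
    intro b
    obtain ⟨s, hs⟩ := QuotientGroup.mk_out_eq_mul S b
    simp only [T, hs]
    exact ht b s s.2
  have hgT : ∀ (g : B) (x : B ⧸ S), σ g * T x = T (g • x) * σ g := by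
    intro g x
    induction x using QuotientGroup.induction_on with
    | H b =>
      rw [MulAction.Quotient.smul_coe, hT, hT, smul_eq_mul]
      simp only [t, mul_inv_rev, map_mul]
      simp only [mul_assoc]
      rw [← map_mul σ g⁻¹ g, inv_mul_cancel, map_one, mul_one]
  have hT0 : ∀ x v, T x v ∈ N.toSubmodule := fun x v => N.apply_mem_toSubmodule _ (he₀ _)
  have hT1 : ∀ x, ∀ v ∈ N.toSubmodule, T x v = v := by
    intro x v hv
    simp only [T, t, Module.End.mul_apply]
    rw [he₁ _ (N.apply_mem_toSubmodule _ hv), ← Module.End.mul_apply, ← map_mul, mul_inv_cancel,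
      map_one, Module.End.one_apply]
  let E : Module.End ℂ V := (Fintype.card (B ⧸ S) : ℂ)⁻¹ • ∑ x, T x
  have hE0 : ∀ v, E v ∈ N.toSubmodule := by
    intro v
    simp only [E, LinearMap.smul_apply, LinearMap.sum_apply]
    exact Submodule.smul_mem _ _ (Submodule.sum_mem _ fun x _ => hT0 x v)
  have hE1 : ∀ v ∈ N.toSubmodule, E v = v := by
    intro v hv
    simp only [E, LinearMap.smul_apply, LinearMap.sum_apply]
    rw [Finset.sum_congr rfl fun x _ => hT1 x v hv, Finset.sum_const, Finset.card_univ,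
      ← Nat.cast_smul_eq_nsmul ℂ, smul_smul, inv_mul_cancel₀, one_smul]
    exact Nat.cast_ne_zero.2 Fintype.card_ne_zero
  have hEg : ∀ g, σ g * E = E * σ g := by
    intro g
    simp only [E, mul_smul_comm, smul_mul_assoc]
    congr 1
    rw [Finset.mul_sum, Finset.sum_mul, Finset.sum_congr rfl fun x _ => hgT g x]
    exact Equiv.sum_comp (MulAction.toPerm g) fun x => T x * σ g
  let M : Subrepresentation σ := ⟨LinearMap.ker (E.codRestrict N.toSubmodule hE0),
    fun g v hv => by
      have hv' : E v = 0 := congrArg Subtype.val hv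
      refine Subtype.ext ?_
      change E (σ g v) = 0
      rw [← Module.End.mul_apply, ← hEg, Module.End.mul_apply, hv', map_zero]⟩
  have hc := LinearMap.isCompl_of_proj (p := N.toSubmodule)
    (f := E.codRestrict N.toSubmodule hE0) fun x => Subtype.ext (hE1 x x.2)
  exact ⟨M, .of_eq (Subrepresentation.toSubmodule_injective hc.inf_eq_bot)
    (Subrepresentation.toSubmodule_injective hc.sup_eq_top)⟩

theorem length_le_length_comp (f : H →* B) (σ : Representation ℂ B V) :
    σ.length ≤ length (σ.comp f) := by
  rw [length_eq_height, length_eq_height]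
  exact Order.height_le_height_apply_of_strictMono (fun N : Subrepresentation σ => N.res f)
    (fun _ _ h => h) ⊤

theorem exists_length_eq_sub_add_one {σ : Representation ℂ B V} {n : ℕ}
    (h : σ.length = (n + 1 : ℕ)) :
    ∃ N : Subrepresentation σ, N.quot.IsIrreducible ∧ N.toRepresentation.length = n := by
  have : Nontrivial V := by
    rw [← not_subsingleton_iff_nontrivial, ← length_eq_zero_iff (σ := σ), h]
    exact_mod_cast n.succ_ne_zero
  obtain ⟨N, hN⟩ := exists_isIrreducible_quot (σ := σ) (by rw [h]; exact ENat.natCast_ne_top _)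
  refine ⟨N, hN, ?_⟩
  have h1 := length_eq_sub_add_quot N
  rw [h, length_eq_one_iff.2 hN, Nat.cast_add, Nat.cast_one] at h1
  exact (ENat.add_left_injective_of_ne_top ENat.one_ne_top h1).symm

theorem exists_length_eq_quot_add_one {σ : Representation ℂ B V} {n : ℕ}
    (h : σ.length = (n + 1 : ℕ)) :
    ∃ N : Subrepresentation σ, N.toRepresentation.IsIrreducible ∧ N.quot.length = n := by
  have : Nontrivial V := by
    rw [← not_subsingleton_iff_nontrivial, ← length_eq_zero_iff (σ := σ), h]
    exact_mod_cast n.succ_ne_zero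
  obtain ⟨N, hN⟩ := exists_isIrreducible_sub (σ := σ) (by rw [h]; exact ENat.natCast_ne_top _)
  refine ⟨N, hN, ?_⟩
  have h1 := length_eq_sub_add_quot N
  rw [h, length_eq_one_iff.2 hN, Nat.cast_add, Nat.cast_one, add_comm] at h1
  exact (ENat.add_right_injective_of_ne_top ENat.one_ne_top h1).symm

/-- Finite length is inherited by the restriction to a normal subgroup of finite index up to
scalars. -/
theorem length_comp_ne_top {f : H →* B} {c : B → H ≃* H}
    (hc : ∀ b h, f (c b h) = b * f h * b⁻¹) {σ : Representation ℂ B V}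
    (hfi : (scalarSubgroup f σ).FiniteIndex) (h : σ.length ≠ ⊤) : length (σ.comp f) ≠ ⊤ := by
  obtain ⟨n, hn⟩ := ENat.ne_top_iff_exists.1 h
  induction n generalizing V with
  | zero =>
    have := length_eq_zero_iff.1 (hn.symm.trans Nat.cast_zero)
    rw [length_eq_zero_iff.2 this]
    exact ENat.zero_ne_top
  | succ n ih =>
    obtain ⟨N, hN, hNl⟩ := exists_length_eq_sub_add_one hn.symm
    have h1 := ih (σ := N.toRepresentation)
      (Subgroup.finiteIndex_of_le (scalarSubgroup_le_of_injective N.incl N.incl_injective))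
      (by rw [hNl]; exact ENat.natCast_ne_top _) hNl.symm
    have h2 := (hN.semisimple_comp
      (Subgroup.finiteIndex_of_le (scalarSubgroup_le_of_surjective N.mkQ N.mkQ_surjective)) hc).2
    have h3 := length_eq_sub_add_quot (N.res f)
    rw [h3]
    exact WithTop.add_ne_top.2 ⟨h1, h2⟩

end RelativeMaschke

/-! ### Averaging over compact groups -/

section Averaging

variable {K : Type*} [Group K] {V : Type*} [AddCommGroup V] [Module ℂ V]

/-- The stabilizer of a vector. -/
def fixer (σ : Representation ℂ K V) (v : V) : Subgroup K where
  carrier := {k | σ k v = v}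
  one_mem' := by simp
  mul_mem' {a b} ha hb := by
    change σ (a * b) v = v
    rw [map_mul, Module.End.mul_apply, hb, ha]
  inv_mem' {a} ha := by
    change σ a⁻¹ v = v
    conv_lhs => rw [← show σ a v = v from ha]
    simp

variable {σ : Representation ℂ K V}

theorem mem_fixer {v : V} {k : K} : k ∈ fixer σ v ↔ σ k v = v := Iff.rfl

/-- The average of the translates of a vector over the cosets of a subgroup fixing it. -/
def cosetAverage (σ : Representation ℂ K V) (S : Subgroup K) (v : V) : V :=
  (Nat.card (K ⧸ S) : ℂ)⁻¹ • ∑ᶠ x : K ⧸ S, σ x.out v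

theorem apply_out {S : Subgroup K} {v : V} (h : S ≤ fixer σ v) (k : K) :
    σ (QuotientGroup.mk k : K ⧸ S).out v = σ k v := by
  obtain ⟨s, hs⟩ := QuotientGroup.mk_out_eq_mul S k
  rw [hs, map_mul, Module.End.mul_apply, mem_fixer.1 (h s.2)]

/-- The average does not depend on the subgroup of finite index over which it is taken. -/
theorem cosetAverage_eq_of_le {S S' : Subgroup K} [S'.FiniteIndex] {v : V} (hS : S' ≤ S)
    (h : S ≤ fixer σ v) : cosetAverage σ S' v = cosetAverage σ S v := by
  have : S.FiniteIndex := Subgroup.finiteIndex_of_le hS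
  have : Fintype (K ⧸ S) := Fintype.ofFinite _
  have : Fintype (K ⧸ S') := Fintype.ofFinite _
  let e := Subgroup.quotientEquivProdOfLE hS
  have : Finite (S ⧸ S'.subgroupOf S) :=
    Finite.of_injective (fun y => e.symm (QuotientGroup.mk 1, y)) fun y z hyz =>
      congrArg Prod.snd (e.symm.injective hyz)
  have : Fintype (S ⧸ S'.subgroupOf S) := Fintype.ofFinite _
  -- `K / S'` is fibred over `K / S` with fibre `S / S'`
  have hsum : ∑ x : K ⧸ S', σ x.out v =
      (Fintype.card (S ⧸ S'.subgroupOf S) : ℂ) • ∑ x : K ⧸ S, σ x.out v := by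
    have h1 : ∀ x : K ⧸ S', σ x.out v = σ (e x).1.out v := by
      intro x
      induction x using QuotientGroup.induction_on with
      | H k =>
        rw [apply_out (hS.trans h)]
        exact (apply_out h k).symm
    rw [Finset.sum_congr rfl fun x _ => h1 x, e.sum_comp fun y => σ y.1.out v,
      Fintype.sum_prod_type]
    simp only [Finset.sum_const, Finset.card_univ]
    rw [← Finset.smul_sum, ← Nat.cast_smul_eq_nsmul ℂ]
  have hcard : (Nat.card (K ⧸ S') : ℂ) =
      Nat.card (K ⧸ S) * (Fintype.card (S ⧸ S'.subgroupOf S) : ℂ) := by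
    rw [← Nat.card_eq_fintype_card (α := S ⧸ _), ← Nat.cast_mul, ← Nat.card_prod,
      Nat.card_congr e]
  have hne : (Fintype.card (S ⧸ S'.subgroupOf S) : ℂ) ≠ 0 :=
    Nat.cast_ne_zero.2 Fintype.card_ne_zero
  rw [cosetAverage, cosetAverage, finsum_eq_sum_of_fintype, finsum_eq_sum_of_fintype, hsum, hcard,
    smul_smul, mul_inv, mul_assoc, inv_mul_cancel₀ hne, mul_one]

theorem fixer_add_le (v w : V) : fixer σ v ⊓ fixer σ w ≤ fixer σ (v + w) := fun k hk => by
  rw [mem_fixer, map_add, mem_fixer.1 hk.1, mem_fixer.1 hk.2]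

theorem fixer_smul_le (c : ℂ) (v : V) : fixer σ v ≤ fixer σ (c • v) := fun k hk => by
  rw [mem_fixer, map_smul, mem_fixer.1 hk]

/-- The averaging operator of a representation in which every orbit is finite. -/
def average (hσ : ∀ v, (fixer σ v).FiniteIndex) : V →ₗ[ℂ] V where
  toFun v := cosetAverage σ (fixer σ v) v
  map_add' v w := by
    have := hσ v
    have := hσ w
    rw [← cosetAverage_eq_of_le (fixer_add_le v w) le_rfl,
      ← cosetAverage_eq_of_le (inf_le_left : fixer σ v ⊓ fixer σ w ≤ _) le_rfl,
      ← cosetAverage_eq_of_le (inf_le_right : fixer σ v ⊓ fixer σ w ≤ _) le_rfl, cosetAverage,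
      cosetAverage, cosetAverage, ← smul_add]
    simp only [map_add]
    rw [finsum_add_distrib (Set.toFinite _) (Set.toFinite _)]
  map_smul' c v := by
    have := hσ v
    rw [← cosetAverage_eq_of_le (fixer_smul_le c v) le_rfl, cosetAverage, cosetAverage,
      RingHom.id_apply, smul_comm c]
    congr 1
    simp only [map_smul]
    rw [smul_finsum]

theorem average_eq (hσ : ∀ v, (fixer σ v).FiniteIndex) {S : Subgroup K} [S.FiniteIndex] {v : V}
    (h : S ≤ fixer σ v) : average hσ v = cosetAverage σ S v :=
  (cosetAverage_eq_of_le h le_rfl).symm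

theorem apply_average (hσ : ∀ v, (fixer σ v).FiniteIndex) (k : K) (v : V) :
    σ k (average hσ v) = average hσ v := by
  have := hσ v
  have : Fintype (K ⧸ fixer σ v) := Fintype.ofFinite _
  rw [average_eq hσ (le_refl (fixer σ v)), cosetAverage, map_smul, finsum_eq_sum_of_fintype,
    map_sum]
  congr 1
  refine Eq.trans ?_ (Equiv.sum_comp (MulAction.toPerm k)
    fun x : K ⧸ fixer σ v => σ x.out v)
  refine Finset.sum_congr rfl fun x _ => ?_
  induction x using QuotientGroup.induction_on with
  | H g =>
    rw [apply_out le_rfl, MulAction.toPerm_apply, MulAction.Quotient.smul_coe, apply_out le_rfl,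
      smul_eq_mul, map_mul, Module.End.mul_apply]

theorem average_apply (hσ : ∀ v, (fixer σ v).FiniteIndex) (k : K) (v : V) :
    average hσ (σ k v) = average hσ v := by
  have := hσ v
  -- a normal subgroup fixing `v` also fixes `σ k v`, so both averages run over the same cosets
  let S := (fixer σ v).normalCore
  have hS : S ≤ fixer σ v := Subgroup.normalCore_le _
  have hS' : S ≤ fixer σ (σ k v) := fun s hs => by
    have h1 : k⁻¹ * s * k ∈ S := by
      simpa using (inferInstance : S.Normal).conj_mem s hs k⁻¹
    have h2 := mem_fixer.1 (hS h1)
    rw [mem_fixer]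
    conv_rhs => rw [← h2]
    rw [← Module.End.mul_apply, ← Module.End.mul_apply, ← map_mul, ← map_mul]
    congr 2
    group
  have : Fintype (K ⧸ S) := Fintype.ofFinite _
  rw [average_eq hσ hS, average_eq hσ hS', cosetAverage, cosetAverage, finsum_eq_sum_of_fintype,
    finsum_eq_sum_of_fintype, ← Equiv.sum_comp (Equiv.mulRight (k : K ⧸ S)) fun x => σ x.out v]
  congr 1
  refine Finset.sum_congr rfl fun x _ => ?_
  induction x using QuotientGroup.induction_on with
  | H g =>
    rw [apply_out hS', Equiv.coe_mulRight]
    exact ((apply_out hS (g * k)).trans (by rw [map_mul, Module.End.mul_apply])).symm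

/-- A linear map which is constant on an orbit takes the same value on the average. -/
theorem map_average {X : Type*} [AddCommGroup X] [Module ℂ X]
    (hσ : ∀ v, (fixer σ v).FiniteIndex) (l : V →ₗ[ℂ] X) {v : V} (h : ∀ k, l (σ k v) = l v) :
    l (average hσ v) = l v := by
  have := hσ v
  have : Fintype (K ⧸ fixer σ v) := Fintype.ofFinite _
  rw [average_eq hσ (le_refl (fixer σ v)), cosetAverage, map_smul, finsum_eq_sum_of_fintype,
    map_sum, Finset.sum_congr rfl fun x _ => h _, Finset.sum_const, Finset.card_univ,
    ← Nat.cast_smul_eq_nsmul ℂ, smul_smul, Nat.card_eq_fintype_card, inv_mul_cancel₀, one_smul]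
  exact Nat.cast_ne_zero.2 Fintype.card_ne_zero

theorem average_mem (hσ : ∀ v, (fixer σ v).FiniteIndex) {N : Submodule ℂ V} {v : V}
    (h : ∀ k, σ k v ∈ N) : average hσ v ∈ N := by
  have := hσ v
  have : Fintype (K ⧸ fixer σ v) := Fintype.ofFinite _
  rw [average_eq hσ (le_refl (fixer σ v)), cosetAverage, finsum_eq_sum_of_fintype]
  exact N.smul_mem _ (N.sum_mem fun x _ => h _)

end Averaging

/-! ### The contragredient -/

section Contragredient

open Representation

variable {A : Type*} [Group A] [TopologicalSpace A]
variable {V W : Type*} [AddCommGroup V] [Module ℂ V] [AddCommGroup W] [Module ℂ W]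

/-- An algebraic substitute for a compact open subgroup: an open subgroup in which every open
subgroup has finite index. This is all that is needed for averaging smooth vectors. -/
def HasCompactOpenSubgroup (A : Type*) [Group A] [TopologicalSpace A] : Prop :=
  ∃ K : OpenSubgroup A, ∀ U : OpenSubgroup A, U.toSubgroup.relIndex K.toSubgroup ≠ 0

theorem HasCompactOpenSubgroup.exists_le (h : HasCompactOpenSubgroup A) (U : OpenSubgroup A) :
    ∃ K : OpenSubgroup A, K ≤ U ∧
      ∀ U' : OpenSubgroup A, U'.toSubgroup.relIndex K.toSubgroup ≠ 0 := by
  obtain ⟨K, hK⟩ := h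
  refine ⟨K ⊓ U, inf_le_right, fun U' => ?_⟩
  exact mt (Subgroup.relIndex_eq_zero_of_le_right inf_le_left) (hK U')

theorem IsSmoothRep.finiteIndex_fixer {σ : Representation ℂ A V} (hσ : IsSmoothRep σ)
    {K : OpenSubgroup A} (hK : ∀ U : OpenSubgroup A, U.toSubgroup.relIndex K.toSubgroup ≠ 0)
    (v : V) : (fixer (MonoidHom.comp σ K.toSubgroup.subtype) v).FiniteIndex := by
  obtain ⟨U, hU⟩ := hσ v
  have h1 : (U.toSubgroup.subgroupOf K.toSubgroup).FiniteIndex := ⟨hK U⟩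
  exact Subgroup.finiteIndex_of_le (H := U.toSubgroup.subgroupOf K.toSubgroup) fun k hk => hU _ hk

variable {σ : Representation ℂ A V} {τ : Representation ℂ A W}

/-- Smooth linear forms separate the vectors of a smooth representation. -/
theorem IsSmoothRep.exists_smoothDual_ne_zero (hA : HasCompactOpenSubgroup A)
    (hσ : IsSmoothRep σ) {v : V} (hv : v ≠ 0) :
    ∃ f : smoothDual σ, (f : Module.Dual ℂ V) v ≠ 0 := by
  obtain ⟨U, hU⟩ := hσ v
  obtain ⟨K, hKU, hK⟩ := hA.exists_le U
  have hfix := hσ.finiteIndex_fixer hK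
  obtain ⟨l, hl⟩ : ∃ l : Module.Dual ℂ V, l v ≠ 0 := by
    by_contra! h
    exact hv ((Module.forall_dual_apply_eq_zero_iff ℂ v).1 h)
  refine ⟨⟨l ∘ₗ average hfix, K, fun a ha => LinearMap.ext fun w => ?_⟩, ?_⟩
  · change l (average hfix (σ a⁻¹ w)) = l (average hfix w)
    exact congrArg l (average_apply hfix ⟨a⁻¹, inv_mem ha⟩ w)
  · change l (average hfix v) ≠ 0
    have : average hfix v = v :=
      map_average hfix LinearMap.id (v := v) fun k => hU k (hKU k.2)
    rwa [this]

variable [SeparatelyContinuousMul A]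

theorem contragredient_apply (f : smoothDual σ) (a : A) (v : V) :
    (contragredient σ a f : Module.Dual ℂ V) v = (f : Module.Dual ℂ V) (σ a⁻¹ v) :=
  rfl

theorem contragredient_smooth (σ : Representation ℂ A V) : IsSmoothRep (contragredient σ) := by
  rintro ⟨f, U, hU⟩
  exact ⟨U, fun a ha => Subtype.ext (hU a ha)⟩

/-- The smooth linear forms vanishing on a subrepresentation. -/
def annihilator (N : Subrepresentation σ) : Subrepresentation (contragredient σ) where
  toSubmodule :=
    { carrier := {f | ∀ v ∈ N, (f : Module.Dual ℂ V) v = 0}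
      zero_mem' := fun _ _ => rfl
      add_mem' := fun {f g} hf hg v hv => by
        rw [Submodule.coe_add, LinearMap.add_apply, hf v hv, hg v hv, add_zero]
      smul_mem' := fun c f hf v hv => by
        rw [Submodule.coe_smul, LinearMap.smul_apply, hf v hv, smul_zero] }
  apply_mem_toSubmodule a _ hf v hv := hf _ (N.apply_mem_toSubmodule a⁻¹ hv)

/-- The vectors killed by a subrepresentation of the contragredient. -/
def coannihilator (I : Subrepresentation (contragredient σ)) : Subrepresentation σ where
  toSubmodule :=
    { carrier := {v | ∀ f ∈ I, (f : Module.Dual ℂ V) v = 0}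
      zero_mem' := fun f _ => map_zero _
      add_mem' := fun {v w} hv hw f hf => by rw [map_add, hv f hf, hw f hf, add_zero]
      smul_mem' := fun c v hv f hf => by rw [map_smul, hv f hf, smul_zero] }
  apply_mem_toSubmodule a v hv f hf := by
    have := hv _ (I.apply_mem_toSubmodule a⁻¹ hf)
    rwa [contragredient_apply, inv_inv] at this

theorem mem_annihilator {N : Subrepresentation σ} {f : smoothDual σ} :
    f ∈ annihilator N ↔ ∀ v ∈ N, (f : Module.Dual ℂ V) v = 0 := Iff.rfl

theorem mem_coannihilator {I : Subrepresentation (contragredient σ)} {v : V} :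
    v ∈ coannihilator I ↔ ∀ f ∈ I, (f : Module.Dual ℂ V) v = 0 := Iff.rfl

theorem coannihilator_annihilator (hA : HasCompactOpenSubgroup A) (hσ : IsSmoothRep σ)
    (N : Subrepresentation σ) : coannihilator (annihilator N) = N := by
  refine le_antisymm (fun v hv => ?_) fun v hv f hf => hf v hv
  by_contra hvN
  have h1 : N.mkQ v ≠ 0 := fun h => hvN (Subrepresentation.mkQ_eq_zero.1 h)
  obtain ⟨⟨f, U, hU⟩, hf⟩ := (hσ.of_surjective N.mkQ N.mkQ_surjective).exists_smoothDual_ne_zero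
    hA h1
  refine hf (mem_coannihilator.1 hv ⟨f ∘ₗ N.toSubmodule.mkQ, U, fun a ha => ?_⟩ fun w hw => ?_)
  · exact LinearMap.ext fun w => LinearMap.congr_fun (hU a ha) (N.mkQ w)
  · exact (congrArg f (Subrepresentation.mkQ_eq_zero.2 hw)).trans (map_zero f)

/-- Every subrepresentation of the contragredient of an admissible representation is an
annihilator: on the vectors fixed by a compact open subgroup this is finite-dimensional duality. -/
theorem annihilator_coannihilator (hA : HasCompactOpenSubgroup A) (hσ : IsAdmissibleRep σ)
    (I : Subrepresentation (contragredient σ)) : annihilator (coannihilator I) = I := by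
  refine le_antisymm (fun f hf => ?_) fun f hf v hv => hv f hf
  obtain ⟨U, hU⟩ := f.2
  obtain ⟨K, hKU, hK⟩ := hA.exists_le U
  have hfix := hσ.1.finiteIndex_fixer hK
  have hfix' := (contragredient_smooth σ).finiteIndex_fixer hK
  have := hσ.2 K
  let X := fixedVectors σ K.toSubgroup
  let R : smoothDual σ →ₗ[ℂ] Module.Dual ℂ X := X.subtype.dualMap ∘ₗ (smoothDual σ).subtype
  let I' : Submodule ℂ (Module.Dual ℂ X) := I.toSubmodule.map R
  have hmem : R f ∈ I' := by
    rw [← Subspace.dualCoannihilator_dualAnnihilator_eq (W := I'),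
      Submodule.mem_dualAnnihilator]
    intro x hx
    rw [Submodule.mem_dualCoannihilator] at hx
    exact mem_annihilator.1 hf x fun g hg => hx (R g) ⟨g, hg, rfl⟩
  obtain ⟨g, hg, hgf⟩ := hmem
  have havg : ∀ (k : K.toSubgroup) (v : V), σ k (average hfix v) = average hfix v :=
    apply_average hfix
  have hinv : ∀ h : smoothDual σ, (∀ k ∈ K, contragredient σ k h = h) →
      ∀ v, (h : Module.Dual ℂ V) v = (h : Module.Dual ℂ V) (average hfix v) := by
    intro h hh v
    refine (map_average hfix (h : Module.Dual ℂ V) fun k => ?_).symm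
    have h1 := congrArg (fun l : smoothDual σ => (l : Module.Dual ℂ V) v)
      (hh (k⁻¹ : K.toSubgroup) (k⁻¹).2)
    simpa [contragredient_apply] using h1
  have hgavg : ∀ v, (average hfix' g : smoothDual σ).1 v = (f : Module.Dual ℂ V) v := by
    intro v
    rw [hinv (average hfix' g) fun k hk => apply_average hfix' ⟨k, hk⟩ g,
      hinv f fun k hk => Subtype.ext (hU k (hKU hk))]
    let l : smoothDual σ →ₗ[ℂ] ℂ :=
      (LinearMap.applyₗ (average hfix v)) ∘ₗ (smoothDual σ).subtype
    have h1 : l (average hfix' g) = l g := by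
      refine map_average hfix' l fun k => ?_
      change g.1 (σ (k⁻¹ : K.toSubgroup) (average hfix v)) = g.1 (average hfix v)
      rw [havg]
    refine h1.trans ?_
    exact LinearMap.congr_fun hgf ⟨average hfix v, fun a ha => havg ⟨a, ha⟩ v⟩
  have : average hfix' g = f := Subtype.ext (LinearMap.ext hgavg)
  rw [← this]
  exact average_mem hfix' fun k => I.apply_mem_toSubmodule k hg

theorem annihilator_le_annihilator_iff (hA : HasCompactOpenSubgroup A) (hσ : IsSmoothRep σ)
    {M N : Subrepresentation σ} : annihilator M ≤ annihilator N ↔ N ≤ M := by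
  refine ⟨fun h => ?_, fun h f hf v hv => hf v (h hv)⟩
  rw [← coannihilator_annihilator hA hσ M, ← coannihilator_annihilator hA hσ N]
  exact fun v hv f hf => hv f (h hf)

/-- Duality between the subrepresentations of an admissible representation and those of its
contragredient. -/
def annihilatorIso (hA : HasCompactOpenSubgroup A) (hσ : IsAdmissibleRep σ) :
    Subrepresentation σ ≃o (Subrepresentation (contragredient σ))ᵒᵈ where
  toFun N := OrderDual.toDual (annihilator N)
  invFun I := coannihilator (OrderDual.ofDual I)
  left_inv := coannihilator_annihilator hA hσ.1
  right_inv := annihilator_coannihilator hA hσ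
  map_rel_iff' := annihilator_le_annihilator_iff hA hσ.1

theorem length_contragredient (hA : HasCompactOpenSubgroup A) (hσ : IsAdmissibleRep σ) :
    (contragredient σ).length = σ.length := by
  rw [length_eq_coheight, length_eq_height, ← Order.height_orderIso (annihilatorIso hA hσ),
    OrderIso.map_top]
  rfl

theorem IsAdmissibleRep.contragredient (hA : HasCompactOpenSubgroup A) (hσ : IsAdmissibleRep σ) :
    IsAdmissibleRep (contragredient σ) := by
  refine ⟨contragredient_smooth σ, fun U => ?_⟩
  obtain ⟨K, hKU, hK⟩ := hA.exists_le U
  have hfix := hσ.1.finiteIndex_fixer hK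
  have := hσ.2 K
  let X := fixedVectors σ K.toSubgroup
  refine Module.Finite.of_injective (X.subtype.dualMap ∘ₗ (smoothDual σ).subtype ∘ₗ
    (fixedVectors (_root_.contragredient σ) U.toSubgroup).subtype) ?_
  refine (injective_iff_map_eq_zero _).2 fun f hf => Subtype.ext (Subtype.ext
    (LinearMap.ext fun v => ?_))
  -- a functional fixed by `K` is determined by its values on the `K`-fixed vectors
  have h1 : (f.1 : Module.Dual ℂ V) (average hfix v) = (f.1 : Module.Dual ℂ V) v := by
    refine map_average hfix (f.1 : Module.Dual ℂ V) fun k => ?_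
    have h1 := congrArg (fun l : smoothDual σ => (l : Module.Dual ℂ V) v)
      (f.2 (k⁻¹ : K.toSubgroup) (hKU (k⁻¹).2))
    simpa [contragredient_apply] using h1
  rw [← h1]
  exact LinearMap.congr_fun hf ⟨average hfix v, fun a ha => apply_average hfix ⟨a, ha⟩ v⟩

theorem IsGoodRep.contragredient (hA : HasCompactOpenSubgroup A) (hσ : IsGoodRep σ) :
    IsGoodRep (contragredient σ) := by
  refine ⟨?_, ?_, hσ.3.contragredient hA⟩
  · have := (OrderIso.complementedLattice_iff (annihilatorIso hA hσ.3)).1 hσ.1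
    exact ⟨fun N => by
      obtain ⟨M, hM⟩ := exists_isCompl (OrderDual.toDual N)
      exact ⟨OrderDual.ofDual M, hM.ofDual⟩⟩
  · rw [length_contragredient hA hσ.3]
    exact hσ.2

theorem IsIrrRep.contragredient (hA : HasCompactOpenSubgroup A) (hσ : IsIrrRep σ) :
    IsIrrRep (contragredient σ) := by
  refine ⟨length_eq_one_iff.1 ?_, hσ.2.contragredient hA⟩
  rw [length_contragredient hA hσ.2, length_eq_one_iff]
  exact hσ.1

/-- The evaluation map to the double contragredient. -/
def toDoubleContragredient (hσ : IsSmoothRep σ) :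
    IntertwiningMap σ (contragredient (contragredient σ)) where
  toLinearMap :=
    { toFun := fun v => ⟨(LinearMap.applyₗ v) ∘ₗ (smoothDual σ).subtype, by
        obtain ⟨U, hU⟩ := hσ v
        refine ⟨U, fun a ha => LinearMap.ext fun f => ?_⟩
        change (contragredient σ a⁻¹ f : Module.Dual ℂ V) v = f.1 v
        rw [contragredient_apply, inv_inv, hU a ha]⟩
      map_add' := fun v w => Subtype.ext (LinearMap.ext fun f => map_add f.1 v w)
      map_smul' := fun c v => Subtype.ext (LinearMap.ext fun f => map_smul f.1 c v) }
  isIntertwining' a := by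
    refine LinearMap.ext fun v => Subtype.ext (LinearMap.ext fun f => ?_)
    change f.1 (σ a v) = (contragredient σ a⁻¹ f : Module.Dual ℂ V) v
    rw [contragredient_apply, inv_inv]

theorem toDoubleContragredient_bijective (hA : HasCompactOpenSubgroup A)
    (hσ : IsAdmissibleRep σ) : Function.Bijective (toDoubleContragredient hσ.1) := by
  constructor
  · refine (injective_iff_map_eq_zero _).2 fun v hv => ?_
    by_contra hv0
    obtain ⟨f, hf⟩ := hσ.1.exists_smoothDual_ne_zero hA hv0
    exact hf (LinearMap.congr_fun (congrArg Subtype.val hv) f)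
  -- the range has trivial annihilator, so it is everything by the duality of subrepresentations
  · let I := (toDoubleContragredient hσ.1).range
    have h0 : coannihilator I = ⊥ := by
      refine le_antisymm (fun f hf => ?_) bot_le
      have : f = 0 := Subtype.ext (LinearMap.ext fun v => hf _ ⟨v, rfl⟩)
      exact this
    have hI : I = ⊤ := by
      rw [← annihilator_coannihilator hA (hσ.contragredient hA) I, h0]
      refine top_le_iff.1 fun f _ v hv => ?_
      have : v = 0 := hv
      rw [this, map_zero]
    intro x
    have : x ∈ I := by
      rw [hI]
      exact Submodule.mem_top
    exact this

end Contragredient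

/-! ### Unique irreducible quotients -/

section UniqueQuotient

open Representation

variable {B : Type*} [Group B] [TopologicalSpace B]
variable {V W : Type*} [AddCommGroup V] [Module ℂ V] [AddCommGroup W] [Module ℂ W]
variable {σ : Representation ℂ B V} {τ : Representation ℂ B W}

theorem Representation.IntertwiningMap.exists_inverse {A : Type*} [Group A]
    {σ : Representation ℂ A V} {τ : Representation ℂ A W} (φ : IntertwiningMap σ τ)
    (hφ : Function.Bijective φ) :
    ∃ ψ : IntertwiningMap τ σ, (∀ v, ψ (φ v) = v) ∧ ∀ w, φ (ψ w) = w := by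
  let e := LinearEquiv.ofBijective φ.toLinearMap hφ
  have h1 : ∀ w, φ (e.symm w) = w := e.apply_symm_apply
  refine ⟨⟨e.symm, fun g => LinearMap.ext fun w => hφ.1 ?_⟩, e.symm_apply_apply, h1⟩
  change φ (e.symm (τ g w)) = φ (σ g (e.symm w))
  rw [h1, φ.isIntertwining, h1]

/-- An intertwining map which vanishes on the kernel of a surjective one factors through it. -/
theorem Representation.IntertwiningMap.exists_factor {A : Type*} [Group A] {X : Type*}
    [AddCommGroup X] [Module ℂ X] {σ : Representation ℂ A V} {τ : Representation ℂ A W}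
    {υ : Representation ℂ A X} (φ : IntertwiningMap σ τ) (hφ : Function.Surjective φ)
    (ψ : IntertwiningMap σ υ) (h : ∀ v, φ v = 0 → ψ v = 0) :
    ∃ χ : IntertwiningMap τ υ, ∀ v, χ (φ v) = ψ v := by
  have hb : Function.Bijective (φ.ker.liftQ φ fun _ hv => hv) := by
    refine ⟨(injective_iff_map_eq_zero _).2 fun x hx => ?_, fun w => ?_⟩
    · obtain ⟨v, rfl⟩ := φ.ker.mkQ_surjective x
      exact Subrepresentation.mkQ_eq_zero.2 hx
    · obtain ⟨v, rfl⟩ := hφ w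
      exact ⟨φ.ker.mkQ v, rfl⟩
  obtain ⟨χ, hχ, -⟩ := IntertwiningMap.exists_inverse _ hb
  refine ⟨(φ.ker.liftQ ψ fun v hv => h v hv).comp χ, fun v => ?_⟩
  have h1 : χ (φ v) = φ.ker.mkQ v := hχ (φ.ker.mkQ v)
  rw [IntertwiningMap.comp_apply, h1]
  rfl

theorem Representation.length_eq_ker_add {A : Type*} [Group A] {σ : Representation ℂ A V}
    {τ : Representation ℂ A W} (φ : IntertwiningMap σ τ) (hφ : Function.Surjective φ) :
    σ.length = φ.ker.toRepresentation.length + τ.length :=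
  length_eq_add φ.ker.incl φ φ.ker.incl_injective hφ fun v =>
    ⟨fun hv => ⟨⟨v, hv⟩, rfl⟩, fun ⟨x, hx⟩ => hx ▸ x.2⟩

/-- A surjection onto a representation of at least the same finite length is injective. -/
theorem injective_of_length_le {A : Type*} [Group A] {σ : Representation ℂ A V}
    {τ : Representation ℂ A W} (φ : IntertwiningMap σ τ) (hφ : Function.Surjective φ)
    (h : σ.length ≤ τ.length) (hτ : τ.length ≠ ⊤) : Function.Injective φ := by
  have h2 : φ.ker.toRepresentation.length = 0 := by
    have h3 : φ.ker.toRepresentation.length + τ.length ≤ 0 + τ.length := by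
      rw [zero_add, ← length_eq_ker_add φ hφ]; exact h
    exact le_antisymm ((ENat.add_le_add_iff_right hτ).1 h3) bot_le
  have h4 : Subsingleton φ.ker.toSubmodule := length_eq_zero_iff.1 h2
  refine (injective_iff_map_eq_zero φ).2 fun v hv => ?_
  exact congrArg Subtype.val (Subsingleton.elim (⟨v, hv⟩ : φ.ker.toSubmodule) 0)

/-- If `V / (N₁ ∩ N₂)` is not longer than its quotient `V / N₁`, then the two agree. -/
theorem le_of_length_inf_quot_le {A : Type*} [Group A] {σ : Representation ℂ A V}
    {N₁ N₂ : Subrepresentation σ} (h : (N₁ ⊓ N₂).quot.length ≤ N₁.quot.length)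
    (h₁ : N₁.quot.length ≠ ⊤) : N₁ ≤ N₂ := by
  let ψ : IntertwiningMap (N₁ ⊓ N₂).quot N₁.quot :=
    (N₁ ⊓ N₂).liftQ N₁.mkQ fun v hv => Subrepresentation.mkQ_eq_zero.2 hv.1
  have hψ : Function.Surjective ψ := fun y => by
    obtain ⟨x, rfl⟩ := N₁.mkQ_surjective y
    exact ⟨(N₁ ⊓ N₂).mkQ x, rfl⟩
  have hinj := injective_of_length_le ψ hψ h h₁
  intro x hx
  have h1 : (N₁ ⊓ N₂).mkQ x = 0 := hinj (by
    rw [map_zero]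
    exact Subrepresentation.mkQ_eq_zero.2 hx)
  exact (Subrepresentation.mkQ_eq_zero.1 h1).2

/-- The quotient by `N₁ ∩ N₂` embeds into the product of the quotients by `N₁` and by `N₂`. -/
theorem IsGoodRep.inf_quot {N₁ N₂ : Subrepresentation σ} (h₁ : IsGoodRep N₁.quot)
    (h₂ : IsGoodRep N₂.quot) : IsGoodRep (N₁ ⊓ N₂).quot := by
  let N : Bool → Subrepresentation σ := fun i => cond i N₁ N₂
  have hN : ∀ i, IsGoodRep (N i).quot := by
    rintro (_ | _)
    · exact h₂
    · exact h₁
  let Φ : IntertwiningMap σ (piRep fun i => (N i).quot) :=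
    { toLinearMap := LinearMap.pi fun i => (N i).toSubmodule.mkQ
      isIntertwining' := fun g => rfl }
  have hΦ : ∀ v, Φ v = 0 ↔ v ∈ N₁ ⊓ N₂ := by
    intro v
    refine ⟨fun hv => ⟨?_, ?_⟩, fun hv => funext fun i => ?_⟩
    · exact Subrepresentation.mkQ_eq_zero.1 (congrFun hv true)
    · exact Subrepresentation.mkQ_eq_zero.1 (congrFun hv false)
    · cases i
      · exact Subrepresentation.mkQ_eq_zero.2 hv.2
      · exact Subrepresentation.mkQ_eq_zero.2 hv.1
  refine (IsGoodRep.pi hN).of_injective ((N₁ ⊓ N₂).liftQ Φ fun v hv => (hΦ v).2 hv)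
    ((injective_iff_map_eq_zero _).2 fun x hx => ?_)
  obtain ⟨v, rfl⟩ := (N₁ ⊓ N₂).mkQ_surjective x
  exact Subrepresentation.mkQ_eq_zero.2 ((hΦ v).1 hx)

theorem IsIrrRep.of_bijective_symm (h : IsIrrRep τ) (φ : IntertwiningMap σ τ)
    (hφ : Function.Bijective φ) : IsIrrRep σ := by
  refine ⟨length_eq_one_iff.1 (le_antisymm ?_ ?_), h.2.of_injective φ hφ.1⟩
  · exact (length_le_of_injective φ hφ.1).trans (length_eq_one_iff.2 h.1).le
  · exact (length_eq_one_iff.2 h.1).ge.trans (length_le_of_surjective φ hφ.2)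

theorem IsIrrRep.quot_of_surjective (h : IsIrrRep τ) (φ : IntertwiningMap σ τ)
    (hφ : Function.Surjective φ) : IsIrrRep φ.ker.quot := by
  refine h.of_bijective_symm (φ.ker.liftQ φ fun _ hv => hv) ⟨?_, fun w => ?_⟩
  · refine (injective_iff_map_eq_zero _).2 fun x hx => ?_
    obtain ⟨v, rfl⟩ := φ.ker.mkQ_surjective x
    exact Subrepresentation.mkQ_eq_zero.2 hx
  · obtain ⟨v, rfl⟩ := hφ w
    exact ⟨φ.ker.mkQ v, rfl⟩

theorem FiniteLengthUniqueQuotient.of_bijective (h : FiniteLengthUniqueQuotient σ)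
    (φ : IntertwiningMap σ τ) (hφ : Function.Bijective φ) : FiniteLengthUniqueQuotient τ := by
  refine ⟨length_ne_top_iff.1 (ne_top_of_le_ne_top (length_ne_top_iff.2 h.1)
    (length_le_of_surjective φ hφ.2)), fun hW => ?_⟩
  have : Nontrivial V := hφ.2.nontrivial
  obtain ⟨N, hN, huniq⟩ := h.2 this
  obtain ⟨ψ, hψφ, hφψ⟩ := φ.exists_inverse hφ
  have hψ : Function.Surjective ψ := fun v => ⟨φ v, hψφ v⟩
  have hk : ∀ {M : Subrepresentation σ} {w : W},
      w ∈ (M.mkQ.comp ψ).ker ↔ ψ w ∈ M := Subrepresentation.mkQ_eq_zero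
  refine ⟨(N.mkQ.comp ψ).ker, IsIrrRep.quot_of_surjective hN _ (N.mkQ_surjective.comp hψ),
    fun M hM => ?_⟩
  have h1 := huniq (M.mkQ.comp φ).ker (IsIrrRep.quot_of_surjective hM _
    (M.mkQ_surjective.comp hφ.2))
  refine SetLike.ext fun w => ?_
  rw [hk, ← h1]
  change _ ↔ M.mkQ (φ (ψ w)) = 0
  rw [hφψ, Subrepresentation.mkQ_eq_zero]

/-- If `σ` has a unique irreducible admissible quotient, then its semisimple admissible quotients
have length at most one. -/
theorem FiniteLengthUniqueQuotient.length_le_one (h : FiniteLengthUniqueQuotient σ)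
    (φ : IntertwiningMap σ τ) (hφ : Function.Surjective φ)
    (hss : τ.IsSemisimpleRepresentation) (hadm : IsAdmissibleRep τ) : τ.length ≤ 1 := by
  refine hss.length_le_one fun M N hM hN => ?_
  have hirr : ∀ M : Subrepresentation τ, M.quot.IsIrreducible → IsIrrRep M.quot := by
    intro M hM
    obtain ⟨s, hs⟩ := hss.exists_section M.mkQ M.mkQ_surjective
    exact ⟨hM, hadm.of_injective s (Function.LeftInverse.injective hs)⟩
  have hk : ∀ {M : Subrepresentation τ} {v : V},
      v ∈ (M.mkQ.comp φ).ker ↔ φ v ∈ M := Subrepresentation.mkQ_eq_zero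
  have : Nontrivial V := by
    have := hM.nontrivial
    exact (M.mkQ_surjective.comp hφ).nontrivial
  have heq := (h.2 this).unique
    (IsIrrRep.quot_of_surjective (hirr M hM) (M.mkQ.comp φ) (M.mkQ_surjective.comp hφ))
    (IsIrrRep.quot_of_surjective (hirr N hN) (N.mkQ.comp φ) (N.mkQ_surjective.comp hφ))
  refine SetLike.ext fun w => ?_
  obtain ⟨v, rfl⟩ := hφ w
  rw [← hk, heq, hk]

end UniqueQuotient

/-! ### Equivariant pairings and theta lifts -/

section Pairings

open Representation

variable {J A B : Type*} [Group J] [Group A] [Group B]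
variable {Ω V W V' W' : Type*} [AddCommGroup Ω] [Module ℂ Ω] [AddCommGroup V] [Module ℂ V]
  [AddCommGroup W] [Module ℂ W] [AddCommGroup V'] [Module ℂ V'] [AddCommGroup W'] [Module ℂ W']

/-- The coinvariants `(Ω ⊗ ρ)_{ker q}` as a representation of `B = J / ker q`. The big theta lift of
`π` is the case in which `ρ` is the contragredient of `π`. -/
def thetaRep (p : J →* A) (q : J →* B) (hq : Function.Surjective q)
    (ω : Representation ℂ J Ω) (ρ : Representation ℂ A V) :
    Representation ℂ B
      (Representation.Coinvariants
        (MonoidHom.comp (ω.tprod (MonoidHom.comp ρ p)) q.ker.subtype)) :=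
  ((ω.tprod (MonoidHom.comp ρ p)).quotientToCoinvariants q.ker).comp
    (QuotientGroup.quotientKerEquivOfSurjective q hq).symm.toMonoidHom

theorem thetaRep_apply_mk (p : J →* A) (q : J →* B) (hq : Function.Surjective q)
    (ω : Representation ℂ J Ω) (ρ : Representation ℂ A V) (j : J) (x : Ω ⊗[ℂ] V) :
    thetaRep p q hq ω ρ (q j) (Coinvariants.mk _ x) =
      Coinvariants.mk _ (ω.tprod (MonoidHom.comp ρ p) j x) := by
  have h : (QuotientGroup.quotientKerEquivOfSurjective q hq).symm (q j) =
      QuotientGroup.mk j := by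
    rw [MulEquiv.symm_apply_eq]
    rfl
  change ((ω.tprod (MonoidHom.comp ρ p)).quotientToCoinvariants q.ker)
    ((QuotientGroup.quotientKerEquivOfSurjective q hq).symm (q j)) _ = _
  rw [h]
  rfl

/-- A bilinear map `Ω × ρ → τ` which is equivariant for `J`, acting on `ρ` through `p` and on `τ`
through `q`. -/
structure Pairing (p : J →* A) (q : J →* B) (ω : Representation ℂ J Ω)
    (ρ : Representation ℂ A V) (τ : Representation ℂ B W) where
  /-- the bilinear map -/
  bilin : Ω →ₗ[ℂ] V →ₗ[ℂ] W
  equivariant : ∀ j w v, bilin (ω j w) (ρ (p j) v) = τ (q j) (bilin w v)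

namespace Pairing

variable {p : J →* A} {q : J →* B} {ω : Representation ℂ J Ω}
  {ρ : Representation ℂ A V} {τ : Representation ℂ B W}
  {ρ' : Representation ℂ A V'} {τ' : Representation ℂ B W'}

/-- A pairing whose values span `τ`. -/
def Spanning (β : Pairing p q ω ρ τ) : Prop :=
  Submodule.span ℂ {x | ∃ w v, β.bilin w v = x} = ⊤

/-- A pairing with trivial right kernel. -/
def Separating (β : Pairing p q ω ρ τ) : Prop :=
  ∀ v, (∀ w, β.bilin w v = 0) → v = 0

/-- Composition with a map of the target. -/
def map (β : Pairing p q ω ρ τ) (φ : IntertwiningMap τ τ') : Pairing p q ω ρ τ' where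
  bilin := β.bilin.compr₂ φ.toLinearMap
  equivariant j w v := by
    change φ (β.bilin _ _) = τ' (q j) (φ (β.bilin w v))
    rw [β.equivariant, φ.isIntertwining]

/-- Composition with a map to `ρ`. -/
def precomp (β : Pairing p q ω ρ τ) (φ : IntertwiningMap ρ' ρ) : Pairing p q ω ρ' τ where
  bilin := β.bilin.compl₂ φ.toLinearMap
  equivariant j w v := by
    change β.bilin _ (φ _) = τ (q j) (β.bilin w (φ v))
    rw [φ.isIntertwining, β.equivariant]

@[simp]
theorem precomp_bilin (β : Pairing p q ω ρ τ) (φ : IntertwiningMap ρ' ρ) (w : Ω) (v : V') :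
    (β.precomp φ).bilin w v = β.bilin w (φ v) := rfl

/-- The universal pairing, with values in the theta lift. -/
def univ (p : J →* A) (q : J →* B) (hq : Function.Surjective q) (ω : Representation ℂ J Ω)
    (ρ : Representation ℂ A V) : Pairing p q ω ρ (thetaRep p q hq ω ρ) where
  bilin := (TensorProduct.mk ℂ Ω V).compr₂ (Coinvariants.mk _)
  equivariant j w v := (thetaRep_apply_mk p q hq ω ρ j (w ⊗ₜ v)).symm

theorem univ_spanning (p : J →* A) (q : J →* B) (hq : Function.Surjective q)
    (ω : Representation ℂ J Ω) (ρ : Representation ℂ A V) : (univ p q hq ω ρ).Spanning := by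
  refine top_le_iff.1 fun x _ => ?_
  obtain ⟨y, rfl⟩ := Coinvariants.mk_surjective _ x
  induction y using TensorProduct.induction_on with
  | zero => rw [map_zero]; exact Submodule.zero_mem _
  | tmul w v => exact Submodule.subset_span ⟨w, v, rfl⟩
  | add y z hy hz => rw [map_add]; exact Submodule.add_mem _ (hy trivial) (hz trivial)

theorem Spanning.map {β : Pairing p q ω ρ τ} (hβ : β.Spanning) {φ : IntertwiningMap τ τ'}
    (hφ : Function.Surjective φ) : (β.map φ).Spanning := by
  refine top_le_iff.1 ?_
  have h1 : (⊤ : Submodule ℂ W') = Submodule.map φ.toLinearMap ⊤ := by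
    rw [Submodule.map_top, LinearMap.range_eq_top.2 hφ]
  rw [h1, ← hβ, Submodule.map_span_le]
  rintro _ ⟨w, v, rfl⟩
  exact Submodule.subset_span ⟨w, v, rfl⟩

theorem Spanning.precomp {β : Pairing p q ω ρ τ} (hβ : β.Spanning) {φ : IntertwiningMap ρ' ρ}
    (hφ : Function.Surjective φ) : (β.precomp φ).Spanning := by
  refine top_le_iff.1 ?_
  rw [← hβ, Submodule.span_le]
  rintro _ ⟨w, v, rfl⟩
  obtain ⟨v, rfl⟩ := hφ v
  exact Submodule.subset_span ⟨w, v, rfl⟩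

theorem Spanning.ext {β : Pairing p q ω ρ τ} (hβ : β.Spanning) {φ ψ : IntertwiningMap τ τ'}
    (h : ∀ w v, φ (β.bilin w v) = ψ (β.bilin w v)) : φ = ψ := by
  refine IntertwiningMap.ext (LinearMap.ext_on hβ ?_)
  rintro _ ⟨w, v, rfl⟩
  exact h w v

theorem Spanning.surjective_of_map {β : Pairing p q ω ρ τ} {φ : IntertwiningMap τ τ'}
    (h : (β.map φ).Spanning) : Function.Surjective φ := by
  refine LinearMap.range_eq_top.1 (top_le_iff.1 ?_)
  rw [← h, Submodule.span_le]
  rintro _ ⟨w, v, rfl⟩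
  exact ⟨β.bilin w v, rfl⟩

section Lift

variable {J₀ G H : Type*} [Group J₀] [Group G] [Group H] {κ : J₀ →* J} {f : G →* A} {f' : H →* B}
  {p₀ : J₀ →* G} {q₀ : J₀ →* H} {X : Type*} [AddCommGroup X] [Module ℂ X]
  {υ : Representation ℂ H X}

/-- Restriction of a pairing to a smaller group. -/
def res (β : Pairing p q ω ρ τ) (hp : ∀ j, p (κ j) = f (p₀ j)) (hq : ∀ j, q (κ j) = f' (q₀ j)) :
    Pairing p₀ q₀ (MonoidHom.comp ω κ) (MonoidHom.comp ρ f) (MonoidHom.comp τ f') where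
  bilin := β.bilin
  equivariant j w v := by
    have := β.equivariant (κ j) w v
    rwa [hp, hq] at this

/-- The elements of `ker q` come from elements of `J₀` acting trivially on the target, so the functional
induced by the pairing factors through the coinvariants. -/
theorem lift_invariant (hp : ∀ j, p (κ j) = f (p₀ j))
    (hker : ∀ j, q j = 1 → ∃ j₀, q₀ j₀ = 1 ∧ κ j₀ = j)
    (β : Pairing p₀ q₀ (MonoidHom.comp ω κ) (MonoidHom.comp ρ f) υ) (x : q.ker) :
    TensorProduct.lift β.bilin ∘ₗ
      (MonoidHom.comp (ω.tprod (MonoidHom.comp ρ p)) q.ker.subtype) x =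
      TensorProduct.lift β.bilin := by
  obtain ⟨j, hj⟩ := x
  obtain ⟨j₀, hj₀, rfl⟩ := hker j hj
  refine TensorProduct.ext' fun w v => ?_
  have := β.equivariant j₀ w v
  rw [hj₀, map_one] at this
  change TensorProduct.lift β.bilin (ω (κ j₀) w ⊗ₜ[ℂ] ρ (p (κ j₀)) v) = _
  rw [TensorProduct.lift.tmul, TensorProduct.lift.tmul, hp]
  exact this

/-- The universal property of the theta lift, for pairings which are only equivariant for a subgroup
of `J` containing `ker q`. -/
def lift (hqs : Function.Surjective q) (hp : ∀ j, p (κ j) = f (p₀ j))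
    (hq : ∀ j, q (κ j) = f' (q₀ j)) (hq₀ : Function.Surjective q₀)
    (hker : ∀ j, q j = 1 → ∃ j₀, q₀ j₀ = 1 ∧ κ j₀ = j)
    (β : Pairing p₀ q₀ (MonoidHom.comp ω κ) (MonoidHom.comp ρ f) υ) :
    IntertwiningMap (MonoidHom.comp (thetaRep p q hqs ω ρ) f') υ where
  toLinearMap := Coinvariants.lift _ (TensorProduct.lift β.bilin) (lift_invariant hp hker β)
  isIntertwining' h := by
    obtain ⟨j, rfl⟩ := hq₀ h
    refine Coinvariants.hom_ext (TensorProduct.ext' fun w v => ?_)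
    change Coinvariants.lift _ (TensorProduct.lift β.bilin) (lift_invariant hp hker β)
      (thetaRep p q hqs ω ρ (f' (q₀ j)) (Coinvariants.mk _ (w ⊗ₜ[ℂ] v))) =
      υ (q₀ j) (TensorProduct.lift β.bilin (w ⊗ₜ v))
    rw [← hq, thetaRep_apply_mk, TensorProduct.lift.tmul, ← β.equivariant]
    change TensorProduct.lift β.bilin (ω (κ j) w ⊗ₜ[ℂ] ρ (p (κ j)) v) = _
    rw [TensorProduct.lift.tmul, hp]
    rfl

end Lift

/-- The map from the theta lift defined by a pairing. -/
def toMap (hq : Function.Surjective q) (β : Pairing p q ω ρ τ) :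
    IntertwiningMap (thetaRep p q hq ω ρ) τ :=
  lift (κ := MonoidHom.id J) (f := MonoidHom.id A) (f' := MonoidHom.id B) (p₀ := p) (q₀ := q) hq
    (fun _ => rfl) (fun _ => rfl) hq (fun j hj => ⟨j, hj, rfl⟩) β

theorem toMap_univ (hq : Function.Surjective q) (β : Pairing p q ω ρ τ) (w : Ω) (v : V) :
    β.toMap hq ((univ p q hq ω ρ).bilin w v) = β.bilin w v :=
  rfl

theorem Spanning.toMap_surjective (hq : Function.Surjective q) {β : Pairing p q ω ρ τ}
    (hβ : β.Spanning) : Function.Surjective (β.toMap hq) :=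
  Spanning.surjective_of_map (β := univ p q hq ω ρ) (φ := β.toMap hq) hβ

/-- The subrepresentation spanned by the values of a pairing. -/
def span (hq : Function.Surjective q) (β : Pairing p q ω ρ τ) : Subrepresentation τ where
  toSubmodule := Submodule.span ℂ {x | ∃ w v, β.bilin w v = x}
  apply_mem_toSubmodule b x hx := by
    obtain ⟨j, rfl⟩ := hq b
    refine Submodule.span_induction (fun y hy => ?_) ?_ (fun y z _ _ hy hz => ?_)
      (fun a y _ hy => ?_) hx
    · obtain ⟨w, v, rfl⟩ := hy
      exact Submodule.subset_span ⟨ω j w, ρ (p j) v, β.equivariant j w v⟩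
    · rw [map_zero]; exact Submodule.zero_mem _
    · rw [map_add]; exact Submodule.add_mem _ hy hz
    · rw [map_smul]; exact Submodule.smul_mem _ _ hy

theorem mem_span (hq : Function.Surjective q) (β : Pairing p q ω ρ τ) (w : Ω) (v : V) :
    β.bilin w v ∈ β.span hq :=
  Submodule.subset_span ⟨w, v, rfl⟩

theorem span_le {hq : Function.Surjective q} {β : Pairing p q ω ρ τ} {N : Subrepresentation τ} :
    β.span hq ≤ N ↔ ∀ w v, β.bilin w v ∈ N := by
  refine ⟨fun h w v => h (β.mem_span hq w v), fun h => ?_⟩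
  refine (Submodule.span_le (p := N.toSubmodule)).2 ?_
  rintro _ ⟨w, v, rfl⟩
  exact h w v

/-- The pairing with values in a subrepresentation. -/
def codRestrict (β : Pairing p q ω ρ τ) (N : Subrepresentation τ)
    (h : ∀ w v, β.bilin w v ∈ N) : Pairing p q ω ρ N.toRepresentation where
  bilin := LinearMap.mk₂ ℂ (fun w v => (⟨β.bilin w v, h w v⟩ : N.toSubmodule))
    (fun w w' v => Subtype.ext (by simp)) (fun c w v => Subtype.ext (by simp))
    (fun w v v' => Subtype.ext (by simp)) (fun c w v => Subtype.ext (by simp))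
  equivariant j w v := Subtype.ext (β.equivariant j w v)

theorem codRestrict_span_spanning (hq : Function.Surjective q) (β : Pairing p q ω ρ τ) :
    (β.codRestrict (β.span hq) (β.mem_span hq)).Spanning := by
  refine top_le_iff.1 fun x _ => ?_
  obtain ⟨x, hx⟩ := x
  refine Submodule.span_induction (p := fun y hy => (⟨y, hy⟩ : (β.span hq).toSubmodule) ∈
    Submodule.span ℂ {x | ∃ w v, (β.codRestrict (β.span hq) (β.mem_span hq)).bilin w v = x})
    ?_ ?_ ?_ ?_ hx
  · rintro y ⟨w, v, rfl⟩
    exact Submodule.subset_span ⟨w, v, rfl⟩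
  · exact Submodule.zero_mem _
  · intro y z _ _ hy hz
    exact Submodule.add_mem _ hy hz
  · intro a y _ hy
    exact Submodule.smul_mem _ a hy

/-- The pairing of quotients. -/
def quot (β : Pairing p q ω ρ τ) (N : Subrepresentation ρ) (S : Subrepresentation τ)
    (h : ∀ w, ∀ v ∈ N, β.bilin w v ∈ S) : Pairing p q ω N.quot S.quot where
  bilin := (N.toSubmodule.liftQ (β.bilin.compr₂ S.toSubmodule.mkQ).flip fun v hv =>
    LinearMap.ext fun w => (Submodule.Quotient.mk_eq_zero _).2 (h w v hv)).flip
  equivariant j w v := by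
    obtain ⟨v, rfl⟩ := N.mkQ_surjective v
    exact congrArg S.toSubmodule.mkQ (β.equivariant j w v)

theorem Spanning.quot {β : Pairing p q ω ρ τ} (hβ : β.Spanning) (N : Subrepresentation ρ)
    (S : Subrepresentation τ) (h : ∀ w, ∀ v ∈ N, β.bilin w v ∈ S) : (β.quot N S h).Spanning := by
  refine top_le_iff.1 ?_
  have h1 := hβ.map S.mkQ_surjective
  rw [← h1, Submodule.span_le]
  rintro _ ⟨w, v, rfl⟩
  exact Submodule.subset_span ⟨w, N.mkQ v, rfl⟩

/-- The vectors pairing `Ω` into a subrepresentation of `τ`. -/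
def transporter (hp : Function.Surjective p) (β : Pairing p q ω ρ τ) (S : Subrepresentation τ) :
    Subrepresentation ρ where
  toSubmodule :=
    { carrier := {v | ∀ w, β.bilin w v ∈ S}
      zero_mem' := fun w => by rw [map_zero]; exact S.toSubmodule.zero_mem
      add_mem' := fun {v v'} hv hv' w => by
        rw [map_add]; exact S.toSubmodule.add_mem (hv w) (hv' w)
      smul_mem' := fun c v hv w => by rw [map_smul]; exact S.toSubmodule.smul_mem c (hv w) }
  apply_mem_toSubmodule a v hv w := by
    obtain ⟨j, rfl⟩ := hp a
    have := S.apply_mem_toSubmodule (q j) (hv (ω j⁻¹ w))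
    rwa [← β.equivariant, ← Module.End.mul_apply, ← map_mul, mul_inv_cancel, map_one] at this

/-- A nonzero pairing on an irreducible representation is separating. -/
theorem separating_of_ne_zero (hp : Function.Surjective p) {β : Pairing p q ω ρ τ}
    (hρ : ρ.IsIrreducible) {w : Ω} {v : V} (h : β.bilin w v ≠ 0) : β.Separating := by
  have h1 : β.transporter hp ⊥ = ⊥ := by
    refine (hρ.eq_bot_or_eq_top _).resolve_right fun h0 => h ?_
    have : v ∈ β.transporter hp ⊥ := by
      rw [h0]
      exact Submodule.mem_top
    exact this w
  intro v hv
  have : v ∈ β.transporter hp ⊥ := hv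
  rw [h1] at this
  exact this

end Pairing

end Pairings

/-! ### Lengths in equivariant pairings -/

section PairingLength

open Representation

theorem Representation.length_toRepresentation {G W : Type*} [Group G] [AddCommGroup W]
    [Module ℂ W] {τ : Representation ℂ G W} (N : Subrepresentation τ) :
    N.toRepresentation.length = Order.height N := by
  let φ := IntertwiningMap.equivLinearMapAsModule N.toRepresentation τ N.incl
  have hφ : Function.Injective φ := N.incl_injective
  have hk : LinearMap.range φ = Subrepresentation.subrepresentationSubmoduleOrderIso N := by
    refine SetLike.ext fun w => ?_
    exact ⟨fun ⟨x, hx⟩ => hx ▸ x.2, fun h => ⟨⟨w, h⟩, rfl⟩⟩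
  rw [length, (LinearEquiv.ofInjective φ hφ).length_eq, Module.length_submodule, hk,
    Order.height_orderIso]

variable {J A B : Type u} [Group J] [Group A] [Group B] [TopologicalSpace A] [TopologicalSpace B]
variable {Ω : Type u} [AddCommGroup Ω] [Module ℂ Ω]
variable {V W V' : Type u} [AddCommGroup V] [Module ℂ V] [AddCommGroup W] [Module ℂ W]
  [AddCommGroup V'] [Module ℂ V']
variable {p : J →* A} {q : J →* B} {ω : Representation ℂ J Ω}
variable {ρ : Representation ℂ A V} {τ : Representation ℂ B W}

/-- One half of the Howe duality property, for the lifts `(Ω ⊗ ρ)_{ker q}` of the irreducible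
admissible representations `ρ` of `A`. Passing to contragredients identifies it with the statement
about the big theta lifts of the representations in `Irr A`. -/
def HoweFor (p : J →* A) (q : J →* B) (hq : Function.Surjective q)
    (ω : Representation ℂ J Ω) : Prop :=
  ∀ (V : Type u) [AddCommGroup V] [Module ℂ V] (ρ : Representation ℂ A V),
    IsIrrRep ρ → FiniteLengthUniqueQuotient (thetaRep p q hq ω ρ)

omit [TopologicalSpace A] in
theorem FiniteLengthUniqueQuotient.thetaRep_of_bijective {ρ' : Representation ℂ A V'}
    (hq : Function.Surjective q) (h : FiniteLengthUniqueQuotient (thetaRep p q hq ω ρ'))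
    (φ : IntertwiningMap ρ' ρ) (hφ : Function.Bijective φ) :
    FiniteLengthUniqueQuotient (thetaRep p q hq ω ρ) := by
  obtain ⟨ψ, hψφ, hφψ⟩ := φ.exists_inverse hφ
  have hs := ((Pairing.univ_spanning p q hq ω ρ).precomp
    (φ := φ) hφ.2).toMap_surjective hq
  refine h.of_bijective _ ⟨?_, hs⟩
  let α := ((Pairing.univ p q hq ω ρ').precomp ψ).toMap hq
  have e : α.comp (((Pairing.univ p q hq ω ρ).precomp φ).toMap hq) = IntertwiningMap.id _ := by
    refine (Pairing.univ_spanning p q hq ω _).ext fun w v => ?_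
    change (Pairing.univ p q hq ω ρ').bilin w (ψ (φ v)) = (Pairing.univ p q hq ω ρ').bilin w v
    rw [hψφ]
  exact Function.LeftInverse.injective (g := α) fun x => congrArg (fun γ => γ x) e

/-- Irreducible admissible representations are contragredients, by double duality; so the theta lifts may
be formed from `ρ` in place of its contragredient. -/
theorem howeFor_iff [SeparatelyContinuousMul A] (hA : HasCompactOpenSubgroup A)
    (hq : Function.Surjective q) :
    HoweFor p q hq ω ↔ ∀ (V : Type u) [AddCommGroup V] [Module ℂ V] (ρ : Representation ℂ A V),
      IsIrrRep ρ → FiniteLengthUniqueQuotient (bigTheta p q hq ω ρ) := by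
  refine ⟨fun h V _ _ ρ hρ => h _ _ (hρ.contragredient hA), fun h V _ _ ρ hρ => ?_⟩
  obtain ⟨ψ, hψφ, hφψ⟩ :=
    (toDoubleContragredient hρ.2.1).exists_inverse (toDoubleContragredient_bijective hA hρ.2)
  exact FiniteLengthUniqueQuotient.thetaRep_of_bijective hq (h _ _ (hρ.contragredient hA)) ψ
    ⟨Function.LeftInverse.injective (g := toDoubleContragredient hρ.2.1) hφψ,
      Function.RightInverse.surjective (g := toDoubleContragredient hρ.2.1) hψφ⟩

namespace Pairing

omit [TopologicalSpace A] [TopologicalSpace B] in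
theorem Spanning.subsingleton {β : Pairing p q ω ρ τ} (hβ : β.Spanning) [Subsingleton V] :
    Subsingleton W := by
  have h0 : ∀ x : W, x = 0 := fun x => by
    have h1 : (⊤ : Submodule ℂ W) ≤ ⊥ := by
      rw [← hβ, Submodule.span_le]
      rintro _ ⟨w, v, rfl⟩
      rw [Subsingleton.elim v 0, map_zero]
      exact Submodule.zero_mem _
    exact h1 (Submodule.mem_top (x := x))
  exact ⟨fun a b => (h0 a).trans (h0 b).symm⟩

omit [TopologicalSpace A] [TopologicalSpace B] in
theorem Spanning.exists_ne_zero {β : Pairing p q ω ρ τ} (hβ : β.Spanning) [Nontrivial W] :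
    ∃ w v, β.bilin w v ≠ 0 := by
  by_contra! hall
  obtain ⟨y, hy⟩ := exists_ne (0 : W)
  refine hy (LinearMap.congr_fun (LinearMap.ext_on hβ (f := LinearMap.id) (g := 0) ?_) y)
  rintro _ ⟨w, v, rfl⟩
  exact hall w v

omit [TopologicalSpace A] [TopologicalSpace B] in
theorem nontrivial_thetaRep (hq : Function.Surjective q) (β : Pairing p q ω ρ τ) {w : Ω} {v : V}
    (h : β.bilin w v ≠ 0) :
    Nontrivial (Coinvariants (MonoidHom.comp (ω.tprod (MonoidHom.comp ρ p)) q.ker.subtype)) := by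
  by_contra hsub
  rw [not_nontrivial_iff_subsingleton] at hsub
  refine h ?_
  rw [← β.toMap_univ hq, Subsingleton.elim ((univ p q hq ω ρ).bilin w v) 0, map_zero]

/-- A spanning pairing between semisimple representations does not increase the length. -/
theorem length_le_of_spanning {hq : Function.Surjective q} (hH : HoweFor p q hq ω)
    (hρ : IsGoodRep ρ) (hτ : IsGoodRep τ) (β : Pairing p q ω ρ τ) (hβ : β.Spanning) :
    τ.length ≤ ρ.length := by
  obtain ⟨n, hn⟩ := ENat.ne_top_iff_exists.1 hρ.length_ne_top
  induction n generalizing V W with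
  | zero =>
    have := length_eq_zero_iff.1 (hn.symm.trans Nat.cast_zero)
    exact le_of_eq_of_le (length_eq_zero_iff.2 hβ.subsingleton) bot_le
  | succ n ih =>
    obtain ⟨N, hN, hNq⟩ := exists_length_eq_quot_add_one hn.symm
    -- the irreducible piece `N` spans at most one irreducible representation
    let β' := β.precomp N.incl
    let S := β'.span hq
    have h1 : S.toRepresentation.length ≤ 1 :=
      (hH _ _ ⟨hN, (hρ.of_injective N.incl N.incl_injective).admissible⟩).length_le_one
        ((β'.codRestrict S (β'.mem_span hq)).toMap hq)
        (β'.codRestrict_span_spanning hq |>.toMap_surjective hq)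
        (hτ.of_injective S.incl S.incl_injective).semisimple
        (hτ.of_injective S.incl S.incl_injective).admissible
    have h2 := ih (hρ.of_surjective N.mkQ N.mkQ_surjective) (hτ.of_surjective S.mkQ S.mkQ_surjective)
      (β.quot N S fun w v hv => β'.mem_span hq w ⟨v, hv⟩) (hβ.quot N S _) hNq.symm
    rw [length_eq_sub_add_quot S, length_eq_sub_add_quot N, length_eq_one_iff.2 hN]
    exact add_le_add h1 h2

/-- The target of a spanning pairing on a semisimple representation of finite length has finite
length. -/
theorem length_ne_top_of_spanning {hq : Function.Surjective q} (hH : HoweFor p q hq ω)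
    (hρ : IsGoodRep ρ) (β : Pairing p q ω ρ τ) (hβ : β.Spanning) : τ.length ≠ ⊤ := by
  obtain ⟨n, hn⟩ := ENat.ne_top_iff_exists.1 hρ.length_ne_top
  induction n generalizing V W with
  | zero =>
    have := length_eq_zero_iff.1 (hn.symm.trans Nat.cast_zero)
    rw [length_eq_zero_iff.2 hβ.subsingleton]
    exact ENat.zero_ne_top
  | succ n ih =>
    obtain ⟨N, hN, hNq⟩ := exists_length_eq_quot_add_one hn.symm
    let β' := β.precomp N.incl
    let S := β'.span hq
    have h1 : S.toRepresentation.length ≠ ⊤ := by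
      refine ne_top_of_le_ne_top (length_ne_top_iff.2
        (hH _ _ ⟨hN, (hρ.of_injective N.incl N.incl_injective).admissible⟩).1)
        (length_le_of_surjective ((β'.codRestrict S (β'.mem_span hq)).toMap hq)
          (β'.codRestrict_span_spanning hq |>.toMap_surjective hq))
    have h2 := ih (hρ.of_surjective N.mkQ N.mkQ_surjective)
      (β.quot N S fun w v hv => β'.mem_span hq w ⟨v, hv⟩) (hβ.quot N S _) hNq.symm
    rw [length_eq_sub_add_quot S]
    exact WithTop.add_ne_top.2 ⟨h1, h2⟩

section Dual

variable [SeparatelyContinuousMul A] [SeparatelyContinuousMul B]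

/-- The transpose of a pairing `Ω × ρ → τ` is a pairing `Ω × τ^∨ → ρ^∨`, provided that its values
are smooth functionals. -/
def dual (β : Pairing p q ω ρ τ)
    (h : ∀ w (l : smoothDual τ), (l : Module.Dual ℂ W) ∘ₗ β.bilin w ∈ smoothDual ρ) :
    Pairing q p ω (contragredient τ) (contragredient ρ) where
  bilin := LinearMap.mk₂ ℂ (fun w l => (⟨(l : Module.Dual ℂ W) ∘ₗ β.bilin w, h w l⟩ : smoothDual ρ))
    (fun w w' v => Subtype.ext (LinearMap.ext fun x => by simp))
    (fun c w v => Subtype.ext (LinearMap.ext fun x => by simp))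
    (fun w v v' => Subtype.ext (LinearMap.ext fun x => by simp))
    (fun c w v => Subtype.ext (LinearMap.ext fun x => by simp))
  equivariant j w l := by
    refine Subtype.ext (LinearMap.ext fun v => ?_)
    change (l : Module.Dual ℂ W) (τ (q j)⁻¹ (β.bilin (ω j w) v)) =
      (l : Module.Dual ℂ W) (β.bilin w (ρ (p j)⁻¹ v))
    rw [← map_inv, ← β.equivariant, ← Module.End.mul_apply, ← map_mul, inv_mul_cancel, map_one,
      map_inv]
    rfl

theorem Separating.dual_spanning (hA : HasCompactOpenSubgroup A) (hB : HasCompactOpenSubgroup B)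
    {β : Pairing p q ω ρ τ} (hp : Function.Surjective p) (hβ : β.Separating) (hρ : IsAdmissibleRep ρ)
    (hτ : IsSmoothRep τ)
    (h : ∀ w (l : smoothDual τ), (l : Module.Dual ℂ W) ∘ₗ β.bilin w ∈ smoothDual ρ) :
    (β.dual h).Spanning := by
  have h1 : coannihilator ((β.dual h).span hp) = ⊥ := by
    refine eq_bot_iff.2 fun v hv => hβ v fun w => ?_
    by_contra hne
    obtain ⟨l, hl⟩ := hτ.exists_smoothDual_ne_zero hB hne
    exact hl (mem_coannihilator.1 hv _ ((β.dual h).mem_span hp w l))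
  have h2 := annihilator_coannihilator hA hρ ((β.dual h).span hp)
  rw [h1] at h2
  have h3 : (β.dual h).span hp = ⊤ := by
    rw [← h2]
    refine top_le_iff.1 fun l _ => ?_
    refine mem_annihilator.2 fun v hv => ?_
    rw [show v = 0 from hv, map_zero]
  exact congrArg Subrepresentation.toSubmodule h3

/-- The transpose of a separating pairing with an irreducible representation `τ` exhibits the
contragredient of `ρ` as a quotient of a theta lift. -/
theorem length_le_one_of_separating (hA : HasCompactOpenSubgroup A)
    (hB : HasCompactOpenSubgroup B) {hp : Function.Surjective p} (hH : HoweFor q p hp ω)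
    (hρ : IsGoodRep ρ) (hτ : IsIrrRep τ)
    (h : ∀ w, ∃ U : OpenSubgroup A, ∀ a ∈ U, ∃ j, p j = a ∧ q j = 1 ∧ ω j w = w)
    (β : Pairing p q ω ρ τ) (hβ : β.Separating) : ρ.length ≤ 1 := by
  have h' : ∀ w (l : smoothDual τ), (l : Module.Dual ℂ W) ∘ₗ β.bilin w ∈ smoothDual ρ := by
    intro w l
    obtain ⟨U, hU⟩ := h w
    refine ⟨U, fun a ha => LinearMap.ext fun v => ?_⟩
    obtain ⟨j, hj, hj', hw⟩ := hU _ (U.inv_mem ha)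
    change (l : Module.Dual ℂ W) (β.bilin w (ρ a⁻¹ v)) = (l : Module.Dual ℂ W) (β.bilin w v)
    rw [← hj]
    conv_lhs => rw [← hw]
    rw [β.equivariant, hj', map_one]
    rfl
  rw [← length_contragredient hA hρ.admissible]
  exact (hH _ _ (hτ.contragredient hB)).length_le_one ((β.dual h').toMap hp)
    ((hβ.dual_spanning hA hB hp hρ.admissible hτ.2.1 h').toMap_surjective hp)
    (hρ.contragredient hA).semisimple (hρ.contragredient hA).admissible

/-- A separating pairing between semisimple representations does not decrease the length. -/
theorem length_le_of_separating (hA : HasCompactOpenSubgroup A)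
    (hB : HasCompactOpenSubgroup B) {hp : Function.Surjective p} (hH : HoweFor q p hp ω)
    (hρ : IsGoodRep ρ) (hτ : IsGoodRep τ)
    (h : ∀ w, ∃ U : OpenSubgroup A, ∀ a ∈ U, ∃ j, p j = a ∧ q j = 1 ∧ ω j w = w)
    (β : Pairing p q ω ρ τ) (hβ : β.Separating) : ρ.length ≤ τ.length := by
  obtain ⟨n, hn⟩ := ENat.ne_top_iff_exists.1 hτ.length_ne_top
  induction n generalizing V W with
  | zero =>
    have := length_eq_zero_iff.1 (hn.symm.trans Nat.cast_zero)
    refine le_of_eq_of_le (length_eq_zero_iff.2 ⟨fun a b => ?_⟩) bot_le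
    rw [hβ a fun w => Subsingleton.elim _ _, hβ b fun w => Subsingleton.elim _ _]
  | succ n ih =>
    obtain ⟨S, hS, hSn⟩ := exists_length_eq_sub_add_one hn.symm
    -- dually, at most one irreducible piece is lost in passing from `τ` to `S`
    let N := β.transporter hp S
    have h1 : N.quot.length ≤ 1 := by
      refine length_le_one_of_separating hA hB hH (hρ.of_surjective N.mkQ N.mkQ_surjective)
        ⟨hS, (hτ.of_surjective S.mkQ S.mkQ_surjective).admissible⟩ h
        (β.quot N S fun w v hv => hv w) fun v hv => ?_
      obtain ⟨v, rfl⟩ := N.mkQ_surjective v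
      exact Subrepresentation.mkQ_eq_zero.2 fun w => Subrepresentation.mkQ_eq_zero.1 (hv w)
    have h2 := ih (hρ.of_injective N.incl N.incl_injective) (hτ.of_injective S.incl S.incl_injective)
      ((β.precomp N.incl).codRestrict S fun w v => v.2 w)
      (fun v hv => Subtype.ext (hβ v fun w => congrArg Subtype.val (hv w))) hSn.symm
    rw [length_eq_sub_add_quot S, length_eq_sub_add_quot N, length_eq_one_iff.2 hS]
    exact add_le_add h2 h1

end Dual

omit [TopologicalSpace A] [TopologicalSpace B] in
/-- If every endomorphism of a semisimple representation `ρ` is realized on the values of a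
separating pairing `Ω × ρ → τ`, then distinct subrepresentations of `ρ` span distinct
subrepresentations of `τ`. -/
theorem length_le_length_span (hq : Function.Surjective q) (β : Pairing p q ω ρ τ)
    (hβ : β.Separating) (hρ : ρ.IsSemisimpleRepresentation)
    (hend : ∀ e : IntertwiningMap ρ ρ, ∃ ψ : IntertwiningMap τ τ,
      ∀ w v, ψ (β.bilin w v) = β.bilin w (e v)) (N : Subrepresentation ρ) :
    N.toRepresentation.length ≤ ((β.precomp N.incl).span hq).toRepresentation.length := by
  have hmono : StrictMono fun N : Subrepresentation ρ => (β.precomp N.incl).span hq := by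
    intro M N hMN
    have hle : (β.precomp M.incl).span hq ≤ (β.precomp N.incl).span hq :=
      span_le.2 fun w v => (β.precomp N.incl).mem_span hq w ⟨v, hMN.le v.2⟩
    refine lt_of_le_of_ne hle fun heq => hMN.not_ge fun v hv => ?_
    obtain ⟨e, he⟩ := hρ.exists_proj M
    -- realize a projection with kernel `M`: it kills the span of `M`, hence that of `N`, so `N ≤ M`
    obtain ⟨ψ, hψ⟩ := hend (IntertwiningMap.id ρ - M.incl.comp e)
    have h1 : (β.precomp N.incl).span hq ≤ ψ.ker := by
      refine le_of_eq_of_le heq.symm ?_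
      refine span_le.2 fun w x => ?_
      change ψ (β.bilin w x) = 0
      have : (IntertwiningMap.id ρ - M.incl.comp e) (x : V) = 0 := by
        change (x : V) - (e x : V) = 0
        rw [he, sub_self]
      rw [hψ, this, map_zero]
    have h2 : v - (e v : V) = 0 := by
      refine hβ _ fun w => ?_
      exact (hψ w v).symm.trans (h1 ((β.precomp N.incl).mem_span hq w ⟨v, hv⟩))
    rw [sub_eq_zero.1 h2]
    exact (e v).2
  rw [length_toRepresentation, length_toRepresentation]
  exact Order.height_le_height_apply_of_strictMono _ hmono N

end Pairing

end PairingLength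

/-! ### Extensions by a central group -/

section CentralExtensions

open Representation

/-- Schur's lemma. -/
theorem IsIrrRep.exists_scalar_of_central {A V : Type*} [Group A] [TopologicalSpace A]
    [AddCommGroup V] [Module ℂ V] {ρ : Representation ℂ A V} (hρ : IsIrrRep ρ) {z : A}
    (hz : ∀ a, z * a = a * z) : ∃ c : ℂ, ∀ v, ρ z v = c • v := by
  have := hρ.1.nontrivial
  obtain ⟨v, hv⟩ := exists_ne (0 : V)
  obtain ⟨U, hU⟩ := hρ.2.1 v
  have := hρ.2.2 U
  have hcomm : ∀ a x, ρ z (ρ a x) = ρ a (ρ z x) := fun a x => by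
    rw [← Module.End.mul_apply, ← Module.End.mul_apply, ← map_mul, ← map_mul, hz]
  have : Nontrivial (fixedVectors ρ U.toSubgroup) :=
    ⟨⟨⟨v, hU⟩, 0, fun h0 => hv (congrArg Subtype.val h0)⟩⟩
  -- an eigenvector exists because `z` preserves the finite-dimensional space of `U`-fixed vectors
  let e : Module.End ℂ (fixedVectors ρ U.toSubgroup) :=
    (ρ z).restrict fun x hx a ha => by rw [← hcomm, hx a ha]
  obtain ⟨c, hc⟩ := Module.End.exists_eigenvalue e
  obtain ⟨x, hx⟩ := hc.exists_hasEigenvector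
  have hx1 : ρ z x = c • (x : V) := congrArg Subtype.val hx.apply_eq_smul
  let N : Subrepresentation ρ :=
    { toSubmodule := Module.End.eigenspace (ρ z) c
      apply_mem_toSubmodule := fun a y hy => by
        rw [Module.End.mem_eigenspace_iff] at hy ⊢
        rw [hcomm, hy, map_smul] }
  have hN : N = ⊤ := (hρ.1.eq_bot_or_eq_top N).resolve_left fun h0 => hx.2 (Subtype.ext (by
    have hm : (x : V) ∈ N := Module.End.mem_eigenspace_iff.2 hx1
    rw [h0] at hm
    exact hm))
  refine ⟨c, fun y => ?_⟩
  have hm : y ∈ N := by rw [hN]; exact Submodule.mem_top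
  exact Module.End.mem_eigenspace_iff.1 hm

variable {G A T : Type u} [Group G] [Group A] [CommGroup T]
variable [TopologicalSpace G] [TopologicalSpace A] [TopologicalSpace T]

/-- A homomorphism `f : G → A` and a central homomorphism `z : T → A` such that `(g, t) ↦ f g * z t`
is continuous and open with image of finite index, and such that conjugation by every element of `A`
lifts to an automorphism of the topological group `G`. -/
structure CentralExt (f : G →* A) (z : T →* A) : Prop where
  continuous_left : Continuous f
  continuous_right : Continuous z
  central : ∀ t a, z t * a = a * z t
  exists_open : ∀ (U : OpenSubgroup G) (U' : OpenSubgroup T), ∃ W : OpenSubgroup A,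
    ∀ a ∈ W, ∃ g ∈ U, ∃ t ∈ U', f g * z t = a
  finiteIndex : (f.range ⊔ z.range).FiniteIndex
  conj : ∀ a : A, ∃ c : G ≃* G, Continuous c ∧ Continuous c.symm ∧
    ∀ g, f (c g) = a * f g * a⁻¹
  compact_left : HasCompactOpenSubgroup G
  compact : HasCompactOpenSubgroup A
  /-- central characters extend to smooth characters of `T` -/
  exists_char : ∀ (V : Type u) [AddCommGroup V] [Module ℂ V] (π : Representation ℂ G V), IsIrrRep π →
    ∃ χ : T →* ℂˣ, (∃ U : OpenSubgroup T, ∀ t ∈ U, χ t = 1) ∧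
      ∀ g t, f g * z t = 1 → ∀ v, (χ t : ℂ) • π g v = v

/-- The group `T` acts by scalars, and an open subgroup of it acts trivially. -/
structure ActsByScalars (z : T →* A) {V : Type u} [AddCommGroup V] [Module ℂ V]
    (ρ : Representation ℂ A V) : Prop where
  scalar : ∀ t, ∃ c : ℂ, ∀ v, ρ (z t) v = c • v
  exists_trivial : ∃ U : OpenSubgroup T, ∀ t ∈ U, ∀ v, ρ (z t) v = v

variable {V W : Type u} [AddCommGroup V] [Module ℂ V] [AddCommGroup W] [Module ℂ W]
variable {f : G →* A} {z : T →* A} {ρ : Representation ℂ A V} {σ : Representation ℂ A W}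

omit [TopologicalSpace A] in
theorem ActsByScalars.of_surjective (h : ActsByScalars z ρ) (φ : IntertwiningMap ρ σ)
    (hφ : Function.Surjective φ) : ActsByScalars z σ where
  scalar t := by
    obtain ⟨c, hc⟩ := h.scalar t
    refine ⟨c, fun w => ?_⟩
    obtain ⟨v, rfl⟩ := hφ w
    rw [← φ.isIntertwining, hc, map_smul]
  exists_trivial := by
    obtain ⟨U, hU⟩ := h.exists_trivial
    refine ⟨U, fun t ht w => ?_⟩
    obtain ⟨v, rfl⟩ := hφ w
    rw [← φ.isIntertwining, hU t ht]

namespace CentralExt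

variable (h : CentralExt f z)
include h

theorem actsByScalars (hρ : IsIrrRep ρ) : ActsByScalars z ρ := by
  have hscalar : ∀ t, ∃ c : ℂ, ∀ v, ρ (z t) v = c • v := fun t =>
    hρ.exists_scalar_of_central (h.central t)
  have := hρ.1.nontrivial
  obtain ⟨v, hv⟩ := exists_ne (0 : V)
  obtain ⟨U, hU⟩ := hρ.2.1 v
  refine ⟨hscalar, U.comap z h.continuous_right, fun t ht x => ?_⟩
  obtain ⟨c, hc⟩ := hscalar t
  have h1 : c • v = (1 : ℂ) • v := by rw [← hc, hU _ ht, one_smul]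
  rw [hc, smul_left_injective ℂ hv h1, one_smul]

theorem finiteIndex_scalarSubgroup (hρ : ActsByScalars z ρ) :
    (scalarSubgroup f ρ).FiniteIndex := by
  have := h.finiteIndex
  refine Subgroup.finiteIndex_of_le (H := f.range ⊔ z.range) (sup_le ?_ ?_)
  · rintro _ ⟨g, rfl⟩
    exact ⟨g, 1, by simp⟩
  · rintro _ ⟨t, rfl⟩
    obtain ⟨c, hc⟩ := hρ.scalar t
    by_cases hV : Subsingleton V
    · exact ⟨1, 1, LinearMap.ext fun v => Subsingleton.elim _ _⟩
    · rw [not_subsingleton_iff_nontrivial] at hV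
      obtain ⟨v, hv⟩ := exists_ne (0 : V)
      have hc0 : c ≠ 0 := by
        rintro rfl
        refine hv ?_
        have h1 := hc v
        rw [zero_smul] at h1
        have h2 : ρ (z t)⁻¹ (ρ (z t) v) = v := by
          rw [← Module.End.mul_apply, ← map_mul, inv_mul_cancel, map_one]; rfl
        rw [← h2, h1, map_zero]
      refine ⟨1, Units.mk0 c hc0, LinearMap.ext fun v => ?_⟩
      rw [hc, map_one, map_one]
      rfl

theorem isSmoothVector (hρ : ActsByScalars z ρ) {v : V}
    (hs : IsSmoothVector (MonoidHom.comp ρ f) v) : IsSmoothVector ρ v := by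
  obtain ⟨U, hU⟩ := hs
  obtain ⟨U', hU'⟩ := hρ.exists_trivial
  obtain ⟨W, hW⟩ := h.exists_open U U'
  refine ⟨W, fun a ha => ?_⟩
  obtain ⟨g, hg, t, ht, rfl⟩ := hW a ha
  rw [map_mul, Module.End.mul_apply, hU' t ht]
  exact hU g hg

theorem isAdmissibleRep (hρ : ActsByScalars z ρ) (hs : IsAdmissibleRep (MonoidHom.comp ρ f)) :
    IsAdmissibleRep ρ := by
  refine ⟨fun v => h.isSmoothVector hρ (hs.1 v), fun U => ?_⟩
  have := hs.2 (U.comap f h.continuous_left)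
  exact Submodule.finiteDimensional_of_le (S₂ := fixedVectors (MonoidHom.comp ρ f)
    (U.comap f h.continuous_left).toSubgroup) fun v hv g hg => hv (f g) hg

theorem isGoodRep (hρ : ActsByScalars z ρ) (hs : IsGoodRep (MonoidHom.comp ρ f)) :
    IsGoodRep ρ where
  semisimple := isSemisimpleRepresentation_of_comp (h.finiteIndex_scalarSubgroup hρ) hs.semisimple
  length_ne_top := ne_top_of_le_ne_top hs.length_ne_top (length_le_length_comp f ρ)
  admissible := h.isAdmissibleRep hρ hs.admissible

theorem isAdmissibleRep_comp (hρ : ActsByScalars z ρ) (hs : IsAdmissibleRep ρ) :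
    IsAdmissibleRep (MonoidHom.comp ρ f) := by
  refine ⟨hs.1.comp f h.continuous_left, fun U => ?_⟩
  obtain ⟨U', hU'⟩ := hρ.exists_trivial
  obtain ⟨W, hW⟩ := h.exists_open U U'
  have := hs.2 W
  refine Submodule.finiteDimensional_of_le (S₂ := fixedVectors ρ W.toSubgroup) fun v hv a ha => ?_
  obtain ⟨g, hg, t, ht, rfl⟩ := hW a ha
  rw [map_mul, Module.End.mul_apply, hU' t ht]
  exact hv g hg

/-- Clifford theory: an irreducible admissible representation of `A` is semisimple of finite length
as a representation of `G`. -/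
theorem isGoodRep_comp (hρ : IsIrrRep ρ) : IsGoodRep (MonoidHom.comp ρ f) := by
  have hs := h.actsByScalars hρ
  choose c _ _ hc using h.conj
  have h1 := hρ.1.semisimple_comp (h.finiteIndex_scalarSubgroup hs) hc
  exact ⟨h1.1, h1.2, h.isAdmissibleRep_comp hs hρ.2⟩

theorem isGoodRep_core {Y : Subrepresentation (MonoidHom.comp ρ f)} (hρ : ActsByScalars z ρ)
    (hY : IsGoodRep Y.quot) :
    IsGoodRep (MonoidHom.comp Y.core.quot f) := by
  choose c hcont hcont' hc using h.conj
  exact IsGoodRep.core (h.finiteIndex_scalarSubgroup hρ) hc hcont hcont' hY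

theorem length_comp_ne_top (hρ : ActsByScalars z ρ) (hl : ρ.length ≠ ⊤) :
    length (MonoidHom.comp ρ f) ≠ ⊤ := by
  choose c _ _ hc using h.conj
  exact _root_.length_comp_ne_top hc (h.finiteIndex_scalarSubgroup hρ) hl

/-- An irreducible subrepresentation of `σ` on which the map to `π` does not vanish maps onto `π`, and
this map splits over `G`. -/
theorem exists_isIrrRep_retract_of_ne_top {π : Representation ℂ G V} (hπ : IsIrrRep π)
    (hσ : IsGoodRep σ) (ev : IntertwiningMap (MonoidHom.comp σ f) π) (hev : ev.ker ≠ ⊤) :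
    ∃ (X : Type u) (_ : AddCommGroup X) (_ : Module ℂ X) (ρ : Representation ℂ A X)
      (ι : IntertwiningMap π (MonoidHom.comp ρ f)) (pr : IntertwiningMap (MonoidHom.comp ρ f) π),
      IsIrrRep ρ ∧ ∀ v, pr (ι v) = v := by
  have hcore : ev.ker.core ≠ ⊤ := fun htop => hev (top_le_iff.1 fun φ _ =>
    Subrepresentation.mem_of_mem_core (by rw [htop]; exact Submodule.mem_top))
  obtain ⟨N, hN, hNle⟩ := hσ.semisimple.exists_isIrreducible_sub_not_le hcore
  have hNirr : IsIrrRep N.toRepresentation :=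
    ⟨hN, IsAdmissibleRep.of_injective hσ.admissible N.incl N.incl_injective⟩
  let pr : IntertwiningMap (MonoidHom.comp N.toRepresentation f) π := ev.comp (N.incl.res f)
  have hpr : Function.Surjective pr := by
    refine LinearMap.range_eq_top.1 ?_
    refine congrArg Subrepresentation.toSubmodule
      ((hπ.1.eq_bot_or_eq_top pr.range).resolve_left fun h0 => hNle fun φ hφ => ?_)
    refine Subrepresentation.mem_core.2 fun a => ?_
    have h1 : pr ⟨σ a φ, N.apply_mem_toSubmodule a hφ⟩ ∈ pr.range := ⟨_, rfl⟩
    rw [h0] at h1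
    exact h1
  obtain ⟨ι, hι⟩ := (h.isGoodRep_comp hNirr).semisimple.exists_section pr hpr
  exact ⟨_, _, _, N.toRepresentation, ι, pr, hNirr, hι⟩

/-- Every irreducible admissible representation of `G` is a direct summand of the restriction of an
irreducible admissible representation of `A`, found in the representation of `A` induced from an
extension of the given one to `G × T`. -/
theorem exists_isIrrRep_retract {π : Representation ℂ G V} (hπ : IsIrrRep π) :
    ∃ (X : Type u) (_ : AddCommGroup X) (_ : Module ℂ X) (ρ : Representation ℂ A X)
      (ι : IntertwiningMap π (MonoidHom.comp ρ f)) (pr : IntertwiningMap (MonoidHom.comp ρ f) π),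
      IsIrrRep ρ ∧ ∀ v, pr (ι v) = v := by
  obtain ⟨χ, ⟨U, hU⟩, hχ⟩ := h.exists_char V π hπ
  let e : G × T →* A := f.noncommCoprod z fun g t => (h.central t (f g)).symm
  have he : ∀ g t, e (g, t) = f g * z t := fun g t => rfl
  -- the extension of `π` by `χ`, which is trivial on the kernel of `(g, t) ↦ f g * z t`
  let π₁ : Representation ℂ (G × T) V :=
    { toFun := fun x => (χ x.2 : ℂ) • π x.1
      map_one' := by simp
      map_mul' := fun x y => by
        rw [Prod.fst_mul, Prod.snd_mul, map_mul, map_mul, smul_mul_smul_comm, Units.val_mul] }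
  have hπ₁ : ∀ g t v, π₁ (g, t) v = (χ t : ℂ) • π g v := fun g t v => rfl
  have hker : ∀ x y, e x = e y → π₁ x = π₁ y := by
    intro x y hxy
    have h1 : π₁ (y⁻¹ * x) = 1 := LinearMap.ext fun v =>
      hχ _ _ (by rw [← he, Prod.mk.eta, map_mul, map_inv, hxy, inv_mul_cancel]) v
    rw [← mul_inv_cancel_left y x, map_mul, h1, mul_one]
  let R := coind e π₁
  have hR : ∀ (a b : A) (φ : coindV e π₁), (R a φ).1 b = φ.1 (b * a) := fun a b φ => rfl
  have hscal : ∀ t (φ : coindV e π₁), R (z t) φ = (χ t : ℂ) • φ := by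
    intro t φ
    refine Subtype.ext (funext fun b => ?_)
    have h1 := φ.2 (1, t) b
    rw [he, map_one, one_mul, hπ₁, map_one] at h1
    rw [hR, ← h.central, h1]
    rfl
  have hRs : ActsByScalars z R :=
    ⟨fun t => ⟨χ t, hscal t⟩, U, fun t ht φ => by
      rw [hscal, hU t ht, Units.val_one, one_smul]⟩
  have hfin : e.range.FiniteIndex := by
    have := h.finiteIndex
    refine Subgroup.finiteIndex_of_le (H := f.range ⊔ z.range) (sup_le ?_ ?_)
    · rintro _ ⟨g, rfl⟩
      exact ⟨(g, 1), by rw [he, map_one, mul_one]⟩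
    · rintro _ ⟨t, rfl⟩
      exact ⟨(1, t), by rw [he, map_one, one_mul]⟩
  have hgood : IsGoodRep (MonoidHom.comp R f) := by
    choose c hcont hcont' hc using h.conj
    obtain ⟨r, hr⟩ := exists_right_transversal e.range
    -- restricted to `G`, the induced representation embeds into a finite sum of conjugates of `π`
    let Φ : IntertwiningMap (MonoidHom.comp R f)
        (piRep fun i => MonoidHom.comp π (MulEquiv.toMonoidHom (c (r i)))) :=
      { toLinearMap := LinearMap.pi fun i => LinearMap.proj (r i) ∘ₗ (coindV e π₁).subtype
        isIntertwining' := fun g => LinearMap.ext fun φ => funext fun i => by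
          change φ.1 (r i * f g) = π (c (r i) g) (φ.1 (r i))
          have h1 := φ.2 (c (r i) g, 1) (r i)
          rw [he, map_one, mul_one, hc, inv_mul_cancel_right, hπ₁, map_one, Units.val_one,
            one_smul] at h1
          exact h1 }
    refine (IsGoodRep.pi fun i => hπ.isGoodRep.comp_mulEquiv (c (r i)) (hcont _)
      (hcont' _)).of_injective Φ fun φ ψ hφψ => Subtype.ext (funext fun a => ?_)
    obtain ⟨i, _, ⟨x, rfl⟩, rfl⟩ := hr a
    have h1 : φ.1 (r i) = ψ.1 (r i) := congrFun hφψ i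
    rw [φ.2, ψ.2, h1]
  have hRgood := h.isGoodRep hRs hgood
  let ev : IntertwiningMap (MonoidHom.comp R f) π :=
    { toLinearMap := LinearMap.proj 1 ∘ₗ (coindV e π₁).subtype
      isIntertwining' := fun g => LinearMap.ext fun φ => by
        change φ.1 (1 * f g) = π g (φ.1 1)
        have h1 := φ.2 (g, 1) 1
        rw [he, map_one, mul_one, hπ₁, map_one, Units.val_one, one_smul, mul_one] at h1
        rw [one_mul, h1] }
  have hev : ev.ker ≠ ⊤ := by
    have := hπ.1.nontrivial
    obtain ⟨v, hv⟩ := exists_ne (0 : V)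
    classical
    -- the function supported on the image of `G × T` with value `v` at `1`
    let φ : A → V := fun a => if ha : ∃ x, e x = a then π₁ ha.choose v else 0
    have hφe : ∀ x, φ (e x) = π₁ x v := fun x => by
      have hx : ∃ y, e y = e x := ⟨x, rfl⟩
      change (if ha : ∃ y, e y = e x then π₁ ha.choose v else 0) = _
      rw [dif_pos hx, hker _ _ hx.choose_spec]
    have hφ : φ ∈ coindV e π₁ := by
      intro x a
      by_cases ha : ∃ y, e y = a
      · obtain ⟨y, rfl⟩ := ha
        rw [← map_mul, hφe, hφe, map_mul]
        rfl
      · have h1 : ¬ ∃ y, e y = e x * a := fun ⟨y, hy⟩ =>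
          ha ⟨x⁻¹ * y, by rw [map_mul, hy, map_inv, inv_mul_cancel_left]⟩
        change (if ha : ∃ y, e y = e x * a then π₁ ha.choose v else 0) =
          π₁ x (if ha : ∃ y, e y = a then π₁ ha.choose v else 0)
        rw [dif_neg ha, dif_neg h1, map_zero]
    intro htop
    have h1 : (⟨φ, hφ⟩ : coindV e π₁) ∈ ev.ker := by rw [htop]; exact Submodule.mem_top
    have h2 : φ 1 = 0 := h1
    have h3 := hφe 1
    rw [map_one, h2, map_one] at h3
    exact hv h3.symm
  exact h.exists_isIrrRep_retract_of_ne_top hπ hRgood ev hev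

variable [SeparatelyContinuousMul G] [SeparatelyContinuousMul A]

omit [SeparatelyContinuousMul G] [SeparatelyContinuousMul A] in
/-- Smoothness of a functional can be tested on `G`, since an open subgroup of `T` acts trivially. -/
theorem mem_smoothDual_iff (hρ : ActsByScalars z ρ) (l : Module.Dual ℂ V) :
    l ∈ smoothDual ρ ↔ l ∈ smoothDual (MonoidHom.comp ρ f) := by
  constructor
  · rintro ⟨U, hU⟩
    refine ⟨U.comap f h.continuous_left, fun g hg => LinearMap.ext fun v => ?_⟩
    have := LinearMap.congr_fun (hU (f g) hg) v
    change l (ρ (f g⁻¹) v) = l v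
    rw [map_inv f]
    exact this
  · rintro ⟨U, hU⟩
    obtain ⟨U', hU'⟩ := hρ.exists_trivial
    obtain ⟨W, hW⟩ := h.exists_open U U'
    refine ⟨W, fun a ha => LinearMap.ext fun v => ?_⟩
    obtain ⟨g, hg, t, ht, hgt⟩ := hW _ (W.inv_mem ha)
    have := LinearMap.congr_fun (hU g⁻¹ (U.inv_mem hg)) v
    change l (ρ (f g⁻¹⁻¹) v) = l v at this
    change l (ρ a⁻¹ v) = l v
    rw [← hgt, map_mul, Module.End.mul_apply, hU' t ht, ← this, inv_inv]

theorem length_contragredient_comp (hρ : IsIrrRep ρ) :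
    length (MonoidHom.comp (contragredient ρ) f) = length (MonoidHom.comp ρ f) := by
  have hs := h.actsByScalars hρ
  rw [← length_contragredient h.compact_left (h.isAdmissibleRep_comp hs hρ.2)]
  have hmem : ∀ l, l ∈ smoothDual (MonoidHom.comp ρ f) ↔ l ∈ smoothDual ρ := fun l =>
    (h.mem_smoothDual_iff hs l).symm
  let φ : IntertwiningMap (MonoidHom.comp (contragredient ρ) f)
      (contragredient (MonoidHom.comp ρ f)) :=
    { toLinearMap := Submodule.inclusion fun l hl => (hmem l).2 hl
      isIntertwining' := fun g => LinearMap.ext fun l => Subtype.ext (LinearMap.ext fun v => by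
        change (l : Module.Dual ℂ V) (ρ (f g)⁻¹ v) = (l : Module.Dual ℂ V) (ρ (f g⁻¹) v)
        rw [map_inv f]) }
  exact le_antisymm (length_le_of_injective φ fun l l' hl =>
    Subtype.ext (congrArg Subtype.val (show φ l = φ l' from hl) :))
    (length_le_of_surjective φ fun l => ⟨⟨l, (hmem _).1 l.2⟩, rfl⟩)

end CentralExt

end CentralExtensions

/-! ### Howe duality for extensions -/

section ThetaExtensions

open Representation

variable {J₀ G H J A B T : Type u} [Group J₀] [Group G] [Group H] [Group J] [Group A] [Group B]
  [CommGroup T]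
variable [TopologicalSpace G] [TopologicalSpace H] [TopologicalSpace A] [TopologicalSpace B]
  [TopologicalSpace T]
variable {Ω : Type u} [AddCommGroup Ω] [Module ℂ Ω]

/-- A correspondence `G ← J₀ → H` inside a correspondence `A ← J → B` in which `A` and `B` are
extensions of `G` and `H` by a central group `T` acting trivially on `Ω`, and in which the kernels of
the projections of `J` come from those of `J₀`. -/
structure ThetaExt (p₀ : J₀ →* G) (q₀ : J₀ →* H) (p : J →* A) (q : J →* B) (κ : J₀ →* J)
    (f : G →* A) (f' : H →* B) (s : T →* J) (ω : Representation ℂ J Ω) : Prop where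
  surjective_p₀ : Function.Surjective p₀
  surjective_q₀ : Function.Surjective q₀
  surjective_p : Function.Surjective p
  surjective_q : Function.Surjective q
  p_apply : ∀ j, p (κ j) = f (p₀ j)
  q_apply : ∀ j, q (κ j) = f' (q₀ j)
  centralExt_p : CentralExt f (p.comp s)
  centralExt_q : CentralExt f' (q.comp s)
  exists_of_p : ∀ j, p j = 1 → ∃ j₀, p₀ j₀ = 1 ∧ κ j₀ = j
  exists_of_q : ∀ j, q j = 1 → ∃ j₀, q₀ j₀ = 1 ∧ κ j₀ = j
  apply_s : ∀ t, ω (s t) = 1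
  smooth_p : ∀ w, ∃ U : OpenSubgroup G, ∀ g ∈ U, ∃ j, p₀ j = g ∧ q₀ j = 1 ∧ ω (κ j) w = w
  smooth_q : ∀ w, ∃ U : OpenSubgroup H, ∀ h ∈ U, ∃ j, q₀ j = h ∧ p₀ j = 1 ∧ ω (κ j) w = w

namespace ThetaExt

variable {p₀ : J₀ →* G} {q₀ : J₀ →* H} {p : J →* A} {q : J →* B} {κ : J₀ →* J}
  {f : G →* A} {f' : H →* B} {s : T →* J} {ω : Representation ℂ J Ω}
variable {V W X : Type u} [AddCommGroup V] [Module ℂ V] [AddCommGroup W] [Module ℂ W]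
  [AddCommGroup X] [Module ℂ X]
variable {ρ : Representation ℂ A V} {σ : Representation ℂ B W} {υ : Representation ℂ H X}

theorem symm (h : ThetaExt p₀ q₀ p q κ f f' s ω) : ThetaExt q₀ p₀ q p κ f' f s ω :=
  ⟨h.surjective_q₀, h.surjective_p₀, h.surjective_q, h.surjective_p, h.q_apply, h.p_apply,
    h.centralExt_q, h.centralExt_p, h.exists_of_q, h.exists_of_p, h.apply_s, h.smooth_q,
    h.smooth_p⟩

variable (h : ThetaExt p₀ q₀ p q κ f f' s ω)
include h

theorem actsByScalars_thetaRep (hρ : ActsByScalars (p.comp s) ρ) :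
    ActsByScalars (q.comp s) (thetaRep p q h.surjective_q ω ρ) := by
  have key : ∀ t (c : ℂ), (∀ v, ρ (p (s t)) v = c • v) → ∀ x,
      thetaRep p q h.surjective_q ω ρ (q (s t)) x = c • x := by
    intro t c hc x
    refine LinearMap.congr_fun (LinearMap.ext_on (Pairing.univ_spanning p q h.surjective_q ω ρ)
      (f := thetaRep p q h.surjective_q ω ρ (q (s t))) (g := c • LinearMap.id) ?_) x
    rintro _ ⟨w, v, rfl⟩
    rw [← Pairing.equivariant, h.apply_s, hc, map_smul]
    rfl
  constructor
  · intro t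
    obtain ⟨c, hc⟩ := hρ.scalar t
    exact ⟨c, key t c hc⟩
  · obtain ⟨U, hU⟩ := hρ.exists_trivial
    refine ⟨U, fun t ht x => ?_⟩
    refine (key t 1 (fun v => ?_) x).trans (one_smul _ _)
    rw [one_smul]
    exact hU t ht v

/-- The restriction of a pairing to `J₀`. -/
def res (β : Pairing p q ω ρ σ) :
    Pairing p₀ q₀ (MonoidHom.comp ω κ) (MonoidHom.comp ρ f) (MonoidHom.comp σ f') :=
  β.res h.p_apply h.q_apply

/-- The universal property of the theta lift of `ρ`, for pairings equivariant under `J₀`. -/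
def lift (β : Pairing p₀ q₀ (MonoidHom.comp ω κ) (MonoidHom.comp ρ f) υ) :
    IntertwiningMap (MonoidHom.comp (thetaRep p q h.surjective_q ω ρ) f') υ :=
  β.lift h.surjective_q h.p_apply h.q_apply h.surjective_q₀ h.exists_of_q

theorem lift_surjective {β : Pairing p₀ q₀ (MonoidHom.comp ω κ) (MonoidHom.comp ρ f) υ}
    (hβ : β.Spanning) : Function.Surjective (h.lift β) := by
  have : β = (h.res (Pairing.univ p q h.surjective_q ω ρ)).map (h.lift β) := rfl
  exact Pairing.Spanning.surjective_of_map (this ▸ hβ)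

/-- The kernel of a map from the theta lift of `ρ` to a semisimple admissible representation of
finite length of `H` contains a subrepresentation whose quotient has the same properties. -/
theorem isGoodRep_core_ker (hρ : IsIrrRep ρ)
    {φ : IntertwiningMap (MonoidHom.comp (thetaRep p q h.surjective_q ω ρ) f') υ}
    (hυ : IsGoodRep υ) : IsGoodRep φ.ker.core.quot := by
  have hs := h.actsByScalars_thetaRep (h.centralExt_p.actsByScalars hρ)
  refine h.centralExt_q.isGoodRep (hs.of_surjective _ φ.ker.core.mkQ_surjective)
    (h.centralExt_q.isGoodRep_core hs ?_)
  refine hυ.of_injective (φ.ker.liftQ φ fun _ hv => hv) ((injective_iff_map_eq_zero _).2 fun x hx => ?_)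
  obtain ⟨v, rfl⟩ := φ.ker.mkQ_surjective x
  exact Subrepresentation.mkQ_eq_zero.2 hx

/-- A spanned representation of `B` has at most one irreducible admissible quotient: two of them
together have length at most the length of `ρ` over `G`, which is at most the length of each. -/
theorem le_of_isIrrRep_quot [SeparatelyContinuousMul G] [SeparatelyContinuousMul H]
    (h₁ : HoweFor p₀ q₀ h.surjective_q₀ (MonoidHom.comp ω κ))
    (h₂ : HoweFor q₀ p₀ h.surjective_p₀ (MonoidHom.comp ω κ)) (hρ : IsIrrRep ρ)
    {β : Pairing p q ω ρ σ} (hβ : β.Spanning) {N₁ N₂ : Subrepresentation σ}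
    (hN₁ : IsIrrRep N₁.quot) (hN₂ : IsIrrRep N₂.quot) : N₁ ≤ N₂ := by
  have hρG := h.centralExt_p.isGoodRep_comp hρ
  have hN₁' := h.centralExt_q.isGoodRep_comp hN₁
  have hN₂' := h.centralExt_q.isGoodRep_comp hN₂
  have hD : IsGoodRep (N₁.res f' ⊓ N₂.res f').quot := IsGoodRep.inf_quot hN₁' hN₂'
  -- Howe duality over `J₀` in one direction bounds a spanned representation by `ρ`, and in the other
  -- direction bounds `ρ`, which pairs without kernel, by each of the two quotients
  have hle₁ : (N₁.res f' ⊓ N₂.res f').quot.length ≤ length (MonoidHom.comp ρ f) :=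
    ((h.res β).map (N₁.res f' ⊓ N₂.res f').mkQ).length_le_of_spanning h₁ hρG hD
      (Pairing.Spanning.map (β := h.res β) hβ (Subrepresentation.mkQ_surjective _))
  have hle₂ : length (MonoidHom.comp ρ f) ≤ Representation.length (MonoidHom.comp N₁.quot f') := by
    refine (h.res (β.map N₁.mkQ)).length_le_of_separating h.centralExt_p.compact_left
      h.centralExt_q.compact_left h₂ hρG hN₁' h.smooth_p ?_
    have hsp : (β.map N₁.mkQ).Spanning := hβ.map N₁.mkQ_surjective
    have := hN₁.1.nontrivial
    obtain ⟨w, v, hwv⟩ := hsp.exists_ne_zero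
    exact Pairing.separating_of_ne_zero h.surjective_p hρ.1 hwv
  exact le_of_length_inf_quot_le (σ := MonoidHom.comp σ f') (N₁ := N₁.res f') (N₂ := N₂.res f') (hle₁.trans hle₂)
    hN₁'.length_ne_top

/-- Howe duality passes from the correspondence `G ← J₀ → H` to `A ← J → B`. -/
theorem howeFor_of_howeFor_res
    (h₁ : HoweFor p₀ q₀ h.surjective_q₀ (MonoidHom.comp ω κ))
    (h₂ : HoweFor q₀ p₀ h.surjective_p₀ (MonoidHom.comp ω κ))
    [SeparatelyContinuousMul G] [SeparatelyContinuousMul H] :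
    HoweFor p q h.surjective_q ω := by
  intro V _ _ ρ hρ
  let β := Pairing.univ p q h.surjective_q ω ρ
  have hβ : β.Spanning := Pairing.univ_spanning p q h.surjective_q ω ρ
  have hρG := h.centralExt_p.isGoodRep_comp hρ
  have hlen : (thetaRep p q h.surjective_q ω ρ).length ≠ ⊤ :=
    ne_top_of_le_ne_top ((h.res β).length_ne_top_of_spanning h₁ hρG hβ) (length_le_length_comp _ _)
  refine ⟨length_ne_top_iff.1 hlen, fun hΘ => ?_⟩
  refine existsUnique_of_exists_of_unique ?_ ?_
  · -- a constituent `ρ₁` of `ρ` over `G` on which the pairing does not vanish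
    have hM : (h.res β).transporter h.surjective_p₀ ⊥ ≠ ⊤ := fun htop => by
      obtain ⟨w, v, hwv⟩ := hβ.exists_ne_zero
      have hv : v ∈ (h.res β).transporter h.surjective_p₀ ⊥ := by
        rw [htop]; exact Submodule.mem_top
      exact hwv (hv w)
    obtain ⟨N, hN, hNle⟩ := hρG.semisimple.exists_isIrreducible_sub_not_le hM
    have hNirr : IsIrrRep N.toRepresentation :=
      ⟨hN, (hρG.of_injective N.incl N.incl_injective).admissible⟩
    obtain ⟨e, he⟩ := hρG.semisimple.exists_proj N
    obtain ⟨v, hv, hvM⟩ := SetLike.not_le_iff_exists.1 hNle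
    obtain ⟨w, hwv⟩ : ∃ w, ((h.res β).precomp N.incl).bilin w ⟨v, hv⟩ ≠ 0 := by
      by_contra! hall
      exact hvM hall
    have hΘ₀ := ((h.res β).precomp N.incl).nontrivial_thetaRep h.surjective_q₀ hwv
    obtain ⟨M, hMirr, -⟩ := (h₁ _ _ hNirr).2 hΘ₀
    let γ := ((Pairing.univ p₀ q₀ h.surjective_q₀ (MonoidHom.comp ω κ)
      N.toRepresentation).map M.mkQ).precomp e
    have hγ : γ.Spanning := ((Pairing.univ_spanning _ _ _ _ _).map M.mkQ_surjective).precomp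
      fun x => ⟨x, he x⟩
    have hMirr' : IsIrrRep M.quot := hMirr
    -- the theta lift of `ρ₁`, a quotient of that of `ρ` over `H`, has an irreducible quotient; the core of
    -- the corresponding kernel is `B`-stable and has a semisimple quotient
    have hsurj := h.lift_surjective hγ
    have hgood := h.isGoodRep_core_ker hρ (φ := h.lift γ) hMirr'.isGoodRep
    have hne : (h.lift γ).ker.core ≠ ⊤ := fun htop => by
      have := hMirr'.1.nontrivial
      obtain ⟨y, hy⟩ := exists_ne (0 : _ ⧸ M.toSubmodule)
      obtain ⟨x, rfl⟩ := hsurj y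
      exact hy (Subrepresentation.mem_of_mem_core (Y := (h.lift γ).ker)
        (by rw [htop]; exact Submodule.mem_top))
    have : Nontrivial (_ ⧸ (h.lift γ).ker.core.toSubmodule) :=
      Submodule.Quotient.nontrivial_iff.2 fun h0 => hne (SetLike.ext fun x => SetLike.ext_iff.1 h0 x)
    obtain ⟨N', hN'⟩ := exists_isIrreducible_quot hgood.length_ne_top
    have hirr : IsIrrRep N'.quot :=
      ⟨hN', (hgood.of_surjective N'.mkQ N'.mkQ_surjective).admissible⟩
    exact ⟨_, IsIrrRep.quot_of_surjective hirr (N'.mkQ.comp (h.lift γ).ker.core.mkQ)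
      (N'.mkQ_surjective.comp (Subrepresentation.mkQ_surjective _))⟩
  · have key := fun N₁ N₂ => h.le_of_isIrrRep_quot h₁ h₂ hρ hβ (N₁ := N₁) (N₂ := N₂)
    exact fun N₁ N₂ hN₁ hN₂ => le_antisymm (key N₁ N₂ hN₁ hN₂) (key N₂ N₁ hN₂ hN₁)

end ThetaExt

end ThetaExtensions

section ThetaDescent

open Representation

variable {J₀ G H J A B T : Type u} [Group J₀] [Group G] [Group H] [Group J] [Group A] [Group B]
  [CommGroup T]
variable [TopologicalSpace G] [TopologicalSpace H] [TopologicalSpace A] [TopologicalSpace B]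
  [TopologicalSpace T]
variable {Ω : Type u} [AddCommGroup Ω] [Module ℂ Ω]

namespace ThetaExt

variable {p₀ : J₀ →* G} {q₀ : J₀ →* H} {p : J →* A} {q : J →* B} {κ : J₀ →* J}
  {f : G →* A} {f' : H →* B} {s : T →* J} {ω : Representation ℂ J Ω}
variable {V W X Y : Type u} [AddCommGroup V] [Module ℂ V] [AddCommGroup W] [Module ℂ W]
  [AddCommGroup X] [Module ℂ X] [AddCommGroup Y] [Module ℂ Y]
variable {ρ : Representation ℂ A V} {σ : Representation ℂ B W} {υ : Representation ℂ H X}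

variable (h : ThetaExt p₀ q₀ p q κ f f' s ω)
include h

/-- If the theta lift of `ρ` has the unique irreducible quotient `σ`, then every pairing of `Ω` and
`ρ` over `J₀` with a semisimple admissible representation of finite length of `H` factors through
`σ`. -/
theorem exists_factor (h₁ : HoweFor p q h.surjective_q ω) (hρ : IsIrrRep ρ) (hσ : IsIrrRep σ)
    {β : Pairing p q ω ρ σ} (hβ : β.Spanning) (hυ : IsGoodRep υ)
    (γ : Pairing p₀ q₀ (MonoidHom.comp ω κ) (MonoidHom.comp ρ f) υ) :
    ∃ ψ : IntertwiningMap (MonoidHom.comp σ f') υ, ∀ w v, ψ (β.bilin w v) = γ.bilin w v := by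
  have hΘ := h₁ V ρ hρ
  let b := β.toMap h.surjective_q
  have hb : Function.Surjective b := hβ.toMap_surjective h.surjective_q
  let Ψ := h.lift γ
  have hgood : IsGoodRep Ψ.ker.core.quot := h.isGoodRep_core_ker hρ hυ
  have hle : b.ker ≤ Ψ.ker.core := by
    by_cases htop : Ψ.ker.core = ⊤
    · rw [htop]; exact le_top
    have hlen := hΘ.length_le_one Ψ.ker.core.mkQ (Subrepresentation.mkQ_surjective _)
      hgood.semisimple hgood.admissible
    have hne : Nontrivial (_ ⧸ Ψ.ker.core.toSubmodule) :=
      Submodule.Quotient.nontrivial_iff.2 fun h0 =>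
        htop (SetLike.ext fun x => SetLike.ext_iff.1 h0 x)
    -- a nonzero quotient by the core is irreducible, so its kernel is that of the map to `σ`
    have hirr : IsIrrRep Ψ.ker.core.quot := by
      refine ⟨length_eq_one_iff.1 (le_antisymm hlen ?_), hgood.admissible⟩
      rw [Order.one_le_iff_ne_zero, ne_eq, length_eq_zero_iff, not_subsingleton_iff_nontrivial]
      exact hne
    have hΘne : Nontrivial (Coinvariants
        (MonoidHom.comp (ω.tprod (MonoidHom.comp ρ p)) q.ker.subtype)) :=
      (Subrepresentation.mkQ_surjective Ψ.ker.core).nontrivial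
    exact ((hΘ.2 hΘne).unique (IsIrrRep.quot_of_surjective hσ b hb) hirr).le
  obtain ⟨ψ, hψ⟩ := (b.res f').exists_factor hb Ψ fun x hx =>
    Subrepresentation.mem_of_mem_core (Y := Ψ.ker) (hle hx)
  exact ⟨ψ, fun w v => hψ ((Pairing.univ p q h.surjective_q ω ρ).bilin w v)⟩

/-- If the theta lift of `ρ` has the irreducible quotient `σ`, then the length of a `G`-subrepresentation
`N` of `ρ` is at most that of the `H`-subrepresentation of `σ` spanned by `N`. -/
theorem length_span_ge (h₁ : HoweFor p q h.surjective_q ω) (hρ : IsIrrRep ρ) (hσ : IsIrrRep σ)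
    {β : Pairing p q ω ρ σ} (hβ : β.Spanning) (N : Subrepresentation (MonoidHom.comp ρ f)) :
    N.toRepresentation.length ≤
      (((h.res β).precomp N.incl).span h.surjective_q₀).toRepresentation.length := by
  have := hσ.1.nontrivial
  obtain ⟨w, v, hwv⟩ := hβ.exists_ne_zero
  refine (h.res β).length_le_length_span h.surjective_q₀
    (Pairing.separating_of_ne_zero (β := β) h.surjective_p hρ.1 hwv)
    (h.centralExt_p.isGoodRep_comp hρ).semisimple (fun e => ?_) N
  exact h.exists_factor h₁ hρ hσ hβ (h.centralExt_q.isGoodRep_comp hσ) ((h.res β).precomp e)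

/-- If the theta lift of `ρ` has the unique irreducible quotient `σ`, then the length of `σ` over
`H` is at least the length of `ρ` over `G`. -/
theorem length_comp_le (h₁ : HoweFor p q h.surjective_q ω) (hρ : IsIrrRep ρ) (hσ : IsIrrRep σ)
    {β : Pairing p q ω ρ σ} (hβ : β.Spanning) :
    length (MonoidHom.comp ρ f) ≤ length (MonoidHom.comp σ f') := by
  refine le_trans ?_ ((h.length_span_ge h₁ hρ hσ hβ ⊤).trans
    (length_le_of_injective _ (Subrepresentation.incl_injective _)))
  exact length_le_of_surjective (Subrepresentation.incl ⊤) fun v => ⟨⟨v, trivial⟩, rfl⟩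

variable [SeparatelyContinuousMul G] [SeparatelyContinuousMul H] [SeparatelyContinuousMul A]
  [SeparatelyContinuousMul B]

omit [SeparatelyContinuousMul G] [SeparatelyContinuousMul H] [SeparatelyContinuousMul A]
  [SeparatelyContinuousMul B] in
/-- The functionals obtained from the pairing are smooth because each vector of `Ω` is fixed by an open
subgroup of `G` whose elements lift to elements of `J₀` acting trivially on `σ`. -/
theorem comp_bilin_mem_smoothDual (hρ : IsIrrRep ρ) (β : Pairing p q ω ρ σ) (w : Ω)
    (l : Module.Dual ℂ W) : l ∘ₗ β.bilin w ∈ smoothDual ρ := by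
  refine (h.centralExt_p.mem_smoothDual_iff (h.centralExt_p.actsByScalars hρ) _).2 ?_
  obtain ⟨U, hU⟩ := h.smooth_p w
  refine ⟨U, fun g hg => LinearMap.ext fun v => ?_⟩
  obtain ⟨j, hj, hj', hw⟩ := hU _ (U.inv_mem hg)
  change l (β.bilin w (ρ (f g⁻¹) v)) = l (β.bilin w v)
  rw [← hj]
  conv_lhs => rw [← hw]
  rw [← h.p_apply, β.equivariant, h.q_apply, hj', map_one, map_one]
  rfl

/-- The lengths of `ρ` over `G` and `σ` over `H` agree if `σ` is a quotient of the theta lift of `ρ`: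
the other inequality comes from the transposed pairing. -/
theorem length_comp_ge (h₂ : HoweFor q p h.surjective_p ω) (hρ : IsIrrRep ρ) (hσ : IsIrrRep σ)
    {β : Pairing p q ω ρ σ} (hβ : β.Spanning) :
    length (MonoidHom.comp σ f') ≤ length (MonoidHom.comp ρ f) := by
  have := hσ.1.nontrivial
  obtain ⟨w, v, hwv⟩ := hβ.exists_ne_zero
  have hsep := Pairing.separating_of_ne_zero h.surjective_p hρ.1 hwv
  have hsp := hsep.dual_spanning h.centralExt_p.compact h.centralExt_q.compact h.surjective_p
    hρ.2 hσ.2.1 fun w l => h.comp_bilin_mem_smoothDual hρ β w l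
  have := h.symm.length_comp_le h₂ (hσ.contragredient h.centralExt_q.compact)
    (hρ.contragredient h.centralExt_p.compact) hsp
  rwa [h.centralExt_p.length_contragredient_comp hρ,
    h.centralExt_q.length_contragredient_comp hσ] at this

/-- Semisimple admissible quotients of finite length of the theta lift of `π` have length at most
one. -/
theorem length_le_one_of_howeFor (h₁ : HoweFor p q h.surjective_q ω)
    (h₂ : HoweFor q p h.surjective_p ω) (hρ : IsIrrRep ρ) (hσ : IsIrrRep σ)
    {β : Pairing p q ω ρ σ} (hβ : β.Spanning) {π : Representation ℂ G Y} (hπ : IsIrrRep π)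
    (pr : IntertwiningMap (MonoidHom.comp ρ f) π) (hpr : Function.Surjective pr)
    (hυ : IsGoodRep υ) {γ : Pairing p₀ q₀ (MonoidHom.comp ω κ) π υ} (hγ : γ.Spanning) :
    υ.length ≤ 1 := by
  obtain ⟨ψ, hψ⟩ := h.exists_factor h₁ hρ hσ hβ hυ (γ.precomp pr)
  have hψs : Function.Surjective ψ := by
    have h1 : (h.res β).map ψ = γ.precomp pr := by
      have h2 : ((h.res β).map ψ).bilin = (γ.precomp pr).bilin :=
        LinearMap.ext fun w => LinearMap.ext fun v => hψ w v
      cases hx : (h.res β).map ψ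
      cases hy : γ.precomp pr
      rw [hx, hy] at h2
      congr
    refine Pairing.Spanning.surjective_of_map (β := h.res β) ?_
    rw [h1]
    exact hγ.precomp hpr
  -- the values of the pairing on the kernel of `ρ → π` die in `υ`
  have hle : ((h.res β).precomp pr.ker.incl).span h.surjective_q₀ ≤ ψ.ker := by
    refine Pairing.span_le.2 fun w v => ?_
    change ψ (β.bilin w v) = 0
    have hv : pr v = 0 := v.2
    rw [hψ, Pairing.precomp_bilin, hv, map_zero]
  have h1 : pr.ker.toRepresentation.length ≤ ψ.ker.toRepresentation.length := by
    refine (h.length_span_ge h₁ hρ hσ hβ pr.ker).trans ?_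
    rw [length_toRepresentation, length_toRepresentation]
    exact Order.height_mono hle
  have h2 := h.length_comp_ge h₂ hρ hσ hβ
  rw [length_eq_ker_add pr hpr, length_eq_ker_add ψ hψs, length_eq_one_iff.2 hπ.1] at h2
  have h3 : pr.ker.toRepresentation.length ≠ ⊤ := ne_top_of_le_ne_top
    (h.centralExt_p.isGoodRep_comp hρ).length_ne_top
    (length_le_of_injective _ pr.ker.incl_injective)
  exact (ENat.add_le_add_iff_left h3).1 ((add_le_add h1 le_rfl).trans h2)

/-- Howe duality passes from the correspondence `A ← J → B` to `G ← J₀ → H`. -/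
theorem howeFor_res_of_howeFor (h₁ : HoweFor p q h.surjective_q ω)
    (h₂ : HoweFor q p h.surjective_p ω) :
    HoweFor p₀ q₀ h.surjective_q₀ (MonoidHom.comp ω κ) := by
  intro Y _ _ π hπ
  obtain ⟨V, _, _, ρ, ι, pr, hρ, hpr⟩ := h.centralExt_p.exists_isIrrRep_retract hπ
  have hprs : Function.Surjective pr := fun v => ⟨ι v, hpr v⟩
  let β₀ := Pairing.univ p₀ q₀ h.surjective_q₀ (MonoidHom.comp ω κ) π
  have hβ₀ : β₀.Spanning := Pairing.univ_spanning _ _ _ _ _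
  have hΘ := h₁ V ρ hρ
  have hlift := h.lift_surjective (β := β₀.precomp pr) (hβ₀.precomp hprs)
  have hs := h.actsByScalars_thetaRep (h.centralExt_p.actsByScalars hρ)
  refine ⟨length_ne_top_iff.1 (ne_top_of_le_ne_top
    (h.centralExt_q.length_comp_ne_top hs (length_ne_top_iff.2 hΘ.1))
    (length_le_of_surjective _ hlift)), fun hne => ?_⟩
  -- the theta lift of `ρ` surjects onto that of `π`, so it is not zero and has an irreducible quotient
  obtain ⟨M, hM, -⟩ := hΘ.2 hlift.nontrivial
  have hM' : IsIrrRep M.quot := hM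
  let β := (Pairing.univ p q h.surjective_q ω ρ).map M.mkQ
  have hβ : β.Spanning := (Pairing.univ_spanning _ _ _ _ _).map M.mkQ_surjective
  have hσH := h.centralExt_q.isGoodRep_comp hM'
  refine existsUnique_of_exists_of_unique ?_ ?_
  · have := hM'.1.nontrivial
    obtain ⟨w, v, hwv⟩ := hβ.exists_ne_zero
    have hsep := Pairing.separating_of_ne_zero h.surjective_p hρ.1 hwv
    -- the summand `π` of `ρ` spans a nonzero subrepresentation of `M.quot`, which is semisimple over `H`
    let φ := ((h.res β).precomp ι).toMap h.surjective_q₀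
    have hgood : IsGoodRep φ.range.toRepresentation :=
      hσH.of_injective φ.range.incl φ.range.incl_injective
    have hφ : Function.Surjective (φ.codRestrict φ.range fun v => ⟨v, rfl⟩) := by
      rintro ⟨_, x, rfl⟩
      exact ⟨x, rfl⟩
    have hnt : Nontrivial φ.range.toSubmodule := by
      have := hπ.1.nontrivial
      obtain ⟨y, hy⟩ := exists_ne (0 : Y)
      obtain ⟨w, hw⟩ : ∃ w, β.bilin w (ι y) ≠ 0 := by
        by_contra! hall
        refine hy ?_
        rw [← hpr y, hsep _ hall, map_zero]
      exact ⟨⟨⟨φ (β₀.bilin w y), _, rfl⟩, 0, fun h0 => hw (congrArg Subtype.val h0)⟩⟩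
    obtain ⟨N, hN⟩ := exists_isIrreducible_quot hgood.length_ne_top
    have hirr : IsIrrRep N.quot :=
      ⟨hN, (hgood.of_surjective N.mkQ N.mkQ_surjective).admissible⟩
    exact ⟨_, IsIrrRep.quot_of_surjective hirr (N.mkQ.comp (φ.codRestrict φ.range fun v => ⟨v, rfl⟩))
      (N.mkQ_surjective.comp hφ)⟩
  · have key : ∀ N₁ N₂ : Subrepresentation (thetaRep p₀ q₀ h.surjective_q₀ (MonoidHom.comp ω κ) π),
        IsIrrRep N₁.quot → IsIrrRep N₂.quot → N₁ ≤ N₂ := fun N₁ N₂ hN₁ hN₂ => by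
      have hgood := hN₁.isGoodRep.inf_quot hN₂.isGoodRep
      refine le_of_length_inf_quot_le ?_ hN₁.isGoodRep.length_ne_top
      rw [length_eq_one_iff.2 hN₁.1]
      exact h.length_le_one_of_howeFor h₁ h₂ hρ hM' hβ hπ pr hprs hgood
        (hβ₀.map (Subrepresentation.mkQ_surjective _))
    exact fun N₁ N₂ hN₁ hN₂ => le_antisymm (key N₁ N₂ hN₁ hN₂) (key N₂ N₁ hN₂ hN₁)

/-- The Howe duality properties of the two correspondences are equivalent. -/
theorem howeDualityProperty_iff :
    HoweDualityProperty p₀ h.surjective_p₀ q₀ h.surjective_q₀ (MonoidHom.comp ω κ) ↔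
      HoweDualityProperty p h.surjective_p q h.surjective_q ω := by
  unfold HoweDualityProperty
  rw [← howeFor_iff h.centralExt_p.compact_left, ← howeFor_iff h.centralExt_q.compact_left,
    ← howeFor_iff h.centralExt_p.compact, ← howeFor_iff h.centralExt_q.compact]
  exact ⟨fun hH => ⟨h.howeFor_of_howeFor_res hH.1 hH.2, h.symm.howeFor_of_howeFor_res hH.2 hH.1⟩,
    fun hH => ⟨h.howeFor_res_of_howeFor hH.1 hH.2, h.symm.howeFor_res_of_howeFor hH.2 hH.1⟩⟩

end ThetaExt

end ThetaDescent

/-! ### Rational points of similitude groups -/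

section SimilitudeAlgebra

variable {F : Type u} [Field F]

/-- The two embeddings of `F̄` in `F̄ ⊗ F̄`. -/
abbrev inclL (F : Type u) [Field F] :
    AlgebraicClosure F →ₐ[F] AlgebraicClosure F ⊗[F] AlgebraicClosure F :=
  Algebra.TensorProduct.includeLeft

/-- See `inclL`. -/
abbrev inclR (F : Type u) [Field F] :
    AlgebraicClosure F →ₐ[F] AlgebraicClosure F ⊗[F] AlgebraicClosure F :=
  Algebra.TensorProduct.includeRight

/-- The inclusion of `F` in `F̄`. -/
abbrev toClosure (F : Type u) [Field F] : F →ₐ[F] AlgebraicClosure F :=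
  Algebra.ofId F (AlgebraicClosure F)

theorem toClosure_injective : Function.Injective (toClosure F) :=
  (algebraMap F (AlgebraicClosure F)).injective

namespace AffineAlgebraicGroup

theorem map_injective (G : AffineAlgebraicGroup F) {R S : Type u} [CommRing R] [Algebra F R]
    [CommRing S] [Algebra F S] {φ : R →ₐ[F] S} (hφ : Function.Injective φ) :
    Function.Injective (G.map φ) := fun _ _ hgh =>
  G.ext_ev (AlgHom.ext fun a => hφ (congrArg (fun x => G.ev x a) hgh))

/-- Descent of points along `F → F̄`. -/
theorem exists_map_toClosure (G : AffineAlgebraicGroup F) {g : G.Pts (AlgebraicClosure F)}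
    (hg : G.map (inclL F) g = G.map (inclR F) g) : ∃ g₀, G.map (toClosure F) g₀ = g := by
  have hrange : ∀ a : G.coord, G.ev g a ∈ (toClosure F).range := by
    intro a
    have h1 := congrArg (fun y : G.Pts (AlgebraicClosure F ⊗[F] AlgebraicClosure F) =>
      G.ev y a) hg
    obtain ⟨c, hc⟩ := exists_algebraMap_eq (F := F) (L := AlgebraicClosure F) h1
    exact ⟨c, hc⟩
  let g₀ : G.coord →ₐ[F] F :=
    ((AlgEquiv.ofInjective (toClosure F) toClosure_injective).symm : _ →ₐ[F] F).comp
      ((G.ev g).codRestrict _ hrange)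
  refine ⟨G.pt g₀, G.ext_ev (AlgHom.ext fun a => ?_)⟩
  exact congrArg Subtype.val ((AlgEquiv.ofInjective (toClosure F) toClosure_injective).apply_symm_apply
      ((G.ev g).codRestrict _ hrange a))

theorem CentralSubgroup.pts_injective {Z G : AffineAlgebraicGroup F} (ζ : CentralSubgroup Z G)
    (R : Type u) [CommRing R] [Algebra F R] : Function.Injective (ζ.pts R) := fun z w h =>
  Z.ext_ev (AlgHom.ext fun a => by
    obtain ⟨b, rfl⟩ := ζ.surjective a
    exact congrArg (fun x => G.ev x b) h)

end AffineAlgebraicGroup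

variable {Z G : AffineAlgebraicGroup F} {K E : Type u} [CommRing K] [Algebra F K] [CommRing E]
  [Algebra F E]

theorem resMap_resMap {R S S' : Type u} [CommRing R] [Algebra F R] [CommRing S] [Algebra F S]
    [CommRing S'] [Algebra F S'] (φ : R →ₐ[F] S) (ψ : S →ₐ[F] S') (t : ResPts F K R) :
    resMap K ψ (resMap K φ t) = resMap K (ψ.comp φ) t := by
  refine Units.ext ?_
  have := congrArg (fun f : K ⊗[F] R →ₐ[F] K ⊗[F] S' => f (t : K ⊗[F] R))
    (Algebra.TensorProduct.map_comp (AlgHom.id F K) (AlgHom.id F K) ψ φ)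
  exact this.symm

namespace SimGroup

variable {ζ : CentralSubgroup Z G} {I : InitialData Z K E}

theorem incl_injective : Function.Injective (incl ζ I) := Subtype.val_injective

theorem incl_proj (g : G.Pts F) (t : ResPts F K F) :
    incl ζ I (proj ζ I (g, t)) =
      QuotientGroup.mk (G.map (toClosure F) g, resMap K (toClosure F) t) := rfl

theorem sim_eq {x : SimGroup ζ I} {g : G.Pts (AlgebraicClosure F)}
    {t : ResPts F K (AlgebraicClosure F)} (h : incl ζ I x = QuotientGroup.mk (g, t)) :
    sim ζ I x = I.s (AlgebraicClosure F) t := by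
  change preSimChar ζ I _ (incl ζ I x) = _
  rw [h]
  rfl

theorem sim_proj (g : G.Pts F) (t : ResPts F K F) :
    sim ζ I (proj ζ I (g, t)) = resMap E (toClosure F) (I.s F t) := by
  rw [sim_eq (incl_proj g t), I.s_natural]

theorem exists_rep (x : SimGroup ζ I) : ∃ g t, incl ζ I x = QuotientGroup.mk (g, t) := by
  obtain ⟨⟨g, t⟩, h⟩ := QuotientGroup.mk_surjective (incl ζ I x)
  exact ⟨g, t, h.symm⟩

theorem mk_eq_mk_iff {R : Type u} [CommRing R] [Algebra F R] {g g' : G.Pts R}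
    {t t' : ResPts F K R} :
    (QuotientGroup.mk (g, t) : PreSim ζ I R) = QuotientGroup.mk (g', t') ↔
      ∃ z : Z.Pts R, g' = g * ζ.pts R z ∧ t' = t * (I.j R z)⁻¹ := by
  rw [QuotientGroup.eq, mem_nabla]
  refine exists_congr fun z => ?_
  rw [Prod.ext_iff]
  exact and_congr inv_mul_eq_iff_eq_mul inv_mul_eq_iff_eq_mul

theorem mk_eq_mk_left_iff {R : Type u} [CommRing R] [Algebra F R] {g g' : G.Pts R}
    {t : ResPts F K R} :
    (QuotientGroup.mk (g, t) : PreSim ζ I R) = QuotientGroup.mk (g', t) ↔ g = g' := by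
  refine ⟨fun h => ?_, fun h => h ▸ rfl⟩
  obtain ⟨z, hz, hz'⟩ := mk_eq_mk_iff.1 h
  have h1 : z = 1 := I.j_injective R (by rw [map_one]; simpa using hz')
  rw [hz, h1, map_one, mul_one]

theorem preSimMap_incl (x : SimGroup ζ I) :
    preSimMap ζ I (inclL F) (incl ζ I x) = preSimMap ζ I (inclR F) (incl ζ I x) := x.2

/-- The kernel of the similitude character is `G(F)`. -/
theorem exists_proj_eq_of_sim_eq_one {x : SimGroup ζ I} (h : sim ζ I x = 1) :
    ∃ g, proj ζ I (g, 1) = x := by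
  obtain ⟨g, t, hx⟩ := exists_rep x
  rw [sim_eq hx] at h
  obtain ⟨z, rfl⟩ := (I.ker_s _ _).1 h
  have hx' : incl ζ I x = QuotientGroup.mk (g * ζ.pts _ z, 1) := by
    rw [hx, mk_eq_mk_iff]
    exact ⟨z, rfl, (mul_inv_cancel _).symm⟩
  have h1 := preSimMap_incl x
  rw [hx'] at h1
  have h2 : G.map (inclL F) (g * ζ.pts _ z) = G.map (inclR F) (g * ζ.pts _ z) := by
    refine mk_eq_mk_left_iff (ζ := ζ) (I := I) (t := 1).1 ?_
    have h3 : ∀ φ : AlgebraicClosure F →ₐ[F] AlgebraicClosure F ⊗[F] AlgebraicClosure F,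
        preSimMap ζ I φ (QuotientGroup.mk (g * ζ.pts _ z, 1)) =
          QuotientGroup.mk (G.map φ (g * ζ.pts _ z), 1) := fun φ =>
      congrArg (fun t => (QuotientGroup.mk (G.map φ (g * ζ.pts _ z), t) : PreSim ζ I _))
        (map_one (resMap K φ))
    rwa [h3, h3] at h1
  obtain ⟨g₀, hg₀⟩ := G.exists_map_toClosure h2
  exact ⟨g₀, incl_injective (by rw [hx', incl_proj, hg₀, map_one])⟩

/-- The kernel of `G(F) × T(F) → G̃(F)` is `Z(F)`. -/
theorem exists_of_proj_eq_one {g : G.Pts F} {t : ResPts F K F} (h : proj ζ I (g, t) = 1) :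
    ∃ z : Z.Pts F, g = ζ.pts F z ∧ t = (I.j F z)⁻¹ := by
  have h1 : (QuotientGroup.mk (1, 1) : PreSim ζ I _) =
      QuotientGroup.mk (G.map (toClosure F) g, resMap K (toClosure F) t) :=
    (congrArg (incl ζ I) h).symm
  obtain ⟨z, hz, hz'⟩ := mk_eq_mk_iff.1 h1
  rw [one_mul] at hz hz'
  obtain ⟨z₀, rfl⟩ := Z.exists_map_toClosure (g := z) (by
    refine ζ.pts_injective _ ?_
    rw [← ζ.map_pts, ← ζ.map_pts, ← hz]
    have : (inclL F).comp (toClosure F) = (inclR F).comp (toClosure F) := Subsingleton.elim _ _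
    exact congrArg (fun φ => G.map φ g) this)
  refine ⟨z₀, G.map_injective toClosure_injective (by rw [hz, ζ.map_pts]), ?_⟩
  have hinj : Function.Injective (resMap K (toClosure F)) := by
    refine Units.map_injective ?_
    exact Module.Flat.lTensor_preserves_injective_linearMap (M := K)
      (toClosure F).toLinearMap toClosure_injective
  refine hinj ?_
  rw [hz', map_inv, I.j_natural]

theorem proj_left_injective {g g' : G.Pts F} {t : ResPts F K F}
    (h : proj ζ I (g, t) = proj ζ I (g', t)) : g = g' := by
  have h1 := congrArg (incl ζ I) h
  rw [incl_proj, incl_proj] at h1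
  exact G.map_injective toClosure_injective (mk_eq_mk_left_iff.1 h1)

theorem proj_eq_mul (g : G.Pts F) (t : ResPts F K F) :
    proj ζ I (g, t) = proj ζ I (g, 1) * proj ζ I (1, t) := by
  rw [← map_mul, Prod.mk_mul_mk, mul_one, one_mul]

theorem proj_right_comm (t : ResPts F K F) (x : SimGroup ζ I) :
    proj ζ I (1, t) * x = x * proj ζ I (1, t) := by
  obtain ⟨g, t', hx⟩ := exists_rep x
  refine incl_injective ?_
  rw [map_mul, map_mul, hx, incl_proj, map_one, ← QuotientGroup.mk_mul, ← QuotientGroup.mk_mul,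
    Prod.mk_mul_mk, Prod.mk_mul_mk, one_mul, mul_one, mul_comm t']

theorem exists_conj (x : SimGroup ζ I) (g : G.Pts F) :
    ∃ g', proj ζ I (g', 1) = x * proj ζ I (g, 1) * x⁻¹ := by
  refine exists_proj_eq_of_sim_eq_one ?_
  rw [map_mul, map_mul, mul_right_comm, ← map_mul, mul_inv_cancel, map_one, one_mul, sim_proj,
    map_one, map_one]

/-- Conjugation by an element of `G̃(F)`, as an automorphism of `G(F)`. -/
def conj (x : SimGroup ζ I) : G.Pts F ≃* G.Pts F where
  toFun g := (exists_conj x g).choose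
  invFun g := (exists_conj x⁻¹ g).choose
  left_inv g := proj_left_injective (ζ := ζ) (I := I) (t := 1) (by
    rw [(exists_conj x⁻¹ _).choose_spec, (exists_conj x g).choose_spec]
    group)
  right_inv g := proj_left_injective (ζ := ζ) (I := I) (t := 1) (by
    rw [(exists_conj x _).choose_spec, (exists_conj x⁻¹ g).choose_spec]
    group)
  map_mul' g g' := proj_left_injective (ζ := ζ) (I := I) (t := 1) (by
    have h1 : ∀ a b : G.Pts F, proj ζ I (a * b, 1) = proj ζ I (a, 1) * proj ζ I (b, 1) :=
      fun a b => by rw [← map_mul, Prod.mk_mul_mk, one_mul]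
    have h2 := (exists_conj x g).choose_spec
    have h3 := (exists_conj x g').choose_spec
    refine ((exists_conj x (g * g')).choose_spec.trans ?_).trans (h1 _ _).symm
    rw [h2, h3, h1]
    group)

theorem proj_conj (x : SimGroup ζ I) (g : G.Pts F) :
    proj ζ I (conj x g, 1) = x * proj ζ I (g, 1) * x⁻¹ :=
  (exists_conj x g).choose_spec

theorem conj_symm (x : SimGroup ζ I) : (conj x).symm = conj x⁻¹ :=
  MulEquiv.ext fun g => proj_left_injective (ζ := ζ) (I := I) (t := 1) (by
    rw [proj_conj]
    exact (exists_conj x⁻¹ g).choose_spec)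

theorem map_conj {x : SimGroup ζ I} {g₁ : G.Pts (AlgebraicClosure F)}
    {t : ResPts F K (AlgebraicClosure F)} (h : incl ζ I x = QuotientGroup.mk (g₁, t))
    (g : G.Pts F) :
    G.map (toClosure F) (conj x g) = g₁ * G.map (toClosure F) g * g₁⁻¹ := by
  have h1 := congrArg (incl ζ I) (proj_conj x g)
  rw [map_mul, map_mul, map_inv, h, incl_proj, incl_proj, map_one, ← QuotientGroup.mk_mul,
    ← QuotientGroup.mk_inv, ← QuotientGroup.mk_mul] at h1
  refine mk_eq_mk_left_iff (ζ := ζ) (I := I) (t := 1).1 (h1.trans ?_)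
  refine congrArg QuotientGroup.mk (Prod.ext rfl ?_)
  change t * 1 * t⁻¹ = 1
  rw [mul_one, mul_inv_cancel]

/-- Conjugation by an element of `G̃(F)` is given by regular functions on `G` with coefficients in
`F̄`; applying an `F`-linear retraction `F̄ → F` to the coefficients shows that it is continuous. -/
theorem continuous_conj [TopologicalSpace F] [IsTopologicalRing F] (x : SimGroup ζ I) :
    Continuous (conj x) := by
  obtain ⟨g₁, t, hx⟩ := exists_rep x
  obtain ⟨l, hl⟩ := LinearMap.exists_leftInverse_of_injective
    (Algebra.linearMap F (AlgebraicClosure F))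
    (LinearMap.ker_eq_bot.2 (algebraMap F (AlgebraicClosure F)).injective)
  have hl' : ∀ c : F, l (algebraMap F (AlgebraicClosure F) c) = c := fun c =>
    LinearMap.congr_fun hl c
  -- a product `g₁ g g₂` of points is continuous in `g`
  have hleft : ∀ (g₂ : G.Pts (AlgebraicClosure F)) (a : G.coord) (b : AlgebraicClosure F),
      Continuous fun g : G.Pts F => l (b * G.ev (G.map (toClosure F) g * g₂) a) := by
    intro g₂ a b
    have key : ∀ y : G.coord ⊗[F] G.coord, Continuous fun g : G.Pts F =>
        l (b * Algebra.TensorProduct.lift (G.ev (G.map (toClosure F) g)) (G.ev g₂)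
          (fun _ _ => .all ..) y) := by
      intro y
      induction y using TensorProduct.induction_on with
      | zero => simpa using continuous_const
      | tmul c d =>
        refine ((G.continuous_eval c).mul (continuous_const (y := l (b * G.ev g₂ d)))).congr
          fun g => ?_
        rw [Algebra.TensorProduct.lift_tmul]
        have h1 : G.ev (G.map (toClosure F) g) c =
          algebraMap F (AlgebraicClosure F) (G.ev g c) := rfl
        rw [h1, mul_left_comm, ← Algebra.smul_def, map_smul, smul_eq_mul]
        rfl
      | add c d hc hd =>
        refine (hc.add hd).congr fun g => ?_
        rw [map_add, mul_add, map_add]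
        rfl
    exact (key (Coalgebra.comul (R := F) a)).congr fun g => by
      congr 2
      exact (AlgHom.convMul_apply _ _ a).symm
  refine continuous_induced_rng.2 (continuous_pi fun a => ?_)
  have key : ∀ y : G.coord ⊗[F] G.coord, Continuous fun g : G.Pts F =>
      l (Algebra.TensorProduct.lift (G.ev g₁) (G.ev (G.map (toClosure F) g * g₁⁻¹))
        (fun _ _ => .all ..) y) := by
    intro y
    induction y using TensorProduct.induction_on with
    | zero => simpa using continuous_const
    | tmul c d => simpa only [Algebra.TensorProduct.lift_tmul] using hleft g₁⁻¹ d (G.ev g₁ c)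
    | add c d hc hd =>
      refine (hc.add hd).congr fun g => ?_
      rw [map_add, map_add]
      rfl
  refine (key (Coalgebra.comul (R := F) a)).congr fun g => ?_
  have h1 : Algebra.TensorProduct.lift (G.ev g₁) (G.ev (G.map (toClosure F) g * g₁⁻¹))
      (fun _ _ => .all ..) (Coalgebra.comul (R := F) a) =
      G.ev (g₁ * (G.map (toClosure F) g * g₁⁻¹)) a := (AlgHom.convMul_apply _ _ a).symm
  rw [h1, ← mul_assoc, ← map_conj hx]
  exact hl' _

end SimGroup

end SimilitudeAlgebra

/-! ### Compact open subgroups -/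

section CompactOpen

open Topology

/-- Van Dantzig's theorem. -/
theorem exists_compact_openSubgroup_le {A : Type*} [Group A] [TopologicalSpace A]
    [IsTopologicalGroup A] [LocallyCompactSpace A] [T2Space A] [TotallyDisconnectedSpace A]
    {U : Set A} (hU : U ∈ 𝓝 (1 : A)) : ∃ K : OpenSubgroup A, (K : Set A) ⊆ U ∧
      IsCompact (K : Set A) := by
  obtain ⟨C, hC, hCU, hCc⟩ := LocallyCompactSpace.local_compact_nhds 1 U hU
  obtain ⟨W, hW, h1W, hWC⟩ :=
    (loc_compact_Haus_tot_disc_of_zero_dim (H := A)).mem_nhds_iff.1 hC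
  have hWc : IsCompact W := hCc.of_isClosed_subset hW.isClosed hWC
  obtain ⟨V, hV, hWV⟩ := compact_open_separated_mul_right hWc hW.isOpen subset_rfl
  let S := Subgroup.closure (V ∩ V⁻¹)
  have hS : (S : Set A) ⊆ W := by
    have hinv : ∀ x ∈ V ∩ V⁻¹, x⁻¹ ∈ V := fun x hx => hx.2
    intro x hx
    refine Subgroup.closure_induction_right (p := fun x _ => x ∈ W) h1W ?_ ?_ hx
    · intro x _ y hy hxW
      exact hWV (Set.mul_mem_mul hxW hy.1)
    · intro x _ y hy hxW
      exact hWV (Set.mul_mem_mul hxW (hinv y hy))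
  have hSo : IsOpen (S : Set A) := Subgroup.isOpen_of_mem_nhds S
    (g := 1) (Filter.mem_of_superset (Filter.inter_mem hV (inv_mem_nhds_one A hV))
      Subgroup.subset_closure)
  exact ⟨⟨S, hSo⟩, hS.trans (hWC.trans hCU),
    hWc.of_isClosed_subset (Subgroup.isClosed_of_isOpen S hSo) hS⟩

theorem relIndex_ne_zero_of_isCompact {A : Type*} [Group A] [TopologicalSpace A]
    [IsTopologicalGroup A] (U : OpenSubgroup A) {K : Subgroup A} (hK : IsCompact (K : Set A)) :
    U.toSubgroup.relIndex K ≠ 0 := by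
  have : CompactSpace K := isCompact_iff_compactSpace.1 hK
  have : Finite (K ⧸ U.toSubgroup.subgroupOf K) := Subgroup.quotient_finite_of_isOpen _
    (U.isOpen.preimage continuous_subtype_val)
  exact Subgroup.index_ne_zero_of_finite

variable (F : Type u) [Field F] [ValuativeRel F] [TopologicalSpace F]
  [IsNonarchimedeanLocalField F]

theorem localField_t2Space : T2Space F := by
  let := IsTopologicalAddGroup.rightUniformSpace F
  have := isUniformAddGroup_of_addCommGroup (G := F)
  infer_instance

theorem localField_totallyDisconnectedSpace : TotallyDisconnectedSpace F := by
  have := localField_t2Space F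
  have : NonarchimedeanRing F := by
    convert! ValuativeRel.nonarchimedeanRing F
    exact (ValuativeRel.valuation F).toTopologicalSpace_eq
  have : NonarchimedeanAddGroup F := inferInstance
  infer_instance

variable {F}

theorem AffineAlgebraicGroup.isTopologicalGroup_pts (G : AffineAlgebraicGroup F) :
    IsTopologicalGroup (G.Pts F) where
  continuous_inv := by
    refine continuous_induced_rng.2 (continuous_pi fun a => ?_)
    exact G.continuous_eval (HopfAlgebra.antipodeAlgHom F G.coord a)

theorem AffineAlgebraicGroup.t2Space_pts (G : AffineAlgebraicGroup F) : T2Space (G.Pts F) := by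
  have := localField_t2Space F
  refine T2Space.of_injective_continuous (f := fun g a => G.ev g a) (fun g h hgh => ?_)
    continuous_induced_dom
  exact G.ext_ev (AlgHom.ext fun a => congrFun hgh a)

theorem AffineAlgebraicGroup.totallyDisconnectedSpace_pts (G : AffineAlgebraicGroup F) :
    TotallyDisconnectedSpace (G.Pts F) := by
  have := localField_totallyDisconnectedSpace F
  have hinj : Function.Injective fun (g : G.Pts F) (a : G.coord) => G.ev g a := fun g h hgh =>
    G.ext_ev (AlgHom.ext fun a => congrFun hgh a)
  refine ⟨isTotallyDisconnected_of_image (f := fun (g : G.Pts F) (a : G.coord) => G.ev g a)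
    (Continuous.continuousOn continuous_induced_dom) hinj (isTotallyDisconnected_of_totallyDisconnectedSpace _)⟩

/-- The points of an affine variety are closed in affine space. -/
theorem AffineAlgebraicGroup.locallyCompactSpace_pts (G : AffineAlgebraicGroup F) :
    LocallyCompactSpace (G.Pts F) := by
  have := localField_t2Space F
  obtain ⟨n, π, hπ⟩ := Algebra.FiniteType.iff_quotient_mvPolynomial''.1 G.finiteType
  let e : G.Pts F → (Fin n → F) := fun g i => G.ev g (π (MvPolynomial.X i))
  have hev : ∀ g (P : MvPolynomial (Fin n) F), G.ev g (π P) = MvPolynomial.aeval (e g) P := by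
    intro g P
    have : (G.ev g).comp π = MvPolynomial.aeval (e g) := MvPolynomial.algHom_ext fun i => by
      rw [MvPolynomial.aeval_X]; rfl
    exact DFunLike.congr_fun this P
  have hcont : ∀ P : MvPolynomial (Fin n) F, Continuous fun v : Fin n → F =>
      MvPolynomial.aeval v P := fun P => by
    simpa only [MvPolynomial.aeval_eq_eval] using MvPolynomial.continuous_eval P
  have hind : IsInducing e := by
    refine ⟨le_antisymm ?_ ?_⟩
    · rw [← continuous_iff_le_induced]
      exact continuous_pi fun i => G.continuous_eval _
    · let Φ : (Fin n → F) → G.coord → F := fun v a => MvPolynomial.aeval v (hπ a).choose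
      have hΦ : Continuous Φ := continuous_pi fun a => hcont _
      have hΦe : Φ ∘ e = fun g a => G.ev g a := funext fun g => funext fun a => by
        change MvPolynomial.aeval (e g) (hπ a).choose = _
        rw [← hev, (hπ a).choose_spec]
      refine (induced_mono (continuous_iff_le_induced.1 hΦ)).trans ?_
      rw [induced_compose, hΦe]
      exact le_rfl
  have hinj : Function.Injective e := fun g h hgh => G.ext_ev (AlgHom.ext fun a => by
    obtain ⟨P, rfl⟩ := hπ a
    rw [hev, hev, hgh])
  have hrange : Set.range e = ⋂ P ∈ RingHom.ker π, {v | MvPolynomial.aeval v P = 0} := by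
    ext v
    rw [Set.mem_iInter₂]
    constructor
    · rintro ⟨g, rfl⟩ P hP
      change MvPolynomial.aeval (e g) P = 0
      rw [← hev, show π P = 0 from hP, map_zero]
    · intro hv
      refine ⟨G.pt (Ideal.Quotient.liftₐ (RingHom.ker π) (MvPolynomial.aeval v) hv |>.comp
        (Ideal.quotientKerAlgEquivOfSurjective hπ).symm.toAlgHom), funext fun i => ?_⟩
      change Ideal.Quotient.liftₐ (RingHom.ker π) (MvPolynomial.aeval v) hv
        ((Ideal.quotientKerAlgEquivOfSurjective hπ).symm (π (MvPolynomial.X i))) = v i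
      have h1 : (Ideal.quotientKerAlgEquivOfSurjective hπ).symm (π (MvPolynomial.X i)) =
          Ideal.Quotient.mk _ (MvPolynomial.X i) := by
        rw [AlgEquiv.symm_apply_eq]
        rfl
      rw [h1]
      exact MvPolynomial.aeval_X v i
  refine (IsClosedEmbedding.mk ⟨hind, hinj⟩ ?_).locallyCompactSpace
  rw [hrange]
  exact isClosed_biInter fun P _ => isClosed_singleton.preimage (hcont P)

section Torus

variable (F) (K : Type u) [CommRing K] [Algebra F K] [Module.Finite F K]

attribute [local instance] resTopology

theorem isTopologicalGroup_resPts : IsTopologicalGroup (ResPts F K F) := by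
  let _ : TopologicalSpace (K ⊗[F] F) := moduleTopology F (K ⊗[F] F)
  have : IsModuleTopology F (K ⊗[F] F) := ⟨rfl⟩
  have := IsModuleTopology.isTopologicalRing F (K ⊗[F] F)
  exact inferInstanceAs (IsTopologicalGroup (K ⊗[F] F)ˣ)

/-- A finite-dimensional algebra is homeomorphic to affine space. -/
theorem nonempty_homeomorph_moduleTopology (D : Type*) [CommRing D] [Algebra F D] [Module.Finite F D]
    [TopologicalSpace D] [IsModuleTopology F D] :
    ∃ n, Nonempty (D ≃ₜ (Fin n → F)) := by
  let b := Module.finBasis F D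
  have := IsModuleTopology.isTopologicalRing F D
  exact ⟨_, ⟨{ b.equivFun.toEquiv with
    continuous_toFun := IsModuleTopology.continuous_of_linearMap b.equivFun.toLinearMap
    continuous_invFun := IsModuleTopology.continuous_of_linearMap b.equivFun.symm.toLinearMap }⟩⟩

theorem t2Space_resPts : T2Space (ResPts F K F) := by
  let _ : TopologicalSpace (K ⊗[F] F) := moduleTopology F (K ⊗[F] F)
  have : IsModuleTopology F (K ⊗[F] F) := ⟨rfl⟩
  have := localField_t2Space F
  obtain ⟨n, ⟨e⟩⟩ := nonempty_homeomorph_moduleTopology F (K ⊗[F] F)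
  have := e.symm.t2Space
  exact inferInstanceAs (T2Space (K ⊗[F] F)ˣ)

theorem locallyCompactSpace_resPts : LocallyCompactSpace (ResPts F K F) := by
  let _ : TopologicalSpace (K ⊗[F] F) := moduleTopology F (K ⊗[F] F)
  have : IsModuleTopology F (K ⊗[F] F) := ⟨rfl⟩
  have := IsModuleTopology.isTopologicalRing F (K ⊗[F] F)
  have := localField_t2Space F
  obtain ⟨n, ⟨e⟩⟩ := nonempty_homeomorph_moduleTopology F (K ⊗[F] F)
  have := e.symm.t2Space
  have := e.isClosedEmbedding.locallyCompactSpace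
  exact inferInstanceAs (LocallyCompactSpace (K ⊗[F] F)ˣ)

theorem totallyDisconnectedSpace_resPts : TotallyDisconnectedSpace (ResPts F K F) := by
  let _ : TopologicalSpace (K ⊗[F] F) := moduleTopology F (K ⊗[F] F)
  have : IsModuleTopology F (K ⊗[F] F) := ⟨rfl⟩
  have := localField_totallyDisconnectedSpace F
  obtain ⟨n, ⟨e⟩⟩ := nonempty_homeomorph_moduleTopology F (K ⊗[F] F)
  have hc : Continuous fun t : (K ⊗[F] F)ˣ => e t := e.continuous.comp Units.continuous_val
  exact ⟨isTotallyDisconnected_of_image (f := fun t : (K ⊗[F] F)ˣ => e t) hc.continuousOn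
    (e.injective.comp Units.val_injective) (isTotallyDisconnected_of_totallyDisconnectedSpace _)⟩

end Torus

end CompactOpen

section SimilitudeTopology

variable {F : Type u} [Field F] [ValuativeRel F] [TopologicalSpace F]
  [IsNonarchimedeanLocalField F]
variable {Z G : AffineAlgebraicGroup F} {K E : Type u} [CommRing K] [Algebra F K]
  [Module.Finite F K] [CommRing E]
  [Algebra F E]

attribute [local instance] resTopology

namespace SimGroup

variable {ζ : CentralSubgroup Z G} {I : InitialData Z K E}

omit [ValuativeRel F] [IsNonarchimedeanLocalField F] [Module.Finite F K] in
theorem continuous_proj : Continuous (proj ζ I) := by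
  have h : Continuous fun x : G.Pts F × ResPts F K F => (1 : SimGroup ζ I) * proj ζ I x * 1 :=
    continuous_iSup_rng (i := ((1 : SimGroup ζ I), (1 : SimGroup ζ I))) continuous_coinduced_rng
  refine h.congr fun x => ?_
  rw [one_mul, mul_one]

/-- The image in `G̃(F)` of open subgroups of `G(F)` and `T(F)`. -/
def openImage (ζ : CentralSubgroup Z G) (I : InitialData Z K E) (U : OpenSubgroup (G.Pts F))
    (U' : OpenSubgroup (ResPts F K F)) : OpenSubgroup (SimGroup ζ I) where
  toSubgroup := (U.toSubgroup.prod U'.toSubgroup).map (proj ζ I)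
  isOpen' := by
    refine isOpen_iSup_iff.2 fun ab => isOpen_coinduced.2 ?_
    obtain ⟨a, b⟩ := ab
    refine isOpen_iff_mem_nhds.2 fun x hx => ?_
    obtain ⟨u, hu, hux⟩ : ∃ u ∈ U.toSubgroup.prod U'.toSubgroup,
      proj ζ I u = a * proj ζ I x * b := hx
    -- near `x`, the product changes by a conjugate of an element of `G(F) × T(F)` near `1`
    have hN : ∀ y : G.Pts F × ResPts F K F,
        y ∈ {y | conj b⁻¹ (x.1⁻¹ * y.1) ∈ U ∧ x.2⁻¹ * y.2 ∈ U'} →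
        y ∈ (fun y => a * proj ζ I y * b) ⁻¹'
          ((U.toSubgroup.prod U'.toSubgroup).map (proj ζ I) : Set (SimGroup ζ I)) := by
      rintro y ⟨hy₁, hy₂⟩
      refine ⟨u * (conj b⁻¹ (x.1⁻¹ * y.1), x.2⁻¹ * y.2),
        mul_mem hu ⟨hy₁, hy₂⟩, ?_⟩
      have h1 : y = x * (x.1⁻¹ * y.1, x.2⁻¹ * y.2) :=
        Prod.ext (mul_inv_cancel_left _ _).symm (mul_inv_cancel_left _ _).symm
      change _ = a * proj ζ I y * b
      have h2 : proj ζ I y = proj ζ I x * (proj ζ I (x.1⁻¹ * y.1, 1) *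
          proj ζ I (1, x.2⁻¹ * y.2)) := by
        rw [← proj_eq_mul, ← map_mul, ← h1]
      rw [map_mul, hux, proj_eq_mul (conj b⁻¹ _), proj_conj, h2]
      simp only [mul_assoc, inv_inv, mul_inv_cancel_left]
      rw [proj_right_comm (x.2⁻¹ * y.2) b]
    refine Filter.mem_of_superset (IsOpen.mem_nhds ?_ ?_) hN
    · refine IsOpen.inter ?_ ?_
      · exact U.isOpen.preimage ((continuous_conj b⁻¹).comp
          ((continuous_const_mul x.1⁻¹).comp continuous_fst))
      · have := isTopologicalGroup_resPts F K
        exact U'.isOpen.preimage ((continuous_const_mul x.2⁻¹).comp continuous_snd)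
    · simp only [Set.mem_ofPred_eq, inv_mul_cancel, map_one]
      exact ⟨one_mem _, one_mem _⟩

end SimGroup

end SimilitudeTopology

/-! ### Central characters -/

section CentralCharacters

open Topology

/-- Extension of characters, by the divisibility of `ℂˣ`. -/
theorem exists_character_extension {Z₀ T : Type*} [Group Z₀] [CommGroup T] (j : Z₀ →* T)
    (T₁ : Subgroup T) (c : Z₀ →* ℂˣ) (hc : ∀ z, j z ∈ T₁ → c z = 1) :
    ∃ χ : T →* ℂˣ, (∀ t ∈ T₁, χ t = 1) ∧ ∀ z, χ (j z) = c z := by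
  have hdiv : ∀ n : ℤ, n ≠ 0 → Function.Surjective fun a : Additive ℂˣ => n • a := by
    intro n hn a
    obtain ⟨b, hb⟩ := IsAlgClosed.exists_pow_nat_eq (a.toMul : ℂ) (Int.natAbs_pos.2 hn)
    have hb0 : b ≠ 0 := fun h0 => a.toMul.ne_zero (by
      rw [← hb, h0, zero_pow (Int.natAbs_ne_zero.2 hn)])
    have h1 : (Units.mk0 b hb0) ^ n.natAbs = a.toMul := Units.ext hb
    rcases Int.natAbs_eq n with h | h
    · refine ⟨Additive.ofMul (Units.mk0 b hb0), ?_⟩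
      change n • _ = _
      rw [h, natCast_zsmul]
      exact congrArg Additive.ofMul h1
    · refine ⟨Additive.ofMul (Units.mk0 b hb0)⁻¹, ?_⟩
      change n • _ = _
      rw [h, neg_zsmul, natCast_zsmul, ofMul_inv, neg_nsmul, neg_neg]
      exact congrArg Additive.ofMul h1
  let _ : DivisibleBy (Additive ℂˣ) ℤ := divisibleByOfSMulRightSurj _ _ fun {n} hn => hdiv n hn
  let φ : Z₀ →* T ⧸ T₁ := (QuotientGroup.mk' T₁).comp j
  have hker : φ.ker ≤ c.ker := fun z hz => hc z ((QuotientGroup.eq_one_iff _).1 hz)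
  let c' : φ.range →* ℂˣ := φ.rangeRestrict.liftOfSurjective φ.rangeRestrict_surjective
    ⟨c, by rwa [MonoidHom.ker_rangeRestrict]⟩
  obtain ⟨χ, hχ⟩ := (Module.Baer.of_divisible (Additive ℂˣ)).extension_property_addMonoidHom
    (MonoidHom.toAdditive φ.range.subtype) Subtype.val_injective (MonoidHom.toAdditive c')
  let χ' : T ⧸ T₁ →* ℂˣ := MonoidHom.toAdditive.symm χ
  have hχ' : ∀ x : φ.range, χ' x = c' x := fun x => DFunLike.congr_fun hχ (Additive.ofMul x)
  refine ⟨χ'.comp (QuotientGroup.mk' T₁), fun t ht => ?_, fun z => ?_⟩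
  · rw [MonoidHom.comp_apply, show QuotientGroup.mk' T₁ t = 1 from (QuotientGroup.eq_one_iff _).2 ht,
      map_one]
  · exact (hχ' (φ.rangeRestrict z)).trans (MonoidHom.liftOfRightInverse_comp_apply _ _ _ _ z)

theorem IsIrrRep.exists_centralCharacter {Z₀ A V : Type*} [Group Z₀] [Group A] [TopologicalSpace A]
    [AddCommGroup V] [Module ℂ V] {ρ : Representation ℂ A V} (hρ : IsIrrRep ρ) (ζ : Z₀ →* A)
    (hζ : ∀ z a, ζ z * a = a * ζ z) : ∃ c : Z₀ →* ℂˣ, ∀ z v, ρ (ζ z) v = (c z : ℂ) • v := by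
  have := hρ.1.nontrivial
  obtain ⟨v, hv⟩ := exists_ne (0 : V)
  choose c hc using fun z => hρ.exists_scalar_of_central (hζ z)
  let c' : Z₀ →* ℂ :=
    { toFun := c
      map_one' := smul_left_injective ℂ hv (by
        change c 1 • v = (1 : ℂ) • v
        rw [← hc, map_one, map_one, one_smul]; rfl)
      map_mul' := fun z w => smul_left_injective ℂ hv (by
        change c (z * w) • v = (c z * c w) • v
        rw [← hc, map_mul, map_mul, Module.End.mul_apply, hc w, map_smul, hc z, smul_smul,
          mul_comm]) }
  exact ⟨c'.toHomUnits, hc⟩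

end CentralCharacters

/-! ### Similitude groups as central extensions -/

section SimilitudeExtension

open Topology

variable {F : Type u} [Field F] [ValuativeRel F] [TopologicalSpace F]
  [IsNonarchimedeanLocalField F]
variable {Z G : AffineAlgebraicGroup F} {K E : Type u} [CommRing K] [Algebra F K]
  [Module.Finite F K] [CommRing E] [Algebra F E]

attribute [local instance] resTopology

omit [ValuativeRel F] [IsNonarchimedeanLocalField F] [Module.Finite F K] in
theorem continuous_resCoord [IsTopologicalRing F] (l : K →ₗ[F] F) :
    Continuous fun t : ResPts F K F => resCoord K F l (t : K ⊗[F] F) := by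
  let _ : TopologicalSpace (K ⊗[F] F) := moduleTopology F (K ⊗[F] F)
  have : IsModuleTopology F (K ⊗[F] F) := ⟨rfl⟩
  exact (IsModuleTopology.continuous_of_linearMap (resCoord K F l)).comp Units.continuous_val

omit [ValuativeRel F] [IsNonarchimedeanLocalField F] [Module.Finite F K] in
/-- A closed embedding of algebraic groups is a topological embedding on rational points. -/
theorem InitialData.isInducing_j [IsTopologicalRing F] [IsTopologicalGroup (ResPts F K F)]
    (I : InitialData Z K E) {V : Set (Z.Pts F)}
    (hV : IsOpen V) : ∃ W : Set (ResPts F K F), IsOpen W ∧ I.j F ⁻¹' W = V := by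
  have hcoord : ∀ (z : Z.Pts F) (l : K →ₗ[F] F) (x : K ⊗[F] Z.coord),
      (Z.ev z) (resCoord K Z.coord l x) =
        resCoord K F l (Algebra.TensorProduct.map (AlgHom.id F K) (Z.ev z) x) := by
    intro z l x
    induction x using TensorProduct.induction_on with
    | zero => simp
    | tmul b c => simp [resCoord]
    | add x y hx hy => simp only [map_add, hx, hy]
  have hj : ∀ z : Z.Pts F,
      I.j F z = resMap K (Z.ev z) (I.j Z.coord (Z.pt (AlgHom.id F Z.coord))) := fun z =>
    I.j_natural (Z.ev z) (Z.pt (AlgHom.id F Z.coord))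
  -- the coordinate ring of `Z` is generated by the coordinates of `j` and of `j⁻¹`, which are pulled back
  -- from continuous functions on the torus
  have key : ∀ a : Z.coord, ∃ φ : ResPts F K F → F, Continuous φ ∧ ∀ z, Z.ev z a = φ (I.j F z) := by
    intro a
    have ha : a ∈ Algebra.adjoin F {a : Z.coord | ∃ l : K →ₗ[F] F,
      a = resCoord K Z.coord l ↑(I.j Z.coord (Z.pt (AlgHom.id F Z.coord))) ∨
      a = resCoord K Z.coord l ↑(I.j Z.coord (Z.pt (AlgHom.id F Z.coord)))⁻¹} := by
      rw [I.j_closed]; trivial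
    induction ha using Algebra.adjoin_induction with
    | mem a ha =>
      obtain ⟨l, rfl | rfl⟩ := ha
      · refine ⟨fun t => resCoord K F l (t : K ⊗[F] F), continuous_resCoord l, fun z => ?_⟩
        rw [hcoord, hj z]
        rfl
      · refine ⟨fun t => resCoord K F l (t⁻¹ : ResPts F K F), (continuous_resCoord l).comp
          continuous_inv, fun z => ?_⟩
        rw [hcoord, hj z]
        rfl
    | algebraMap r => exact ⟨fun _ => r, continuous_const, fun z => (Z.ev z).commutes r⟩
    | add a b _ _ ha hb =>
      obtain ⟨φ, h1, h2⟩ := ha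
      obtain ⟨ψ, h3, h4⟩ := hb
      exact ⟨fun t => φ t + ψ t, h1.add h3, fun z => by rw [map_add, h2, h4]⟩
    | mul a b _ _ ha hb =>
      obtain ⟨φ, h1, h2⟩ := ha
      obtain ⟨ψ, h3, h4⟩ := hb
      exact ⟨fun t => φ t * ψ t, h1.mul h3, fun z => by rw [map_mul, h2, h4]⟩
  choose φ hφ hφ' using key
  obtain ⟨W, hW, rfl⟩ := isOpen_induced_iff.1 hV
  refine ⟨(fun t a => φ a t) ⁻¹' W, hW.preimage (continuous_pi hφ), ?_⟩
  rw [← Set.preimage_comp]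
  congr 1
  exact funext fun z => funext fun a => (hφ' a z).symm

theorem hasCompactOpenSubgroup_of_locallyCompactSpace {A : Type*} [Group A] [TopologicalSpace A]
    [IsTopologicalGroup A] [LocallyCompactSpace A] [T2Space A] [TotallyDisconnectedSpace A] :
    HasCompactOpenSubgroup A := by
  obtain ⟨C, -, hC⟩ := exists_compact_openSubgroup_le (A := A) Filter.univ_mem
  exact ⟨C, fun U => relIndex_ne_zero_of_isCompact U hC⟩

namespace SimGroup

variable {ζ : CentralSubgroup Z G} {I : InitialData Z K E}

/-- The central character of `π` is trivial on a neighbourhood of `1` in `Z(F)`, hence extends from `Z(F)`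
to a smooth character of `T(F)`. -/
theorem exists_char {V : Type u} [AddCommGroup V] [Module ℂ V] {π : Representation ℂ (G.Pts F) V}
    (hπ : IsIrrRep π) : ∃ χ : ResPts F K F →* ℂˣ,
      (∃ U : OpenSubgroup (ResPts F K F), ∀ t ∈ U, χ t = 1) ∧
      ∀ g t, proj ζ I (g, t) = 1 → ∀ v, (χ t : ℂ) • π g v = v := by
  have := isTopologicalGroup_resPts F K
  have := t2Space_resPts F K
  have := locallyCompactSpace_resPts F K
  have := totallyDisconnectedSpace_resPts F K
  have := hπ.1.nontrivial
  obtain ⟨v, hv⟩ := exists_ne (0 : V)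
  obtain ⟨U, hU⟩ := hπ.2.1 v
  obtain ⟨c, hc⟩ := hπ.exists_centralCharacter (ζ.pts F) fun z g => ζ.central F z g
  have hζc : Continuous (ζ.pts F) :=
    continuous_induced_rng.2 (continuous_pi fun a => Z.continuous_eval (ζ.comap a))
  obtain ⟨W, hW, hWU⟩ := I.isInducing_j (U.isOpen.preimage hζc)
  have h1W : (1 : ResPts F K F) ∈ W := by
    have h1 : (1 : Z.Pts F) ∈ I.j F ⁻¹' W := by
      rw [hWU]
      change ζ.pts F 1 ∈ U
      rw [map_one]
      exact one_mem U
    rwa [Set.mem_preimage, map_one] at h1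
  obtain ⟨T₁, hT₁, -⟩ := exists_compact_openSubgroup_le (hW.mem_nhds h1W)
  obtain ⟨χ, hχ, hχc⟩ := exists_character_extension (I.j F) T₁.toSubgroup c fun z hz => by
    have h1 : z ∈ I.j F ⁻¹' W := hT₁ hz
    rw [hWU] at h1
    refine Units.ext (smul_left_injective ℂ hv ?_)
    change (c z : ℂ) • v = (1 : ℂ) • v
    rw [← hc, one_smul]
    exact hU _ h1
  refine ⟨χ, ⟨T₁, hχ⟩, fun g t h w => ?_⟩
  obtain ⟨z, rfl, rfl⟩ := exists_of_proj_eq_one h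
  rw [map_inv χ, hχc, hc, smul_smul, Units.inv_mul, one_smul]

variable {S : Subgroup (SimGroup ζ I)}

/-- The map from `G(F) × T(F)` to a subgroup of `G̃(F)` containing its image. -/
def projTo (hS : (proj ζ I).range ≤ S) : G.Pts F × ResPts F K F →* S :=
  (proj ζ I).codRestrict S fun x => hS ⟨x, rfl⟩

/-- A subgroup of `G̃(F)` containing the image of `G(F) × T(F)` with finite index is a central extension
of `G(F)` by `T(F)`. -/
theorem centralExt (hS : (proj ζ I).range ≤ S) (hfin : (proj ζ I).range.relIndex S ≠ 0) :
    CentralExt ((projTo hS).comp (MonoidHom.inl _ _)) ((projTo hS).comp (MonoidHom.inr _ _)) := by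
  have := isTopologicalGroup_resPts F K
  have := t2Space_resPts F K
  have := locallyCompactSpace_resPts F K
  have := totallyDisconnectedSpace_resPts F K
  have := G.isTopologicalGroup_pts
  have := G.t2Space_pts
  have := G.locallyCompactSpace_pts
  have := G.totallyDisconnectedSpace_pts
  have hcont : Continuous (projTo hS) := continuous_proj.subtype_mk _
  have hsub : Continuous S.subtype := continuous_subtype_val
  refine ⟨?_, ?_, ?_, ?_, ⟨?_⟩, ?_, ?_, ?_, ?_⟩
  · exact hcont.comp (Continuous.prodMk continuous_id continuous_const)
  · exact hcont.comp (Continuous.prodMk continuous_const continuous_id)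
  · exact fun t a => Subtype.ext (proj_right_comm t (a : SimGroup ζ I))
  · intro U U'
    refine ⟨(openImage ζ I U U').comap S.subtype hsub, fun a ha => ?_⟩
    obtain ⟨⟨g, t⟩, ⟨hg, ht⟩, h⟩ := ha
    exact ⟨g, hg, t, ht, Subtype.ext ((proj_eq_mul g t).symm.trans h)⟩
  · have : ((proj ζ I).range.subgroupOf S).FiniteIndex := ⟨hfin⟩
    refine (Subgroup.finiteIndex_of_le (H := (proj ζ I).range.subgroupOf S) ?_).index_ne_zero
    rintro a ⟨⟨g, t⟩, h⟩
    have h1 : (projTo hS).comp (MonoidHom.inl _ _) g * (projTo hS).comp (MonoidHom.inr _ _) t = a :=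
      Subtype.ext ((proj_eq_mul g t).symm.trans h)
    rw [← h1]
    exact Subgroup.mul_mem_sup ⟨g, rfl⟩ ⟨t, rfl⟩
  · refine fun a => ⟨SimGroup.conj (a : SimGroup ζ I), continuous_conj _, ?_, fun g =>
      Subtype.ext (proj_conj _ g)⟩
    rw [conj_symm]
    exact continuous_conj _
  · exact hasCompactOpenSubgroup_of_locallyCompactSpace
  · obtain ⟨C, -, hC⟩ := exists_compact_openSubgroup_le (A := G.Pts F) Filter.univ_mem
    obtain ⟨C', -, hC'⟩ := exists_compact_openSubgroup_le (A := ResPts F K F) Filter.univ_mem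
    refine ⟨(openImage ζ I C C').comap S.subtype hsub, fun U => ?_⟩
    have h1 : ((openImage ζ I C C').comap S.subtype hsub).toSubgroup =
        (C.toSubgroup.prod C'.toSubgroup).map (projTo hS) := by
      ext a
      constructor
      · rintro ⟨x, hx, h⟩
        exact ⟨x, hx, Subtype.ext h⟩
      · rintro ⟨x, hx, rfl⟩
        exact ⟨x, hx, rfl⟩
    rw [h1, ← Subgroup.relIndex_comap]
    exact relIndex_ne_zero_of_isCompact (U.comap (projTo hS) hcont) (hC.prod hC')
  · intro V _ _ π hπ
    obtain ⟨χ, hχ, h⟩ := exists_char (ζ := ζ) (I := I) hπ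
    refine ⟨χ, hχ, fun g t hgt => h g t ?_⟩
    rw [proj_eq_mul]
    exact congrArg Subtype.val hgt

end SimGroup

/-- The structure is unchanged when the central group is reparametrized by inversion. -/
theorem CentralExt.comp_inv {G A T : Type u} [Group G] [Group A] [CommGroup T] [TopologicalSpace G]
    [TopologicalSpace A] [TopologicalSpace T] [IsTopologicalGroup T] {f : G →* A} {z : T →* A}
    (h : CentralExt f z) : CentralExt f (z.comp invMonoidHom) where
  continuous_left := h.continuous_left
  continuous_right := h.continuous_right.comp continuous_inv
  central t := h.central t⁻¹
  exists_open U U' := by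
    obtain ⟨W, hW⟩ := h.exists_open U U'
    refine ⟨W, fun a ha => ?_⟩
    obtain ⟨g, hg, t, ht, rfl⟩ := hW a ha
    refine ⟨g, hg, t⁻¹, inv_mem ht, ?_⟩
    change f g * z t⁻¹⁻¹ = _
    rw [inv_inv]
  finiteIndex := by
    have h1 : (z.comp invMonoidHom).range = z.range :=
      le_antisymm (by rintro _ ⟨t, rfl⟩; exact ⟨t⁻¹, rfl⟩)
        (by rintro _ ⟨t, rfl⟩; exact ⟨t⁻¹, congrArg z (inv_inv t)⟩)
    rw [h1]
    exact h.finiteIndex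
  conj := h.conj
  compact_left := h.compact_left
  compact := h.compact
  exists_char V _ _ π hπ := by
    obtain ⟨χ, ⟨U, hU⟩, hχ⟩ := h.exists_char V π hπ
    refine ⟨χ.comp invMonoidHom, ⟨U, fun t ht => hU _ (inv_mem ht)⟩, fun g t => hχ g t⁻¹⟩

end SimilitudeExtension

/-! ### Dual pairs and their similitude groups -/

namespace DualPair

section Algebra

variable {F : Type u} [Field F] (P : DualPair F)
variable {K E : Type u} [CommRing K] [Algebra F K] [CommRing E] [Algebra F E]
variable (I : InitialData P.Z K E)

theorem mem_Jsim {x : P.Gsim I × P.Hsim I} :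
    x ∈ P.Jsim I ↔ SimGroup.sim P.ζG I x.1 * SimGroup.sim P.ζH I x.2 = 1 := Iff.rfl

/-- The embedding `G(F) × H(F) → J̃^sim(F)`. -/
def pairEmb : P.G.Pts F × P.H.Pts F →* P.Jsim I :=
  MonoidHom.codRestrict
    (((SimGroup.proj P.ζG I).comp (MonoidHom.inl _ _)).prodMap
      ((SimGroup.proj P.ζH I).comp (MonoidHom.inl _ _))) (P.Jsim I) fun x => by
    rw [mem_Jsim]
    change SimGroup.sim P.ζG I (SimGroup.proj P.ζG I (x.1, 1)) *
      SimGroup.sim P.ζH I (SimGroup.proj P.ζH I (x.2, 1)) = 1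
    rw [SimGroup.sim_proj, SimGroup.sim_proj, map_one, map_one, one_mul]

/-- The antidiagonal embedding `T(F) → J̃^sim(F)`. -/
def torusEmb : ResPts F K F →* P.Jsim I :=
  MonoidHom.codRestrict
    (((SimGroup.proj P.ζG I).comp (MonoidHom.inr _ _)).prod
      (((SimGroup.proj P.ζH I).comp (MonoidHom.inr _ _)).comp invMonoidHom)) (P.Jsim I) fun t => by
    rw [mem_Jsim]
    change SimGroup.sim P.ζG I (SimGroup.proj P.ζG I (1, t)) *
      SimGroup.sim P.ζH I (SimGroup.proj P.ζH I (1, t⁻¹)) = 1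
    rw [SimGroup.sim_proj, SimGroup.sim_proj, ← map_mul, ← map_mul, mul_inv_cancel, map_one,
      map_one]

variable {I} in
theorem iota_eq {x : P.Jsim I} {e : P.𝓔.Pts F} (h : P.IotaRel I x e) : P.iota I x = e :=
  P.iotaRel_unique I (P.exists_iotaRel I x).choose_spec h

theorem iota_comp_pairEmb : (P.iota I).comp (P.pairEmb I) = P.i F := by
  refine MonoidHom.ext fun x => P.iota_eq ⟨P.G.map (toClosure F) x.1, P.H.map (toClosure F) x.2, 1,
    ?_, ?_, P.i_natural _ _ _⟩
  · change SimGroup.incl P.ζG I (SimGroup.proj P.ζG I (x.1, 1)) = _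
    rw [SimGroup.incl_proj, map_one]
  · change SimGroup.incl P.ζH I (SimGroup.proj P.ζH I (x.2, 1)) = _
    rw [SimGroup.incl_proj, map_one, inv_one]

theorem iota_torusEmb (t : ResPts F K F) : P.iota I (P.torusEmb I t) = 1 := by
  refine P.iota_eq ⟨1, 1, resMap K (toClosure F) t, ?_, ?_, ?_⟩
  · change SimGroup.incl P.ζG I (SimGroup.proj P.ζG I (1, t)) = _
    rw [SimGroup.incl_proj, map_one]
  · change SimGroup.incl P.ζH I (SimGroup.proj P.ζH I (1, t⁻¹)) = _
    rw [SimGroup.incl_proj, map_one, map_inv]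
  · rw [map_one]
    exact map_one (P.i (AlgebraicClosure F))

theorem range_proj_le_Gplus : (SimGroup.proj P.ζG I).range ≤ P.Gplus I := by
  rintro _ ⟨⟨g, t⟩, rfl⟩
  rw [SimGroup.proj_eq_mul]
  exact mul_mem ⟨_, (P.pairEmb I (g, 1)).2, rfl⟩ ⟨_, (P.torusEmb I t).2, rfl⟩

theorem range_proj_le_Hplus : (SimGroup.proj P.ζH I).range ≤ P.Hplus I := by
  rintro _ ⟨⟨h, t⟩, rfl⟩
  rw [SimGroup.proj_eq_mul]
  refine mul_mem ⟨_, (P.pairEmb I (1, h)).2, rfl⟩ ⟨_, (P.torusEmb I t⁻¹).2, ?_⟩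
  change SimGroup.proj P.ζH I (1, t⁻¹⁻¹) = _
  rw [inv_inv]

variable {I} in
theorem exists_of_toGplus_eq_one {x : P.Jsim I} (h : P.toGplus I x = 1) :
    ∃ j : P.G.Pts F × P.H.Pts F, j.1 = 1 ∧ P.pairEmb I j = x := by
  have h1 : x.1.1 = 1 := congrArg Subtype.val h
  have h2 := (P.mem_Jsim I).1 x.2
  rw [h1, map_one, one_mul] at h2
  obtain ⟨g, hg⟩ := SimGroup.exists_proj_eq_of_sim_eq_one h2
  refine ⟨(1, g), rfl, Subtype.ext (Prod.ext ?_ hg)⟩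
  exact (map_one (SimGroup.proj P.ζG I)).trans h1.symm

variable {I} in
theorem exists_of_toHplus_eq_one {x : P.Jsim I} (h : P.toHplus I x = 1) :
    ∃ j : P.G.Pts F × P.H.Pts F, j.2 = 1 ∧ P.pairEmb I j = x := by
  have h1 : x.1.2 = 1 := congrArg Subtype.val h
  have h2 := (P.mem_Jsim I).1 x.2
  rw [h1, map_one, mul_one] at h2
  obtain ⟨g, hg⟩ := SimGroup.exists_proj_eq_of_sim_eq_one h2
  refine ⟨(g, 1), rfl, Subtype.ext (Prod.ext hg ?_)⟩
  exact (map_one (SimGroup.proj P.ζH I)).trans h1.symm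

/-- Evaluating `i` at the universal point of `G` shows that `g ↦ i(g, 1)` is given by regular
functions. -/
theorem continuous_i_left [TopologicalSpace F] : Continuous fun g : P.G.Pts F => P.i F (g, 1) := by
  refine continuous_induced_rng.2 (continuous_pi fun a => ?_)
  refine (P.G.continuous_eval (P.𝓔.ev (P.i P.G.coord (P.G.pt (AlgHom.id F _), 1)) a)).congr
    fun g => ?_
  have h1 := P.i_natural (P.G.ev g) (P.G.pt (AlgHom.id F _)) 1
  rw [map_one] at h1
  exact (congrArg (fun e => P.𝓔.ev e a) h1).symm

theorem continuous_i_right [TopologicalSpace F] : Continuous fun h : P.H.Pts F => P.i F (1, h) := by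
  refine continuous_induced_rng.2 (continuous_pi fun a => ?_)
  refine (P.H.continuous_eval (P.𝓔.ev (P.i P.H.coord (1, P.H.pt (AlgHom.id F _))) a)).congr
    fun h => ?_
  have h1 := P.i_natural (P.H.ev h) 1 (P.H.pt (AlgHom.id F _))
  rw [map_one] at h1
  exact (congrArg (fun e => P.𝓔.ev e a) h1).symm

end Algebra

section Howe

variable {F : Type u} [Field F] [ValuativeRel F] [TopologicalSpace F]
  [IsNonarchimedeanLocalField F] (P : DualPair F)
variable {K E : Type u} [CommRing K] [Algebra F K] [Module.Finite F K] [CommRing E] [Algebra F E]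
variable (I : InitialData P.Z K E)
variable {Ω : Type u} [AddCommGroup Ω] [Module ℂ Ω]

attribute [local instance] resTopology

/-- The correspondence `G̃(F)⁺ ← J̃^sim(F) → H̃(F)⁺` extends `G(F) ← G(F) × H(F) → H(F)` by the torus, which
is embedded by `t ↦ (t, t⁻¹)` and acts trivially on `Ω`. -/
theorem thetaExt (hfin : P.FiniteIndex I) (ω : Representation ℂ (P.𝓔.Pts F) Ω)
    (hω : IsSmoothRep ω) :
    ThetaExt (MonoidHom.fst (P.G.Pts F) (P.H.Pts F)) (MonoidHom.snd (P.G.Pts F) (P.H.Pts F))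
      (P.toGplus I) (P.toHplus I) (P.pairEmb I)
      ((SimGroup.projTo (P.range_proj_le_Gplus I)).comp (MonoidHom.inl _ _))
      ((SimGroup.projTo (P.range_proj_le_Hplus I)).comp (MonoidHom.inl _ _))
      (P.torusEmb I) (MonoidHom.comp ω (P.iota I)) where
  surjective_p₀ := Prod.fst_surjective
  surjective_q₀ := Prod.snd_surjective
  surjective_p := P.toGplus_surjective I
  surjective_q := P.toHplus_surjective I
  p_apply _ := rfl
  q_apply _ := rfl
  centralExt_p := SimGroup.centralExt (P.range_proj_le_Gplus I) hfin.1
  centralExt_q := by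
    have := isTopologicalGroup_resPts F K
    exact (SimGroup.centralExt (P.range_proj_le_Hplus I) hfin.2).comp_inv
  exists_of_p _ h := P.exists_of_toGplus_eq_one h
  exists_of_q _ h := P.exists_of_toHplus_eq_one h
  apply_s t := by rw [MonoidHom.comp_apply, iota_torusEmb, map_one]
  smooth_p w := by
    obtain ⟨U, hU⟩ := hω w
    refine ⟨U.comap ((P.i F).comp (MonoidHom.inl _ _)) P.continuous_i_left, fun g hg =>
      ⟨(g, 1), rfl, rfl, ?_⟩⟩
    have h1 := DFunLike.congr_fun (P.iota_comp_pairEmb I) (g, 1)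
    rw [MonoidHom.comp_apply] at h1 ⊢
    rw [h1]
    exact hU _ hg
  smooth_q w := by
    obtain ⟨U, hU⟩ := hω w
    refine ⟨U.comap ((P.i F).comp (MonoidHom.inr _ _)) P.continuous_i_right, fun h hh =>
      ⟨(1, h), rfl, rfl, ?_⟩⟩
    have h1 := DFunLike.congr_fun (P.iota_comp_pairEmb I) (1, h)
    rw [MonoidHom.comp_apply] at h1 ⊢
    rw [h1]
    exact hU _ hh

theorem howeDuality_iff (hfin : P.FiniteIndex I) (ω : Representation ℂ (P.𝓔.Pts F) Ω)
    (hω : IsSmoothRep ω) : P.HoweDuality ω ↔ P.SimilitudeHoweDuality I ω := by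
  have h := (P.thetaExt I hfin ω hω).howeDualityProperty_iff
  rw [MonoidHom.comp_assoc, iota_comp_pairEmb] at h
  exact h

end Howe

end DualPair

/-! ### Splitting étale algebras -/

section Splitting

variable {F : Type u} [Field F] {K : Type u} [CommRing K] [Algebra F K]
variable {L : Type u} [Field L] [Algebra F L]

/-- The coordinate `K ⊗ R → R` given by an embedding `K → L`, for an `L`-algebra `R`. -/
def splitCoord (i : K →ₐ[F] L) (R : Type u) [CommRing R] [Algebra F R] [Algebra L R]
    [IsScalarTower F L R] : K ⊗[F] R →ₐ[F] R :=
  Algebra.TensorProduct.productMap ((IsScalarTower.toAlgHom F L R).comp i) (AlgHom.id F R)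

section

variable {R S : Type u} [CommRing R] [Algebra F R] [Algebra L R] [IsScalarTower F L R]
  [CommRing S] [Algebra F S] [Algebra L S] [IsScalarTower F L S]

theorem splitCoord_tmul (i : K →ₐ[F] L) (k : K) (r : R) :
    splitCoord i R (k ⊗ₜ r) = algebraMap L R (i k) * r := rfl

theorem splitCoord_map (i : K →ₐ[F] L) (φ : R →ₐ[L] S) (x : K ⊗[F] R) :
    splitCoord i S (Algebra.TensorProduct.map (AlgHom.id F K) (φ.restrictScalars F) x) =
      φ (splitCoord i R x) := by
  induction x using TensorProduct.induction_on with
  | zero => simp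
  | tmul k r =>
    rw [Algebra.TensorProduct.map_tmul, splitCoord_tmul, splitCoord_tmul, map_mul,
      AlgHom.commutes]
    rfl
  | add x y hx hy => simp only [map_add, hx, hy]

end

/-- The embeddings `i` give an isomorphism `K ⊗ L → Lⁿ`. The condition is expressed by the
idempotents which correspond to the standard basis of `Lⁿ`, so that it is visibly stable under
change of rings. -/
def IsSplitting {n : ℕ} (i : Fin n → K →ₐ[F] L) : Prop :=
  ∃ e : Fin n → K ⊗[F] L, (∀ a b, splitCoord (i a) L (e b) = if a = b then 1 else 0) ∧
    ∀ k : K, ∑ b, e b * (1 ⊗ₜ i b k) = k ⊗ₜ 1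

/-- A splitting over `L` remains one after extension of scalars to any `L`-algebra. -/
theorem IsSplitting.bijective {n : ℕ} {i : Fin n → K →ₐ[F] L} (hi : IsSplitting i)
    (R : Type u) [CommRing R] [Algebra F R] [Algebra L R] [IsScalarTower F L R] :
    Function.Bijective (RingHom.pi fun a => (splitCoord (i a) R : K ⊗[F] R →+* R)) := by
  obtain ⟨e, he, hsum⟩ := hi
  let ψ : K ⊗[F] L →ₐ[F] K ⊗[F] R :=
    Algebra.TensorProduct.map (AlgHom.id F K) ((Algebra.ofId L R).restrictScalars F)
  have h1 : ∀ a b, splitCoord (i a) R (ψ (e b)) = if a = b then 1 else 0 := fun a b => by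
    rw [splitCoord_map, he]
    split_ifs <;> simp
  have h2 : ∀ x : K ⊗[F] R, ∑ b, ψ (e b) * (1 ⊗ₜ splitCoord (i b) R x) = x := by
    intro x
    induction x using TensorProduct.induction_on with
    | zero => simp
    | tmul k r =>
      have h3 := congrArg (fun y => ψ y * (1 ⊗ₜ r)) (hsum k)
      simp only [map_sum, map_mul, Finset.sum_mul] at h3
      refine Eq.trans (Finset.sum_congr rfl fun b _ => ?_) (h3.trans ?_)
      · rw [splitCoord_tmul, mul_assoc]
        congr 1
        change _ = Algebra.TensorProduct.map _ _ (1 ⊗ₜ i b k) * _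
        rw [Algebra.TensorProduct.map_tmul, Algebra.TensorProduct.tmul_mul_tmul, map_one, one_mul]
        rfl
      · change Algebra.TensorProduct.map _ _ (k ⊗ₜ 1) * _ = _
        rw [Algebra.TensorProduct.map_tmul, Algebra.TensorProduct.tmul_mul_tmul, mul_one, map_one,
          one_mul]
        rfl
    | add x y hx hy =>
      simp only [map_add, TensorProduct.tmul_add, mul_add, Finset.sum_add_distrib, hx, hy]
  constructor
  · intro x y hxy
    rw [← h2 x, ← h2 y]
    exact Finset.sum_congr rfl fun b _ => congrArg (fun r => ψ (e b) * (1 ⊗ₜ r)) (congrFun hxy b)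
  · intro w
    refine ⟨∑ b, ψ (e b) * (1 ⊗ₜ w b), funext fun a => ?_⟩
    change splitCoord (i a) R _ = _
    rw [map_sum, Finset.sum_eq_single a]
    · rw [map_mul, h1, if_pos rfl, one_mul, splitCoord_tmul, map_one, map_one, one_mul]
    · intro b _ hb
      rw [map_mul, h1, if_neg hb.symm, zero_mul]
    · intro h
      exact absurd (Finset.mem_univ a) h

/-- The coordinates of points of a split torus. -/
def IsSplitting.unitsEquiv {n : ℕ} {i : Fin n → K →ₐ[F] L} (hi : IsSplitting i)
    (R : Type u) [CommRing R] [Algebra F R] [Algebra L R] [IsScalarTower F L R] :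
    ResPts F K R ≃* (Fin n → Rˣ) :=
  (Units.mapEquiv (RingEquiv.ofBijective _ (hi.bijective R)).toMulEquiv).trans MulEquiv.piUnits

section

variable {n : ℕ} {i : Fin n → K →ₐ[F] L} (hi : IsSplitting i)
variable {R S : Type u} [CommRing R] [Algebra F R] [Algebra L R] [IsScalarTower F L R]
  [CommRing S] [Algebra F S] [Algebra L S] [IsScalarTower F L S]

theorem IsSplitting.unitsEquiv_resMap (φ : R →ₐ[L] S) (t : ResPts F K R) :
    hi.unitsEquiv S (resMap K (φ.restrictScalars F) t) =
      fun a => Units.map (φ : R →* S) (hi.unitsEquiv R t a) :=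
  funext fun a => Units.ext (splitCoord_map (i a) φ t)

theorem IsSplitting.resMap_unitsEquiv_symm (φ : R →ₐ[L] S) (w : Fin n → Rˣ) :
    resMap K (φ.restrictScalars F) ((hi.unitsEquiv R).symm w) =
      (hi.unitsEquiv S).symm fun a => Units.map (φ : R →* S) (w a) := by
  rw [MulEquiv.eq_symm_apply, unitsEquiv_resMap, MulEquiv.apply_symm_apply]

end

/-- The idempotents are read off from the inverse of the matrix of the embeddings in a basis of `K`. -/
theorem isSplitting_of_isUnit_det {n : ℕ} (i : Fin n → K →ₐ[F] L) (b : Module.Basis (Fin n) F K)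
    (h : IsUnit (Matrix.of fun a j => i a (b j)).det) : IsSplitting i := by
  set P : Matrix (Fin n) (Fin n) L := Matrix.of fun a j => i a (b j) with hP
  refine ⟨fun c => ∑ j, b j ⊗ₜ P⁻¹ j c, fun a c => ?_, fun k => ?_⟩
  · have h1 := congrFun (congrFun (P.mul_nonsing_inv h) a) c
    rw [Matrix.mul_apply, Matrix.one_apply] at h1
    rw [map_sum, ← h1]
    exact Finset.sum_congr rfl fun j _ => splitCoord_tmul _ _ _
  · let f : K →ₗ[F] K ⊗[F] L := ∑ c, (LinearMap.mulLeft F (∑ j, b j ⊗ₜ[F] P⁻¹ j c)) ∘ₗ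
      (Algebra.TensorProduct.includeRight.toLinearMap ∘ₗ (i c).toLinearMap)
    have hf : f = (Algebra.TensorProduct.includeLeft : K →ₐ[F] K ⊗[F] L).toLinearMap := by
      refine b.ext fun l => ?_
      simp only [f, LinearMap.sum_apply, LinearMap.comp_apply, LinearMap.mulLeft_apply,
        AlgHom.toLinearMap_apply, Algebra.TensorProduct.includeRight_apply,
        Algebra.TensorProduct.includeLeft_apply, Finset.sum_mul,
        Algebra.TensorProduct.tmul_mul_tmul, mul_one]
      rw [Finset.sum_comm]
      have h1 : ∀ j, ∑ c, b j ⊗ₜ[F] (P⁻¹ j c * i c (b l)) = b j ⊗ₜ[F] (1 : Matrix (Fin n) (Fin n) L) j l := by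
        intro j
        rw [← TensorProduct.tmul_sum, ← P.nonsing_inv_mul h, Matrix.mul_apply]
        rfl
      simp only [h1]
      rw [Finset.sum_eq_single l]
      · rw [Matrix.one_apply_eq]
      · intro j _ hj
        rw [Matrix.one_apply_ne hj, TensorProduct.tmul_zero]
      · intro h
        exact absurd (Finset.mem_univ l) h
    have h2 := LinearMap.congr_fun hf k
    simpa [f] using h2

/-- A finite étale algebra is split by a finite set of elements of the algebraic closure. -/
theorem exists_isSplitting (F : Type u) [Field F] (K : Type u) [CommRing K] [Algebra F K]
    [Module.Finite F K] [Algebra.Etale F K] :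
    ∃ s : Set (AlgebraicClosure F), s.Finite ∧ ∀ L : IntermediateField F (AlgebraicClosure F),
      s ⊆ L → ∃ (n : ℕ) (i : Fin n → K →ₐ[F] L), IsSplitting i := by
  obtain ⟨n, ⟨e⟩⟩ := Algebra.IsFiniteSplit.nonempty_algEquiv_fun (AlgebraicClosure F)
    (AlgebraicClosure F ⊗[F] K)
  have hn : Module.finrank F K = n := by
    rw [← Module.finrank_baseChange (R := AlgebraicClosure F), e.toLinearEquiv.finrank_eq,
      Module.finrank_fin_fun]
  let b := Module.finBasisOfFinrankEq F K hn
  let i : Fin n → K →ₐ[F] AlgebraicClosure F := fun a =>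
    ((Pi.evalAlgHom (AlgebraicClosure F) (fun _ : Fin n => AlgebraicClosure F) a).comp
      e.toAlgHom).restrictScalars F |>.comp Algebra.TensorProduct.includeRight
  have hdet : IsUnit (Matrix.of fun a j => i a (b j)).det := by
    let b' := (b.baseChange (AlgebraicClosure F)).map e.toLinearEquiv
    have h1 := (Pi.basisFun (AlgebraicClosure F) (Fin n)).isUnit_det b'
    rw [Module.Basis.det_apply] at h1
    convert! h1 using 2
    ext a j
    simp [Module.Basis.toMatrix_apply, b', i]
  refine ⟨Set.range fun x : Fin n × Fin n => i x.1 (b x.2), Set.finite_range _, fun L hL => ?_⟩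
  have hiL : ∀ a k, i a k ∈ L := by
    intro a k
    rw [← b.sum_repr k, map_sum]
    refine sum_mem fun j _ => ?_
    rw [map_smul]
    exact L.smul_mem (hL ⟨(a, j), rfl⟩)
  let i' : Fin n → K →ₐ[F] L := fun a => (i a).codRestrict L.toSubalgebra (hiL a)
  refine ⟨n, i', isSplitting_of_isUnit_det i' b ?_⟩
  rw [isUnit_iff_ne_zero] at hdet ⊢
  intro h0
  refine hdet ?_
  have h1 := RingHom.map_det (algebraMap L (AlgebraicClosure F)) (Matrix.of fun a j => i' a (b j))
  rw [h0, map_zero] at h1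
  exact h1.symm

end Splitting

/-! ### Homomorphisms of split tori -/

section Monomials

/-- The homomorphism `(xₐ) ↦ (∏ₐ xₐ ^ Aₐ꜀)꜀` given by an integer matrix. -/
def zpowMatrix {ι κ : Type*} [Fintype ι] (A : Matrix ι κ ℤ) (M : Type*) [CommGroup M] :
    (ι → M) →* (κ → M) where
  toFun w c := ∏ a, w a ^ A a c
  map_one' := funext fun c => Finset.prod_eq_one fun a _ => one_zpow _
  map_mul' v w := funext fun c => by
    simp only [Pi.mul_apply, mul_zpow, Finset.prod_mul_distrib]

variable {ι κ τ : Type*} [Fintype ι] {M M' : Type*} [CommGroup M] [CommGroup M']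

theorem zpowMatrix_zpowMatrix [Fintype κ] (A : Matrix ι κ ℤ) (B : Matrix κ τ ℤ) (w : ι → M) :
    zpowMatrix B M (zpowMatrix A M w) = zpowMatrix (A * B) M w := by
  funext c
  change ∏ b, (∏ a, w a ^ A a b) ^ B b c = ∏ a, w a ^ (A * B) a c
  simp only [Matrix.mul_apply, ← Finset.prod_zpow, ← zpow_mul]
  rw [Finset.prod_comm]
  refine Finset.prod_congr rfl fun a _ => ?_
  exact (map_sum (zmultiplesHom _ (Additive.ofMul (w a))) _ _).symm

theorem zpowMatrix_nsmul (d : ℕ) (A : Matrix ι κ ℤ) (w : ι → M) :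
    zpowMatrix (d • A) M w = zpowMatrix A M w ^ d := by
  funext c
  change ∏ a, w a ^ (d • A) a c = (∏ a, w a ^ A a c) ^ d
  rw [← Finset.prod_pow]
  refine Finset.prod_congr rfl fun a _ => ?_
  rw [Matrix.smul_apply, nsmul_eq_mul, mul_comm, zpow_mul, zpow_natCast]

theorem map_zpowMatrix (f : M →* M') (A : Matrix ι κ ℤ) (w : ι → M) (c : κ) :
    f (zpowMatrix A M w c) = zpowMatrix A M' (fun a => f (w a)) c := by
  change f (∏ a, w a ^ A a c) = ∏ a, f (w a) ^ A a c
  rw [map_prod]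
  exact Finset.prod_congr rfl fun a _ => map_zpow f _ _

/-- An integral multiple of a generalized inverse of an integer matrix. -/
theorem exists_generalizedInverse {n m : ℕ} (A : Matrix (Fin n) (Fin m) ℤ) :
    ∃ (B : Matrix (Fin m) (Fin n) ℤ) (d : ℕ), 0 < d ∧ A * B * A = d • A := by
  let f : (Fin m → ℚ) →ₗ[ℚ] (Fin n → ℚ) := Matrix.toLin' (A.map (Int.cast : ℤ → ℚ))
  obtain ⟨g, hg⟩ := f.rangeRestrict.exists_rightInverse_of_surjective f.range_rangeRestrict
  obtain ⟨h, hh⟩ := LinearMap.exists_extend g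
  have hfhf : f ∘ₗ h ∘ₗ f = f := by
    refine LinearMap.ext fun v => ?_
    have h1 : h (f v) = g (f.rangeRestrict v) := LinearMap.congr_fun hh (f.rangeRestrict v)
    change f (h (f v)) = f v
    rw [h1]
    exact congrArg Subtype.val (LinearMap.congr_fun hg (f.rangeRestrict v))
  let C : Matrix (Fin m) (Fin n) ℚ := LinearMap.toMatrix' h
  have hC : A.map (Int.cast : ℤ → ℚ) * C * A.map (Int.cast : ℤ → ℚ) =
      A.map (Int.cast : ℤ → ℚ) := by
    have h1 := congrArg LinearMap.toMatrix' hfhf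
    rw [LinearMap.toMatrix'_comp, LinearMap.toMatrix'_comp] at h1
    simpa [f, Matrix.mul_assoc] using h1
  obtain ⟨⟨b, hb⟩, hbC⟩ := IsLocalization.exist_integer_multiples_of_finite (nonZeroDivisors ℤ)
    fun x : Fin m × Fin n => C x.1 x.2
  choose c hc using hbC
  have hb0 : b ≠ 0 := nonZeroDivisors.ne_zero hb
  have hmap : Function.Injective fun X : Matrix (Fin n) (Fin m) ℤ => X.map (Int.cast : ℤ → ℚ) :=
    Matrix.map_injective Int.cast_injective
  let B : Matrix (Fin m) (Fin n) ℤ := Matrix.of fun x y => b.sign * c (x, y)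
  refine ⟨B, b.natAbs, Int.natAbs_pos.2 hb0, hmap ?_⟩
  have hB : B.map (Int.cast : ℤ → ℚ) = (b.natAbs : ℚ) • C := by
    ext x y
    have h1 : (c (x, y) : ℚ) = (b : ℚ) * C x y := by
      simpa [Algebra.smul_def] using hc (x, y)
    have h2 : ((b.sign : ℤ) : ℚ) * (b : ℚ) = (b.natAbs : ℚ) := by
      rw [← Int.cast_mul, Int.sign_mul_self_eq_natAbs, Int.cast_natCast]
    change ((b.sign * c (x, y) : ℤ) : ℚ) = _
    rw [Int.cast_mul, h1, ← mul_assoc, h2]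
    rfl
  change (A * B * A).map (Int.castRingHom ℚ) = (b.natAbs • A).map (Int.castRingHom ℚ)
  rw [Matrix.map_mul, Matrix.map_mul]
  change A.map (Int.cast : ℤ → ℚ) * B.map (Int.cast : ℤ → ℚ) * A.map (Int.cast : ℤ → ℚ) = _
  rw [hB, Matrix.mul_smul, Matrix.smul_mul, hC]
  ext x y
  simp

variable {F L : Type u} [Field F] [Field L] [Algebra F L]

/-- The endomorphisms of `𝔾_m` over a field are the powers: the image of the universal unit is a
group-like element of `L[ℤ]`. -/
theorem exists_zpow_of_natural
    (v : ∀ (R : Type u) [CommRing R] [Algebra F R] [Algebra L R] [IsScalarTower F L R], Rˣ →* Rˣ)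
    (hv : ∀ {R S : Type u} [CommRing R] [Algebra F R] [Algebra L R] [IsScalarTower F L R]
      [CommRing S] [Algebra F S] [Algebra L S] [IsScalarTower F L S] (φ : R →ₐ[L] S) (a : Rˣ),
      v S (Units.map (φ : R →* S) a) = Units.map (φ : R →* S) (v R a)) :
    ∃ n : ℤ, ∀ (R : Type u) [CommRing R] [Algebra F R] [Algebra L R] [IsScalarTower F L R]
      (a : Rˣ), v R a = a ^ n := by
  let A := MonoidAlgebra L (Multiplicative ℤ)
  let T : Multiplicative ℤ →* Aˣ :=
    (Units.map (MonoidAlgebra.of L (Multiplicative ℤ))).comp toUnits.toMonoidHom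
  let x : Aˣ := T (Multiplicative.ofAdd 1)
  have hcounit : Units.map (Bialgebra.counitAlgHom L A : A →* L) x = 1 :=
    Units.ext (by
      change Coalgebra.counit (R := L)
        (MonoidAlgebra.single (Multiplicative.ofAdd (1 : ℤ)) (1 : L)) = 1
      simp)
  have hcomul : Units.map (Bialgebra.comulAlgHom L A : A →* A ⊗[L] A) x =
      Units.map ((Algebra.TensorProduct.includeLeft : A →ₐ[L] A ⊗[L] A) : A →* A ⊗[L] A) x *
      Units.map ((Algebra.TensorProduct.includeRight : A →ₐ[L] A ⊗[L] A) : A →* A ⊗[L] A) x :=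
    Units.ext (by
      change Coalgebra.comul (R := L) (MonoidAlgebra.single (Multiplicative.ofAdd (1 : ℤ)) (1 : L)) =
        (MonoidAlgebra.single (Multiplicative.ofAdd (1 : ℤ)) (1 : L)) ⊗ₜ[L] (1 : A) *
          (1 : A) ⊗ₜ[L] (MonoidAlgebra.single (Multiplicative.ofAdd (1 : ℤ)) (1 : L))
      rw [Algebra.TensorProduct.tmul_mul_tmul, mul_one, one_mul]
      simp)
  have hgl : IsGroupLikeElem L (v A x : A) := by
    refine ⟨?_, ?_⟩
    · have h1 := hv (Bialgebra.counitAlgHom L A) x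
      rw [hcounit, map_one] at h1
      exact (congrArg Units.val h1).symm
    · have h1 := hv (Bialgebra.comulAlgHom L A) x
      rw [hcomul, map_mul, hv, hv] at h1
      refine (congrArg Units.val h1).symm.trans ?_
      change (v A x : A) ⊗ₜ[L] (1 : A) * (1 : A) ⊗ₜ[L] (v A x : A) = _
      rw [Algebra.TensorProduct.tmul_mul_tmul, mul_one, one_mul]
  obtain ⟨n, hn⟩ := MonoidAlgebra.isGroupLikeElem_iff_mem_range_of.1 hgl
  have hn' : v A x = T n := Units.ext hn.symm
  refine ⟨n.toAdd, fun R _ _ _ _ a => ?_⟩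
  let φ : A →ₐ[L] R := MonoidAlgebra.lift L R (Multiplicative ℤ)
    ((Units.coeHom R).comp (zpowersHom Rˣ a))
  have hφ : ∀ k, Units.map (φ : A →* R) (T k) = a ^ k.toAdd := fun k => Units.ext (by
    change φ (MonoidAlgebra.of L _ k) = _
    rw [MonoidAlgebra.lift_of]
    rfl)
  have h1 := hv φ x
  rw [hn', hφ, hφ, toAdd_ofAdd, zpow_one] at h1
  exact h1

variable {Z : AffineAlgebraicGroup F} {K E : Type u} [CommRing K] [Algebra F K] [CommRing E]
  [Algebra F E]

/-- Over a splitting field, `s` is given by monomials. -/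
theorem InitialData.exists_matrix (I : InitialData Z K E) {n m : ℕ} {i : Fin n → K →ₐ[F] L}
    (hi : IsSplitting i) {i' : Fin m → E →ₐ[F] L} (hi' : IsSplitting i') :
    ∃ A : Matrix (Fin n) (Fin m) ℤ, ∀ (R : Type u) [CommRing R] [Algebra F R] [Algebra L R]
      [IsScalarTower F L R] (t : ResPts F K R),
      hi'.unitsEquiv R (I.s R t) = zpowMatrix A Rˣ (hi.unitsEquiv R t) := by
  have h1 : ∀ a c, ∃ k : ℤ, ∀ (R : Type u) [CommRing R] [Algebra F R] [Algebra L R]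
      [IsScalarTower F L R] (x : Rˣ),
      hi'.unitsEquiv R (I.s R ((hi.unitsEquiv R).symm (Pi.mulSingle a x))) c = x ^ k := by
    intro a c
    refine exists_zpow_of_natural (F := F) (L := L) (fun R _ _ _ _ =>
      (Pi.evalMonoidHom _ c).comp (((hi'.unitsEquiv R).toMonoidHom.comp (I.s R)).comp
        ((hi.unitsEquiv R).symm.toMonoidHom.comp (MonoidHom.mulSingle _ a)))) ?_
    intro R S _ _ _ _ _ _ _ _ φ x
    change hi'.unitsEquiv S (I.s S ((hi.unitsEquiv S).symm (Pi.mulSingle a _))) c =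
      Units.map _ (hi'.unitsEquiv R (I.s R ((hi.unitsEquiv R).symm (Pi.mulSingle a x))) c)
    have h2 : (Pi.mulSingle a (Units.map (φ : R →* S) x) : Fin n → Sˣ) =
        fun b => Units.map (φ : R →* S) ((Pi.mulSingle a x : Fin n → Rˣ) b) :=
      funext fun b => (Pi.apply_mulSingle (fun _ => Units.map (φ : R →* S))
        (fun _ => map_one _) a x b).symm
    rw [h2, ← hi.resMap_unitsEquiv_symm, I.s_natural, hi'.unitsEquiv_resMap]
  choose A hA using h1
  refine ⟨Matrix.of A, fun R _ _ _ _ t => ?_⟩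
  obtain ⟨w, rfl⟩ := (hi.unitsEquiv R).symm.surjective t
  rw [MulEquiv.apply_symm_apply]
  funext c
  conv_lhs => rw [← Finset.univ_prod_mulSingle w]
  rw [map_prod, map_prod, map_prod, Finset.prod_apply]
  exact Finset.prod_congr rfl fun a _ => hA a c R (w a)

end Monomials

/-! ### Rational points of quotients of tori -/

section Descent

variable {F : Type u} [Field F] {K : Type u} [CommRing K] [Algebra F K]

theorem resCoord_map {R S : Type u} [CommRing R] [Algebra F R] [CommRing S] [Algebra F S]
    (φ : R →ₐ[F] S) (l : K →ₗ[F] F) (x : K ⊗[F] R) :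
    resCoord K S l (Algebra.TensorProduct.map (AlgHom.id F K) φ x) = φ (resCoord K R l x) := by
  induction x using TensorProduct.induction_on with
  | zero => simp
  | tmul b c => simp [resCoord]
  | add x y hx hy => simp only [map_add, hx, hy]

theorem sum_tmul_resCoord {ι : Type*} [Fintype ι] (b : Module.Basis ι F K) {R : Type u} [CommRing R]
    [Algebra F R] (x : K ⊗[F] R) : ∑ j, b j ⊗ₜ resCoord K R (b.coord j) x = x := by
  induction x using TensorProduct.induction_on with
  | zero => simp
  | tmul k r =>
    simp only [resCoord, LinearMap.comp_apply, LinearMap.rTensor_tmul, LinearEquiv.coe_coe,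
      TensorProduct.lid_tmul, ← TensorProduct.smul_tmul, ← TensorProduct.sum_tmul,
      Module.Basis.coord_apply, b.sum_repr]
  | add x y hx hy => simp only [map_add, TensorProduct.tmul_add, Finset.sum_add_distrib, hx, hy]

theorem resMap_injective {R S : Type u} [CommRing R] [Algebra F R] [CommRing S] [Algebra F S]
    {φ : R →ₐ[F] S} (hφ : Function.Injective φ) : Function.Injective (resMap K φ) :=
  Units.map_injective
    (Module.Flat.lTensor_preserves_injective_linearMap (M := K) φ.toLinearMap hφ)

/-- Descent of points of a torus along a field extension in which the elements of the base field are
characterized by the condition `h`. -/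
theorem exists_resMap_eq [Module.Finite F K] {L S : Type u} [Field L] [Algebra F L] [CommRing S]
    [Algebra F S] {J : Type*} (φ ψ : J → L →ₐ[F] S)
    (h : ∀ x : L, (∀ j, φ j x = ψ j x) → ∃ c, algebraMap F L c = x) {t : ResPts F K L}
    (ht : ∀ j, resMap K (φ j) t = resMap K (ψ j) t) :
    ∃ t₀, resMap K (Algebra.ofId F L) t₀ = t := by
  have key : ∀ t : ResPts F K L, (∀ j, resMap K (φ j) t = resMap K (ψ j) t) →
      ∃ x : K ⊗[F] F, Algebra.TensorProduct.map (AlgHom.id F K) (Algebra.ofId F L) x = t := by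
    intro t ht
    let b := Module.finBasis F K
    have h1 : ∀ j, ∃ c, algebraMap F L c = resCoord K L (b.coord j) t := fun j => h _ fun i => by
      rw [← resCoord_map, ← resCoord_map]
      exact congrArg (fun x : ResPts F K S => resCoord K S (b.coord j) x) (ht i)
    choose c hc using h1
    refine ⟨∑ j, b j ⊗ₜ c j, ?_⟩
    rw [map_sum, ← sum_tmul_resCoord b (t : K ⊗[F] L)]
    refine Finset.sum_congr rfl fun j _ => ?_
    rw [Algebra.TensorProduct.map_tmul, ← hc]
    rfl
  obtain ⟨x, hx⟩ := key t ht
  obtain ⟨y, hy⟩ := key t⁻¹ fun j => by rw [map_inv, map_inv, ht]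
  have hinj : Function.Injective (Algebra.TensorProduct.map (AlgHom.id F K) (Algebra.ofId F L)) :=
    Module.Flat.lTensor_preserves_injective_linearMap (M := K) (Algebra.ofId F L).toLinearMap
      (algebraMap F L).injective
  have hxy : x * y = 1 := hinj (by rw [map_mul, hx, hy, map_one, Units.mul_inv])
  exact ⟨⟨x, y, hxy, by rw [mul_comm, hxy]⟩, Units.ext hx⟩

end Descent

section TorusQuotient

/-- If an endomorphism `e` with values in `A` agrees with the `N`-th power on `Y`, then every `N`-th power
`m ^ N` in `Y` differs from the element `e m` of `A` by an `N`-torsion element. -/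
theorem relIndex_ne_zero_of_endomorphism {M : Type*} [CommGroup M] {A Y : Subgroup M} {N : ℕ}
    (e : M →* M) (he : e.range ≤ A) (hY : ∀ y ∈ Y, e y = y ^ N)
    (hrange : (powMonoidHom N : M →* M).range.FiniteIndex)
    (hker : Finite (powMonoidHom N : M →* M).ker) : A.relIndex Y ≠ 0 := by
  have h1 : (powMonoidHom N : M →* M).range ⊓ Y ≤ A ⊔ (powMonoidHom N : M →* M).ker := by
    rintro y ⟨⟨m, rfl⟩, hy⟩
    have h2 : e (m ^ N) = (m ^ N) ^ N := hY _ hy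
    rw [← mul_div_cancel (e m) (powMonoidHom N m)]
    refine Subgroup.mul_mem_sup (he ⟨m, rfl⟩) ?_
    change (m ^ N / e m) ^ N = 1
    rw [div_pow, ← h2, map_pow, div_self']
  have h3 : (A ⊔ (powMonoidHom N : M →* M).ker).relIndex Y ≠ 0 := by
    refine mt (Subgroup.relIndex_eq_zero_of_le_left h1) ?_
    rw [Subgroup.inf_relIndex_right]
    exact mt Subgroup.index_eq_zero_of_relIndex_eq_zero hrange.index_ne_zero
  have h4 : A.relIndex (A ⊔ (powMonoidHom N : M →* M).ker) ≠ 0 := by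
    rw [Subgroup.relIndex_sup_left]
    exact Subgroup.index_ne_zero_of_finite
  exact Subgroup.relIndex_ne_zero_trans h4 h3

variable {F : Type u} [Field F] [CharZero F] {Z : AffineAlgebraicGroup F} {K E : Type u}
  [CommRing K] [Algebra F K] [Module.Finite F K] [Algebra.Etale F K]
  [CommRing E] [Algebra F E] [Module.Finite F E] [Algebra.Etale F E]

/-- A quasi-inverse of `T → T / j(Z)` up to isogeny, on rational points: a generalized inverse of the
integer matrix which describes `s` over a splitting field gives a homomorphism backwards, and the
norm from the splitting field makes it rational. -/
theorem InitialData.exists_endomorphism (I : InitialData Z K E) :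
    ∃ (N : ℕ) (e : ResPts F E F →* ResPts F E F), 0 < N ∧ e.range ≤ (I.s F).range ∧
      ∀ y t, I.s (AlgebraicClosure F) t = resMap E (toClosure F) y → e y = y ^ N := by
  obtain ⟨S, hS, hSK⟩ := exists_isSplitting F K
  obtain ⟨S', hS', hSE⟩ := exists_isSplitting F E
  have : Finite ↥(S ∪ S') := (hS.union hS').to_subtype
  let L₀ := FiniteGaloisIntermediateField.adjoin F (S ∪ S')
  have hL₀ : S ∪ S' ⊆ L₀.toIntermediateField := FiniteGaloisIntermediateField.subset_adjoin F _
  obtain ⟨n, i, hi⟩ := hSK L₀.toIntermediateField (Set.subset_union_left.trans hL₀)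
  obtain ⟨m, i', hi'⟩ := hSE L₀.toIntermediateField (Set.subset_union_right.trans hL₀)
  have : IsGalois F L₀.toIntermediateField := L₀.isGalois
  have : FiniteDimensional F L₀.toIntermediateField := L₀.finiteDimensional
  generalize L₀.toIntermediateField = L at *
  obtain ⟨A, hA⟩ := I.exists_matrix hi hi'
  obtain ⟨B, d, hd, hABA⟩ := exists_generalizedInverse A
  have hinj : Function.Injective (Algebra.ofId F L) := (algebraMap F L).injective
  -- the homomorphism backwards over `L`
  let r : ResPts F E F →* ResPts F K L := (hi.unitsEquiv L).symm.toMonoidHom.comp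
    ((zpowMatrix B Lˣ).comp ((hi'.unitsEquiv L).toMonoidHom.comp (resMap E (Algebra.ofId F L))))
  have hr : ∀ y t, I.s (AlgebraicClosure F) t = resMap E (toClosure F) y →
      I.s L (r y) = resMap E (Algebra.ofId F L) y ^ d := by
    intro y t hty
    refine (hi'.unitsEquiv L).injective ?_
    rw [hA]
    change zpowMatrix A Lˣ (hi.unitsEquiv L ((hi.unitsEquiv L).symm (zpowMatrix B Lˣ
      (hi'.unitsEquiv L (resMap E (Algebra.ofId F L) y))))) = _
    rw [MulEquiv.apply_symm_apply, map_pow]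
    set w := hi'.unitsEquiv L (resMap E (Algebra.ofId F L) y)
    let ψ : L →ₐ[L] AlgebraicClosure F := Algebra.ofId L (AlgebraicClosure F)
    have hψ : Function.Injective (Units.map (ψ : L →* AlgebraicClosure F)) :=
      Units.map_injective (algebraMap L (AlgebraicClosure F)).injective
    have hw : (fun a => Units.map (ψ : L →* AlgebraicClosure F) (w a)) =
        zpowMatrix A (AlgebraicClosure F)ˣ (hi.unitsEquiv (AlgebraicClosure F) t) := by
      rw [← hA, hty, ← hi'.unitsEquiv_resMap, resMap_resMap]
      congr 2
    funext c
    refine hψ ?_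
    rw [map_zpowMatrix]
    have h1 : (fun a => Units.map (ψ : L →* AlgebraicClosure F) (zpowMatrix B Lˣ w a)) =
        zpowMatrix B (AlgebraicClosure F)ˣ
          (fun a => Units.map (ψ : L →* AlgebraicClosure F) (w a)) :=
      funext fun a => map_zpowMatrix _ _ _ _
    rw [h1, hw, zpowMatrix_zpowMatrix, zpowMatrix_zpowMatrix, ← Matrix.mul_assoc, hABA,
      zpowMatrix_nsmul, ← hw, Pi.pow_apply, Pi.pow_apply, map_pow]
  have : Fintype (L ≃ₐ[F] L) := AlgEquiv.fintype F L
  -- the norm from `L` to `F`; rationality of its values is Galois descent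
  let ν : ResPts F K L →* ResPts F K L := ∏ σ : L ≃ₐ[F] L, resMap K (σ : L →ₐ[F] L)
  have hν : ∀ t, ν t = ∏ σ : L ≃ₐ[F] L, resMap K (σ : L →ₐ[F] L) t := fun t => by
    rw [MonoidHom.finsetProd_apply]
  have hνr : ∀ y, ν (r y) ∈ (resMap K (Algebra.ofId F L)).range := by
    intro y
    refine exists_resMap_eq (fun σ : L ≃ₐ[F] L => (σ : L →ₐ[F] L)) (fun _ => AlgHom.id F L)
      (fun x hx => (IsGalois.mem_range_algebraMap_iff_fixed x).2 hx) fun σ => ?_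
    have h1 : resMap K (AlgHom.id F L) (ν (r y)) = ν (r y) := Units.ext (by
      change Algebra.TensorProduct.map (AlgHom.id F K) (AlgHom.id F L) _ = _
      rw [Algebra.TensorProduct.map_id]
      rfl)
    rw [h1, hν, map_prod]
    simp only [resMap_resMap]
    exact Fintype.prod_equiv (Equiv.mulLeft σ) _ _ fun τ => rfl
  let r₀ : ResPts F E F →* ResPts F K F :=
    (MonoidHom.ofInjective (resMap_injective hinj)).symm.toMonoidHom.comp
      ((ν.comp r).codRestrict (resMap K (Algebra.ofId F L)).range hνr)
  have hr₀ : ∀ y, resMap K (Algebra.ofId F L) (r₀ y) = ν (r y) := fun y =>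
    congrArg Subtype.val ((MonoidHom.ofInjective (resMap_injective hinj)).apply_symm_apply
      ((ν.comp r).codRestrict (resMap K (Algebra.ofId F L)).range hνr y))
  refine ⟨d * Fintype.card (L ≃ₐ[F] L), (I.s F).comp r₀, Nat.mul_pos hd Fintype.card_pos, ?_,
    fun y t hty => ?_⟩
  · rintro _ ⟨y, rfl⟩
    exact ⟨r₀ y, rfl⟩
  · refine resMap_injective (K := E) hinj ?_
    rw [MonoidHom.comp_apply, ← I.s_natural, hr₀, hν, map_prod]
    simp only [I.s_natural, hr y t hty]
    rw [map_pow, pow_mul]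
    have h1 : ∀ σ : L ≃ₐ[F] L, resMap E (σ : L →ₐ[F] L) (resMap E (Algebra.ofId F L) y ^ d) =
        resMap E (Algebra.ofId F L) y ^ d := fun σ => by
      rw [map_pow, resMap_resMap]
      congr 2
      exact congrArg (resMap E) (Subsingleton.elim _ _)
    simp only [h1, Finset.prod_const, Finset.card_univ]

end TorusQuotient

/-! ### Powers in finite extensions of local fields -/

section LocalPowers

open Topology

/-- By the inverse function theorem the powers contain a neighbourhood of `1`, and modulo powers of a
scalar every element lies in a compact annulus. -/
theorem finiteIndex_range_pow_of_normedAlgebra (F E : Type*) [NontriviallyNormedField F]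
    [LocallyCompactSpace F] [NontriviallyNormedField E] [NormedAlgebra F E] [FiniteDimensional F E]
    [CharZero E] {N : ℕ} (hN : 0 < N) : (powMonoidHom N : Eˣ →* Eˣ).range.FiniteIndex := by
  have : ProperSpace E := FiniteDimensional.proper F E
  have hV : Set.range (fun x : E => x ^ N) ∈ 𝓝 (1 : E) := by
    have h1 := (hasStrictDerivAt_pow N (1 : E)).map_nhds_eq (by simpa using hN.ne')
    rw [one_pow] at h1
    rw [← h1]
    exact Filter.mem_of_superset (Filter.image_mem_map Filter.univ_mem) (Set.image_subset_range _ _)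
  obtain ⟨c, hc⟩ := NormedField.exists_one_lt_norm F
  set b : E := algebraMap F E c
  have hb : 1 < ‖b‖ := by rwa [norm_algebraMap']
  have hb0 : b ≠ 0 := norm_pos_iff.1 (one_pos.trans hb)
  let X : Set E := Metric.closedBall 0 1 ∩ {z | ‖b‖⁻¹ ≤ ‖z‖}
  have hX : IsCompact X := (isCompact_closedBall 0 1).inter_right
    (isClosed_le continuous_const continuous_norm)
  have hX0 : ∀ z ∈ X, z ≠ 0 := fun z hz => norm_pos_iff.1
    ((inv_pos.2 (one_pos.trans hb)).trans_le hz.2)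
  obtain ⟨S, hSX, hS⟩ := hX.elim_nhds_subcover
    (fun z => (fun y => z⁻¹ * y) ⁻¹' Set.range (fun x : E => x ^ N)) (fun z hz => by
      refine (continuous_const_mul z⁻¹).continuousAt.preimage_mem_nhds ?_
      rwa [inv_mul_cancel₀ (hX0 z hz)])
  let f : S × Fin N → Eˣ ⧸ (powMonoidHom N : Eˣ →* Eˣ).range := fun x =>
    QuotientGroup.mk (Units.mk0 (x.1 : E) (hX0 _ (hSX _ x.1.2)) * Units.mk0 b hb0 ^ (x.2 : ℕ))
  have hf : Function.Surjective f := by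
    intro y
    obtain ⟨y, rfl⟩ := QuotientGroup.mk_surjective y
    obtain ⟨k, hk₁, hk₂⟩ := exists_mem_Ioc_zpow (norm_pos_iff.2 y.ne_zero) hb
    have hz : (y : E) * b ^ (-(k + 1)) ∈ X := by
      have hpos : 0 < ‖b‖ ^ (k + 1) := zpow_pos (one_pos.trans hb) _
      have hn : ‖(y : E) * b ^ (-(k + 1))‖ = ‖(y : E)‖ / ‖b‖ ^ (k + 1) := by
        rw [norm_mul, norm_zpow, zpow_neg, div_eq_mul_inv]
      refine ⟨?_, ?_⟩
      · rw [mem_closedBall_zero_iff, hn]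
        exact (div_le_one hpos).2 hk₂
      · change _ ≤ ‖_‖
        rw [hn, le_div_iff₀ hpos, zpow_add_one₀ (one_pos.trans hb).ne', mul_comm,
          mul_inv_cancel_right₀ (one_pos.trans hb).ne']
        exact hk₁.le
    obtain ⟨z, hzS, x, hx⟩ : ∃ z ∈ S, ∃ x : E, x ^ N = z⁻¹ * ((y : E) * b ^ (-(k + 1))) := by
      simpa only [Set.mem_iUnion, exists_prop, Set.mem_preimage, Set.mem_range] using hS hz
    have hz0 := hX0 z (hSX z hzS)
    have hx0 : x ≠ 0 := by
      rintro rfl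
      rw [zero_pow hN.ne'] at hx
      exact mul_ne_zero (inv_ne_zero hz0) (hX0 _ hz) hx.symm
    have hNZ : (0 : ℤ) < N := by exact_mod_cast hN
    have hmod : ((k + 1) % N).toNat < N := by
      rw [Int.toNat_lt (Int.emod_nonneg _ hNZ.ne')]
      exact Int.emod_lt_of_pos _ hNZ
    refine ⟨(⟨z, hzS⟩, ⟨((k + 1) % N).toNat, hmod⟩), QuotientGroup.eq.2
      ⟨Units.mk0 x hx0 * Units.mk0 b hb0 ^ ((k + 1) / (N : ℤ)), ?_⟩⟩
    rw [eq_inv_mul_iff_mul_eq]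
    refine Units.ext ?_
    change z * b ^ ((k + 1) % N).toNat * (x * ((Units.mk0 b hb0 ^ ((k + 1) / (N : ℤ)) : Eˣ) : E)) ^ N = y
    rw [Units.val_zpow_eq_zpow_val, Units.val_mk0, mul_pow, hx, ← zpow_natCast b,
      Int.toNat_of_nonneg (Int.emod_nonneg _ hNZ.ne'), ← zpow_natCast (b ^ ((k + 1) / (N : ℤ))),
      ← zpow_mul]
    have h1 : b ^ ((k + 1) % (N : ℤ)) * b ^ ((k + 1) / (N : ℤ) * N) = b ^ (k + 1) := by
      rw [← zpow_add₀ hb0, Int.emod_add_ediv_mul]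
    calc z * b ^ ((k + 1) % (N : ℤ)) * (z⁻¹ * (y * b ^ (-(k + 1))) * b ^ ((k + 1) / (N : ℤ) * N))
        = (z * z⁻¹) * y * (b ^ ((k + 1) % (N : ℤ)) * b ^ ((k + 1) / (N : ℤ) * N)) *
          b ^ (-(k + 1)) := by ring
      _ = y := by
        rw [h1, mul_inv_cancel₀ hz0, one_mul, mul_assoc, ← zpow_add₀ hb0, add_neg_cancel, zpow_zero,
          mul_one]
  have := Finite.of_surjective f hf
  exact Subgroup.finiteIndex_of_finite_quotient

variable (F : Type u) [Field F] [ValuativeRel F] [TopologicalSpace F] [IsNonarchimedeanLocalField F]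

theorem finiteIndex_range_pow_of_field [CharZero F] (E : Type*) [Field E] [Algebra F E]
    [FiniteDimensional F E] {N : ℕ} (hN : 0 < N) :
    (powMonoidHom N : Eˣ →* Eˣ).range.FiniteIndex := by
  let := IsTopologicalAddGroup.rightUniformSpace F
  have := isUniformAddGroup_of_addCommGroup (G := F)
  let : (Valued.v (R := F)).RankOne :=
    { hom' := ValuativeRel.IsRankLeOne.nonempty.some.emb (R := F).comp
        MonoidWithZeroHom.ValueGroup₀.embedding
      strictMono' := ValuativeRel.IsRankLeOne.nonempty.some.strictMono.comp
        MonoidWithZeroHom.ValueGroup₀.embedding_strictMono }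
  let : NontriviallyNormedField F :=
    Valued.toNontriviallyNormedField F (ValuativeRel.ValueGroupWithZero F)
  let : NontriviallyNormedField E := spectralNorm.nontriviallyNormedField F E
  let : NormedAlgebra F E := spectralNorm.normedAlgebra F E
  have : CharZero E := charZero_of_injective_algebraMap (algebraMap F E).injective
  exact finiteIndex_range_pow_of_normedAlgebra F E hN

theorem MulEquiv.finiteIndex_range_pow {M M' : Type*} [CommGroup M] [CommGroup M'] (e : M ≃* M')
    {N : ℕ} (h : (powMonoidHom N : M →* M).range.FiniteIndex) :
    (powMonoidHom N : M' →* M').range.FiniteIndex := by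
  rw [← e.map_range_powMonoidHom]
  exact ⟨by rw [Subgroup.index_map_of_bijective e.bijective]; exact h.index_ne_zero⟩

theorem MulEquiv.finite_ker_pow {M M' : Type*} [CommGroup M] [CommGroup M'] (e : M ≃* M')
    {N : ℕ} (h : Finite (powMonoidHom N : M →* M).ker) : Finite (powMonoidHom N : M' →* M').ker := by
  refine Finite.of_injective (fun x => (⟨e.symm x, ?_⟩ : (powMonoidHom N : M →* M).ker)) ?_
  · have hx : (x : M') ^ N = 1 := x.2
    change e.symm x ^ N = 1
    rw [← map_pow, hx, map_one]
  · exact fun x y h => Subtype.ext (e.symm.injective (congrArg Subtype.val h))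

theorem finite_ker_pow_units (E : Type*) [Field E] {N : ℕ} (hN : 0 < N) :
    Finite (powMonoidHom N : Eˣ →* Eˣ).ker := by
  have : NeZero N := ⟨hN.ne'⟩
  exact inferInstanceAs (Finite (rootsOfUnity N E))

/-- A finite étale algebra is a product of finite separable extensions of `F`, for each of which the
statement holds. -/
theorem finite_powers_resPts [CharZero F] (E : Type u) [CommRing E] [Algebra F E]
    [Module.Finite F E] [Algebra.Etale F E] {N : ℕ} (hN : 0 < N) :
    (powMonoidHom N : ResPts F E F →* ResPts F E F).range.FiniteIndex ∧
      Finite (powMonoidHom N : ResPts F E F →* ResPts F E F).ker := by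
  obtain ⟨ι, _, D, _, _, e, he⟩ := (Algebra.FormallyEtale.iff_exists_algEquiv_prod F E).1 inferInstance
  have hD : ∀ i, FiniteDimensional F (D i) := fun i =>
    Module.Finite.of_surjective ((LinearMap.proj i).comp e.toLinearMap)
      ((Function.surjective_eval i).comp e.surjective)
  let e' : (∀ i, (D i)ˣ) ≃* ResPts F E F := (MulEquiv.piUnits.symm.trans
    (Units.mapEquiv e.symm.toRingEquiv.toMulEquiv)).trans
      (Units.mapEquiv (Algebra.TensorProduct.rid F F E).symm.toRingEquiv.toMulEquiv)
  constructor
  · refine e'.finiteIndex_range_pow ?_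
    have : ∀ i, Finite ((D i)ˣ ⧸ (powMonoidHom N : (D i)ˣ →* (D i)ˣ).range) := fun i => by
      have := finiteIndex_range_pow_of_field F (D i) hN
      exact Subgroup.finite_quotient_of_finiteIndex
    have := Finite.of_equiv _
      (QuotientGroup.mulEquivPiModRangePowMonoidHom (fun i => (D i)ˣ) N).symm.toEquiv
    exact Subgroup.finiteIndex_of_finite_quotient
  · refine e'.finite_ker_pow ?_
    have : ∀ i, Finite (powMonoidHom N : (D i)ˣ →* (D i)ˣ).ker := fun i =>
      finite_ker_pow_units (D i) hN
    refine Finite.of_injective (fun x i => (⟨x.1 i, congrFun x.2 i⟩ :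
      (powMonoidHom N : (D i)ˣ →* (D i)ˣ).ker)) fun x y h => ?_
    exact Subtype.ext (funext fun i => congrArg Subtype.val (congrFun h i))

end LocalPowers

/-! ### Finiteness of the index in characteristic zero -/

section FiniteIndex

namespace SimGroup

variable {F : Type u} [Field F] {Z G : AffineAlgebraicGroup F} {K E : Type u} [CommRing K]
  [Algebra F K] [CommRing E] [Algebra F E] {ζ : CentralSubgroup Z G} {I : InitialData Z K E}

/-- The values of the similitude character are rational. -/
theorem exists_resMap_eq_sim [Module.Finite F E] (x : SimGroup ζ I) :
    ∃ y : ResPts F E F, resMap E (toClosure F) y = sim ζ I x := by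
  refine exists_resMap_eq (fun _ : Unit => inclL F) (fun _ => inclR F)
    (fun a ha => exists_algebraMap_eq (ha ())) fun _ => ?_
  have h1 : ∀ (φ : AlgebraicClosure F →ₐ[F] AlgebraicClosure F ⊗[F] AlgebraicClosure F),
      resMap E φ (sim ζ I x) = preSimChar ζ I _ (preSimMap ζ I φ (incl ζ I x)) := by
    intro φ
    obtain ⟨g, t, hx⟩ := exists_rep x
    rw [sim_eq hx, hx, ← I.s_natural]
    rfl
  rw [h1, h1, preSimMap_incl]

variable [ValuativeRel F] [TopologicalSpace F] [IsNonarchimedeanLocalField F] [CharZero F]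
  [Module.Finite F K] [Algebra.Etale F K] [Module.Finite F E] [Algebra.Etale F E]

/-- The similitude character `θ` has rational values in the image of `T`, and two elements with the same
value differ by an element of `G(F)`. So the index is bounded by that of the group of values of `T(F)`
in the group of rational points of the image of `T`. -/
theorem finiteIndex_range_proj (ζ : CentralSubgroup Z G) (I : InitialData Z K E) :
    (proj ζ I).range.FiniteIndex := by
  have hinj : Function.Injective (resMap E (toClosure F)) := resMap_injective toClosure_injective
  let θ : SimGroup ζ I →* ResPts F E F := (MonoidHom.ofInjective hinj).symm.toMonoidHom.comp
    ((sim ζ I).codRestrict (resMap E (toClosure F)).range exists_resMap_eq_sim)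
  have hθ : ∀ x, resMap E (toClosure F) (θ x) = sim ζ I x := fun x =>
    congrArg Subtype.val ((MonoidHom.ofInjective hinj).apply_symm_apply
      ((sim ζ I).codRestrict (resMap E (toClosure F)).range exists_resMap_eq_sim x))
  let Y : Subgroup (ResPts F E F) := (I.s (AlgebraicClosure F)).range.comap (resMap E (toClosure F))
  have hY : (I.s F).range.relIndex Y ≠ 0 := by
    obtain ⟨N, e, hN, he, heY⟩ := I.exists_endomorphism
    obtain ⟨h1, h2⟩ := finite_powers_resPts F E hN
    refine relIndex_ne_zero_of_endomorphism e he ?_ h1 h2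
    rintro y ⟨t, ht⟩
    exact heY y t ht
  have hrange : θ.range ≤ Y := by
    rintro _ ⟨x, rfl⟩
    obtain ⟨g, t, hx⟩ := exists_rep x
    exact ⟨t, by rw [hθ, sim_eq hx]⟩
  have hfin : ((I.s F).range.comap θ).FiniteIndex :=
    ⟨by
      rw [Subgroup.index_comap]
      exact mt (Subgroup.relIndex_eq_zero_of_le_right hrange) hY⟩
  refine Subgroup.finiteIndex_of_le (H := (I.s F).range.comap θ) ?_
  rintro x ⟨t, ht⟩
  obtain ⟨g, hg⟩ : ∃ g, proj ζ I (g, 1) = x * (proj ζ I (1, t))⁻¹ := by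
    refine exists_proj_eq_of_sim_eq_one ?_
    rw [map_mul, map_inv, sim_proj, ht, hθ, mul_inv_cancel]
  refine ⟨(g, t), ?_⟩
  rw [proj_eq_mul, hg, inv_mul_cancel_right]

end SimGroup

theorem DualPair.finiteIndex_of_charZero {F : Type u} [Field F] [ValuativeRel F]
    [TopologicalSpace F] [IsNonarchimedeanLocalField F] [CharZero F] (P : DualPair F)
    {K E : Type u} [CommRing K] [Algebra F K] [Module.Finite F K] [Algebra.Etale F K]
    [CommRing E] [Algebra F E] [Module.Finite F E] [Algebra.Etale F E]
    (I : InitialData P.Z K E) : P.FiniteIndex I :=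
  ⟨mt Subgroup.index_eq_zero_of_relIndex_eq_zero
      (SimGroup.finiteIndex_range_proj P.ζG I).index_ne_zero,
    mt Subgroup.index_eq_zero_of_relIndex_eq_zero
      (SimGroup.finiteIndex_range_proj P.ζH I).index_ne_zero⟩

end FiniteIndex

theorem proposition5p1 {F : Type u} [Field F] [ValuativeRel F] [TopologicalSpace F]
    [IsNonarchimedeanLocalField F]
    (P : DualPair F)
    {K E : Type u} [CommRing K] [Algebra F K] [Module.Finite F K] [Algebra.Etale F K]
    [CommRing E] [Algebra F E] [Module.Finite F E] [Algebra.Etale F E]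
    (I : InitialData P.Z K E)
    (hfin : CharZero F ∨ P.FiniteIndex I)
    {Ω : Type u} [AddCommGroup Ω] [Module ℂ Ω]
    (ω : Representation ℂ (P.𝓔.Pts F) Ω) (hω : IsSmoothRep ω) :
    P.HoweDuality ω ↔ P.SimilitudeHoweDuality I ω :=
  P.howeDuality_iff I (hfin.elim (fun _ => P.finiteIndex_of_charZero I) id) ω hω

end
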